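/- Let $m\ge 1$ be an integer, $r>0$, $\Delta_r=\{|w|<r\}$, and let $P,Q$ be holomorphic in $\Delta_r$. Consider the $m$-admissible ODE $$\mathcal E:\quad z''=\frac{P(w)}{w^m}\,z'+\frac{Q(w)}{w^{2m}}\,z .$$ Definitions. A positive $m$-admissible Segre family is a family of curves $$Q_{(\xi,\eta)}=\{w=\bar\eta\, e^{i\bar\eta^{m-1}\psi(z\bar\xi,\bar\eta)}\},\qquad (\xi,\eta)\in\Delta_\delta\times\Delta_\varepsilon,$$ where $\delta,\varepsilon>0$ and $\psi(x,y)=x+\sum_{k\ge2}\psi_k(y)x^k$ is holomorphic in $\Delta_{\delta^2}\times\Delta_\varepsilon$. It is associated with $\mathcal E$ if, after shrinking $\Delta_\delta\times\Delta_\varepsilon$, every curve $Q_{(\xi,\eta)}$ with $\eta\ne0$, considered as a graph $w=w(z)$, satisfies the inverse ODE $w''=-\frac{P(w)}{w^m}(w')^2-\frac{Q(w)}{w^{2m}}(w')^3z$. A positive $m$-admissible hypersurface is a germ at $0$ of a real-analytic hypersurface $M\subset\mathbb C^2$ of the form $$v=u^m\Big(\tfrac12|z|^2+\sum_{k\ge2}h_k(u)|z|^{2k}\Big),\qquad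 w=u+iv .$$ If $\phi(Z,\bar Z)=0$ is a real-analytic defining equation of $M$ near $0$, the Segre family of $M$ consists of the curves $\{Z:\phi(Z,\bar\zeta)=0\}$, for $\zeta$ near $0$. The hypersurface $M$ is (positively) associated with $\mathcal E$ if its Segre family is, near the origin, a positive $m$-admissible Segre family associated with $\mathcal E$; and $\mathcal E$ has a positive real structure if such an $M$ exists. Finally, $M$ is spherical at $p\in M$ if some local biholomorphism at $p$ maps $M$ near $p$ onto an open piece of the unit sphere in $\mathbb C^2$. Theorem 3.15. The ODE $\mathcal E$ has a positive real structure if and only if $$P(w)=2i\,a(w)-m\,w^{m-1},\qquad Q(w)=b(w)+i\,w^m a'(w)\qquad(w\in\Delta_r),$$ where $a(w)=\sum_{j\ge0}a_jw^j$ and $b(w)=\sum_{j\ge0}b_jw^j$ are power series with real coefficients that converge in $\Delta_r$. Moreover, if $\mathcal E$ has a positive real structure, then every hypersurface $M$ associated with $\mathcal E$ is, in a neighbourhood of the origin, Levi nondegenerate and spherical at each of its points outside the complex locus $X=\{w=0\}$. -/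

import Mathlib

open scoped Topology ComplexConjugate

/-! Coordinates in `ℂ × ℂ` are `(z, w)`; `u = Re w`, `v = Im w`. -/

/-- `a` is the sum, on the disc of radius `r`, of a power series with real coefficients that
converges there. -/
def IsRealPowerSeriesOn (a : ℂ → ℂ) (r : ℝ) : Prop :=
  ∃ c : ℕ → ℝ, ∀ w ∈ Metric.ball (0 : ℂ) r, HasSum (fun j : ℕ => (c j : ℂ) * w ^ j) (a w)

/-- The data of a positive admissible Segre family: a holomorphic function `ψ` on the polydisc
`|x| < δ², |y| < ε` with `ψ(x, y) = x + ∑_{k ≥ 2} ψ_k(y) x ^ k`, that is, `ψ(0, y) = 0` and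
`∂ψ/∂x (0, y) = 1` for all `y` (the `ψ_k` are then automatically holomorphic). -/
structure PositiveSegreFamily where
  δ : ℝ
  ε : ℝ
  δ_pos : 0 < δ
  ε_pos : 0 < ε
  ψ : ℂ × ℂ → ℂ
  holo : DifferentiableOn ℂ ψ (Metric.ball 0 (δ ^ 2) ×ˢ Metric.ball 0 ε)
  psi_zero : ∀ y ∈ Metric.ball (0 : ℂ) ε, ψ (0, y) = 0
  psi_deriv : ∀ y ∈ Metric.ball (0 : ℂ) ε, HasDerivAt (fun x : ℂ => ψ (x, y)) 1 0

/-- The Segre variety of the point `p = (ξ, η)` in the positive `m`-admissible Segre family given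
by `S`, as the graph `w = η̄ exp (i η̄ ^ (m - 1) ψ(z ξ̄, η̄))` of a function of `z`. -/
noncomputable def PositiveSegreFamily.graph (S : PositiveSegreFamily) (m : ℕ) (p : ℂ × ℂ)
    (z : ℂ) : ℂ :=
  conj p.2 * Complex.exp (Complex.I * (conj p.2) ^ (m - 1) * S.ψ (z * conj p.1, conj p.2))

/-- The function `w(z)` satisfies at `z` the inverse ODE
`w'' = - (P(w) / w ^ m) (w') ^ 2 - (Q(w) / w ^ (2 m)) (w') ^ 3 z` of the `m`-admissible ODE
`z'' = (P(w) / w ^ m) z' + (Q(w) / w ^ (2 m)) z`. -/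
def SatisfiesInverseODEAt (m : ℕ) (P Q : ℂ → ℂ) (w : ℂ → ℂ) (z : ℂ) : Prop :=
  deriv (deriv w) z =
    -(P (w z) / (w z) ^ m) * (deriv w z) ^ 2 - Q (w z) / (w z) ^ (2 * m) * (deriv w z) ^ 3 * z

/-- The positive `m`-admissible Segre family `S` is associated with the `m`-admissible ODE given by
`P, Q`: after shrinking the polydisc, all Segre varieties of points off `{w = 0}`, considered as
graphs `w = w(z)`, satisfy the inverse ODE. -/
def PositiveSegreFamily.IsAssociatedWithODE (S : PositiveSegreFamily) (m : ℕ) (P Q : ℂ → ℂ) :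
    Prop :=
  ∃ δ' ε' : ℝ, 0 < δ' ∧ δ' ≤ S.δ ∧ 0 < ε' ∧ ε' ≤ S.ε ∧
    ∀ p : ℂ × ℂ, p.1 ∈ Metric.ball 0 δ' → p.2 ∈ Metric.ball 0 ε' → p.2 ≠ 0 →
      ∀ z ∈ Metric.ball (0 : ℂ) δ', S.graph m p z ∈ Metric.ball 0 ε' →
        SatisfiesInverseODEAt m P Q (S.graph m p) z

/-- `g` is a real-analytic local defining function of the set `M ⊆ ℂ²` at its point `p`; so `M` is
near `p` a smooth real-analytic real hypersurface. -/
structure IsDefiningFunctionAt (M : Set (ℂ × ℂ)) (p : ℂ × ℂ) (g : ℂ × ℂ → ℝ) : Prop where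
  mem : p ∈ M
  analytic : AnalyticAt ℝ g p
  fderiv_ne_zero : fderiv ℝ g p ≠ 0
  mem_iff : ∀ᶠ q in 𝓝 p, q ∈ M ↔ g q = 0

/-- The family of curves `{w = ρ(ζ, z)}`, indexed by points `ζ` near the origin of `ℂ²`, is the
Segre family of `M` at the origin. Here `φ(Z, Z̄)` is a real-analytic defining function of `M`,
`φ` being its complexification, and the Segre variety of `ζ` is `{Z : φ(Z, ζ̄) = 0}`. -/
def IsSegreFamilyOf (ρ : ℂ × ℂ → ℂ → ℂ) (M : Set (ℂ × ℂ)) : Prop :=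
  ∃ (φ : (ℂ × ℂ) × (ℂ × ℂ) → ℂ) (g : ℂ × ℂ → ℝ),
    AnalyticAt ℂ φ 0 ∧ IsDefiningFunctionAt M 0 g ∧
    (∀ᶠ Z : ℂ × ℂ in 𝓝 0, φ (Z, (conj Z.1, conj Z.2)) = (g Z : ℂ)) ∧
    ∀ᶠ q : (ℂ × ℂ) × (ℂ × ℂ) in 𝓝 0,
      φ (q.1, (conj q.2.1, conj q.2.2)) = 0 ↔ q.1.2 = ρ q.2 q.1.1

/-- `M` is, near the origin, a positive `m`-admissible nonminimal real hypersurface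
`v = u ^ m (|z|² / 2 + ∑_{k ≥ 2} h_k(u) |z| ^ (2 k))`; here `H(x, u)` is the real-analytic function
`x / 2 + ∑_{k ≥ 2} h_k(u) x ^ k`. The coefficient `1/2` is the one for which the Segre family is
`w = η̄ + i η̄ ^ m z ξ̄ + O(z² ξ̄²)`. -/
def IsPositiveAdmissibleHypersurface (m : ℕ) (M : Set (ℂ × ℂ)) : Prop :=
  ∃ H : ℝ × ℝ → ℝ, AnalyticAt ℝ H 0 ∧
    (∀ᶠ u : ℝ in 𝓝 0, H (0, u) = 0 ∧ HasDerivAt (fun x : ℝ => H (x, u)) (1 / 2) 0) ∧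
    ∀ᶠ q : ℂ × ℂ in 𝓝 0, q ∈ M ↔ q.2.im = q.2.re ^ m * H (‖q.1‖ ^ 2, q.2.re)

/-- `M` is a real hypersurface associated with the `m`-admissible ODE given by `P, Q`: it is a
positive `m`-admissible hypersurface whose Segre family is the positive `m`-admissible Segre family
associated with the ODE. -/
def IsPositivelyAssociatedHypersurface (m : ℕ) (P Q : ℂ → ℂ) (M : Set (ℂ × ℂ)) : Prop :=
  IsPositiveAdmissibleHypersurface m M ∧
    ∃ S : PositiveSegreFamily, S.IsAssociatedWithODE m P Q ∧ IsSegreFamilyOf (S.graph m) M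

/-- The `m`-admissible ODE given by `P, Q` has a positive real structure. -/
def HasPositiveRealStructure (m : ℕ) (P Q : ℂ → ℂ) : Prop :=
  ∃ M : Set (ℂ × ℂ), IsPositivelyAssociatedHypersurface m P Q M

/-- The Levi form `∑ (∂²g / ∂Z_j ∂Z̄_k)(p) t_j t̄_k`, i.e. the value at `0` of the `∂²/∂s∂s̄` derivative
of `s ↦ g(p + s t)`, written through the real second derivative. -/
noncomputable def leviForm (g : ℂ × ℂ → ℝ) (p t : ℂ × ℂ) : ℝ :=
  (fderiv ℝ (fderiv ℝ g) p t t +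
    fderiv ℝ (fderiv ℝ g) p (Complex.I • t) (Complex.I • t)) / 4

/-- Levi nondegeneracy of a real hypersurface `M ⊆ ℂ²` at `p`: the Levi form is nondegenerate on
the complex tangent space (which has complex dimension one). -/
def IsLeviNondegenerateAt (M : Set (ℂ × ℂ)) (p : ℂ × ℂ) : Prop :=
  ∃ g : ℂ × ℂ → ℝ, IsDefiningFunctionAt M p g ∧
    ∀ t : ℂ × ℂ, t ≠ 0 → fderiv ℝ g p t = 0 → fderiv ℝ g p (Complex.I • t) = 0 →
      leviForm g p t ≠ 0

/-- `M ⊆ ℂ²` is spherical at its point `p`: some local biholomorphism at `p` maps `M` near `p` onto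
an open piece of the unit sphere. -/
def IsSphericalAt (M : Set (ℂ × ℂ)) (p : ℂ × ℂ) : Prop :=
  p ∈ M ∧ ∃ Φ : ℂ × ℂ → ℂ × ℂ, AnalyticAt ℂ Φ p ∧ Function.Bijective (fderiv ℂ Φ p) ∧
    ∀ᶠ q in 𝓝 p, q ∈ M ↔ ‖(Φ q).1‖ ^ 2 + ‖(Φ q).2‖ ^ 2 = 1

/-!
The equation is singular along `{w = 0}`, but it becomes regular in the logarithmic coordinate
based at a point `y ≠ 0`, that is, the parameter `s` of `w = y exp (i y ^ n s)`, where
`n = m - 1` (`logPoint`): there it reads `X'' = A X' + B X`, with coefficients `A`, `B` that are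
holomorphic in `(s, y)` even at `y = 0` (`logCoeffA`, `logCoeffB`). A Segre variety
`w = y exp (i y ^ n ψ (z ξ̄, y))`, `y = η̄`, satisfies the inverse ODE if and only if `ψ (·, y)` is the
inverse of the solution `X (·, y)` with `X = 0`, `X' = 1` at `s = 0`
(`satisfiesInverseODEAt_logPoint_iff`). So every equation has exactly one positive Segre family, and
the question is when this family is the Segre family of a real hypersurface.

It is if and only if it is symmetric under exchange of the two points, and by the identity theorem
real base points `u` suffice. There the symmetry says that the solution based at the point
`logPoint n t u`, evaluated at `s = 0`, is `conj (X (- conj t, u))`. The left side, as a function of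
`t`, solves the (rescaled) adjoint of the equation based at `u`; this follows from the Lagrange identity
(`adjoint_pairing_const`, `IsLogSolution.adjoint_eq`). The right side solves the reflected equation
(`IsLogSolution.hasDerivAt_reflect`). Comparing coefficients, the two equations agree if and only if
`P = 2 i a - m w ^ (m - 1)` and `Q = b + i w ^ m a'` with `a` and `b` real on the real axis
(`exists_real_form_of_reflection` in one direction,
`IsLogSolution.baseChange_zero_eq` and `IsLogSolution.eventually_logPoint_symm` in the other).
In the latter case the complex equation `w = logPoint n (ψ (z ξ̄, η̄)) η̄` is solved for
`(w - η̄) / 2 i` as a function of `(w + η̄) / 2`, and the symmetry makes the result real: this is the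
hypersurface (`exists_graph_function`, `PositiveSegreFamily.exists_hypersurface`).

For sphericity, let `Y` be the solution with initial values `1, 0`. The same duality writes the
equation of `M` near a point with real part `u ≠ 0` of its `w`-coordinate as
`|z|² = 2 Re (Y conj X) - 2 a(u) |X|²` (`IsLogSolution.baseChange_eq`). With `e = Y - a(u) X` this is
`|√2 z|² + |e - X|² = |e + X|²` (`exists_mem_iff_sphere`), so the map `Φ` with components
`√2 z / (e + X)` and `(e - X) / (e + X)` takes `M` to the sphere (`eventually_isSphericalAt`). Levi
nondegeneracy is read off from the defining function `‖Φ‖² - 1`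
(`IsSphericalAt.isLeviNondegenerateAt`).
-/

/-! ### Power series in two complex variables -/

theorem mk_mem_ball_zero {s y : ℂ} {ρ : ℝ} :
    (s, y) ∈ Metric.ball (0 : ℂ × ℂ) ρ ↔ s ∈ Metric.ball (0 : ℂ) ρ ∧ y ∈ Metric.ball (0 : ℂ) ρ := by
  rw [← Prod.mk_zero_zero, ← ball_prod_same]; rfl

/-- A power series in `s` whose coefficients are holomorphic functions of `y` with geometric bounds
is jointly analytic at the origin: it is the pairing of two Banach-valued holomorphic functions of
one variable, `s ↦ ∑ s ^ k • (Taylor coefficients of x k)` and `y ↦ (evaluation of a sequence of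
Taylor coefficients at y)`. -/
theorem analyticAt_tsum_mul_pow {x : ℕ → ℂ → ℂ} {C K R : ℝ} (hK : 0 < K) (hR : 0 < R)
    (hC : 0 ≤ C) (hd : ∀ k, DifferentiableOn ℂ (x k) (Metric.ball 0 R))
    (hb : ∀ k, ∀ y ∈ Metric.ball (0 : ℂ) R, ‖x k y‖ ≤ C * K ^ k) :
    AnalyticAt ℂ (fun p : ℂ × ℂ => ∑' k, x k p.2 * p.1 ^ k) 0 := by
  set T : ℝ := R / 2 with hT
  have hT0 : 0 < T := by positivity
  set c : ℕ → ℕ → ℂ := fun k l => (l.factorial : ℂ)⁻¹ * iteratedDeriv l (x k) 0 with hc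
  have hcb : ∀ k l, ‖c k l * (T : ℂ) ^ l‖ ≤ C * K ^ k := by
    intro k l
    have h := Complex.norm_iteratedDeriv_le_of_forall_mem_sphere_norm_le (f := x k) (c := 0) l hT0
      (C := C * K ^ k) ?_ ?_
    · simp only [hc, norm_mul, norm_inv, norm_pow, Complex.norm_natCast, Complex.norm_real,
        Real.norm_eq_abs, abs_of_pos hT0]
      have hl : (0 : ℝ) < l.factorial := by positivity
      calc (l.factorial : ℝ)⁻¹ * ‖iteratedDeriv l (x k) 0‖ * T ^ l
          ≤ (l.factorial : ℝ)⁻¹ * (l.factorial * (C * K ^ k) / T ^ l) * T ^ l := by gcongr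
        _ = C * K ^ k := by field_simp
    · refine ((hd k).mono ?_).diffContOnCl_ball (U := Metric.ball 0 R) ?_
      · exact subset_rfl
      · exact Metric.closedBall_subset_ball (by rw [hT]; linarith)
    · intro z hz
      refine hb k z ?_
      rw [mem_sphere_zero_iff_norm] at hz
      rw [mem_ball_zero_iff, hz, hT]; linarith
  set v : ℕ → BoundedContinuousFunction ℕ ℂ := fun k =>
    BoundedContinuousFunction.ofNormedAddCommGroupDiscrete (fun l => c k l * (T : ℂ) ^ l)
      (C * K ^ k) (hcb k) with hv
  have hvn : ∀ k, ‖v k‖ ≤ C * K ^ k := fun k =>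
    BoundedContinuousFunction.norm_le (by positivity) |>.2 (hcb k)
  set G : ℂ → BoundedContinuousFunction ℕ ℂ := fun s => ∑' k, s ^ k • v k with hG
  set L : ℂ → (BoundedContinuousFunction ℕ ℂ →L[ℂ] ℂ) := fun y =>
    ∑' l, (y / T) ^ l • BoundedContinuousFunction.evalCLM ℂ l with hL
  have hgeom : Summable fun k : ℕ => C * (1 / 2 : ℝ) ^ k :=
    (summable_geometric_of_lt_one (by norm_num) (by norm_num)).mul_left C
  have hGb : ∀ (k : ℕ) (s : ℂ), s ∈ Metric.ball (0 : ℂ) (1 / (2 * K)) →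
      ‖s ^ k • v k‖ ≤ C * (1 / 2 : ℝ) ^ k := by
    intro k s hs
    rw [mem_ball_zero_iff] at hs
    rw [norm_smul, norm_pow]
    calc ‖s‖ ^ k * ‖v k‖ ≤ (1 / (2 * K)) ^ k * (C * K ^ k) := by
          gcongr
          exact hvn k
      _ = C * (1 / 2 : ℝ) ^ k := by
          rw [mul_left_comm, ← mul_pow]; congr 2; field_simp
  have hgeom1 : Summable fun k : ℕ => (1 / 2 : ℝ) ^ k :=
    summable_geometric_of_lt_one (by norm_num) (by norm_num)
  have heval : ∀ l : ℕ, ‖(BoundedContinuousFunction.evalCLM ℂ l :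
      BoundedContinuousFunction ℕ ℂ →L[ℂ] ℂ)‖ ≤ 1 := fun l =>
    ContinuousLinearMap.opNorm_le_bound _ zero_le_one fun f => by
      simpa using f.norm_coe_le_norm l
  have hLb : ∀ (l : ℕ) (y : ℂ), y ∈ Metric.ball (0 : ℂ) (T / 2) →
      ‖(y / T) ^ l • (BoundedContinuousFunction.evalCLM ℂ l :
        BoundedContinuousFunction ℕ ℂ →L[ℂ] ℂ)‖ ≤ (1 / 2 : ℝ) ^ l := by
    intro l y hy
    rw [mem_ball_zero_iff] at hy
    rw [norm_smul, norm_pow, norm_div, Complex.norm_real, Real.norm_eq_abs, abs_of_pos hT0]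
    calc (‖y‖ / T) ^ l * _ ≤ ((T / 2) / T) ^ l * 1 := by
          gcongr
          exact heval l
      _ = (1 / 2 : ℝ) ^ l := by rw [mul_one]; congr 1; field_simp
  have hGan : AnalyticAt ℂ G 0 := by
    refine (Complex.differentiableOn_tsum_of_summable_norm hgeom (fun k => ?_)
      Metric.isOpen_ball hGb).analyticAt (Metric.ball_mem_nhds _ (by positivity))
    exact ((differentiable_id.pow k).smul_const (v k)).differentiableOn
  have hLan : AnalyticAt ℂ L 0 := by
    refine (Complex.differentiableOn_tsum_of_summable_norm hgeom1 (fun l => ?_)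
      Metric.isOpen_ball hLb).analyticAt (Metric.ball_mem_nhds _ (by positivity))
    exact (((differentiable_id.div_const (T : ℂ)).pow l).smul_const _).differentiableOn
  have hpair : AnalyticAt ℂ (fun p : ℂ × ℂ => L p.2 (G p.1)) 0 := by
    have h1 : AnalyticAt ℂ (fun p : ℂ × ℂ => L p.2) 0 :=
      AnalyticAt.fun_comp (f := fun p : ℂ × ℂ => p.2) (g := L) hLan analyticAt_snd
    have h2 : AnalyticAt ℂ (fun p : ℂ × ℂ => G p.1) 0 :=
      AnalyticAt.fun_comp (f := fun p : ℂ × ℂ => p.1) (g := G) hGan analyticAt_fst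
    exact AnalyticAt.fun_comp (f := fun p : ℂ × ℂ => (L p.2, G p.1))
      ((ContinuousLinearMap.id ℂ (BoundedContinuousFunction ℕ ℂ →L[ℂ] ℂ)).analyticAt_bilinear _)
      (h1.prod h2)
  refine hpair.congr ?_
  have hnhds : Metric.ball (0 : ℂ) (1 / (2 * K)) ×ˢ Metric.ball (0 : ℂ) (T / 2) ∈ 𝓝 (0 : ℂ × ℂ) :=
    prod_mem_nhds (Metric.ball_mem_nhds _ (by positivity)) (Metric.ball_mem_nhds _ (by positivity))
  filter_upwards [hnhds] with p hp
  obtain ⟨hp1, hp2⟩ := hp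
  have hsG : Summable fun k => p.1 ^ k • v k :=
    Summable.of_norm_bounded hgeom fun k => hGb k _ hp1
  have hsL : Summable fun l => (p.2 / T) ^ l • (BoundedContinuousFunction.evalCLM ℂ l :
      BoundedContinuousFunction ℕ ℂ →L[ℂ] ℂ) :=
    Summable.of_norm_bounded hgeom1 fun l => hLb l _ hp2
  have hLv : ∀ k, L p.2 (v k) = x k p.2 := by
    intro k
    have h1 : L p.2 (v k) = ∑' l, (p.2 / T) ^ l * (c k l * (T : ℂ) ^ l) :=
      (ContinuousLinearMap.apply ℂ ℂ (v k)).map_tsum hsL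
    have hp2' : p.2 ∈ Metric.ball (0 : ℂ) R :=
      Metric.ball_subset_ball (by rw [hT]; linarith) hp2
    have h2 := Complex.hasSum_taylorSeries_on_ball (hd k) hp2'
    rw [h1, ← h2.tsum_eq]
    refine tsum_congr fun l => ?_
    have hT' : (T : ℂ) ≠ 0 := by exact_mod_cast hT0.ne'
    simp only [hc, sub_zero, smul_eq_mul, div_pow]
    field_simp
  have h3 : L p.2 (G p.1) = ∑' k, L p.2 (p.1 ^ k • v k) := (L p.2).map_tsum hsG
  change L p.2 (G p.1) = _
  rw [h3]
  refine tsum_congr fun k => ?_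
  rw [map_smul, hLv, smul_eq_mul, mul_comm]

/-- The Taylor coefficients in the first variable of a holomorphic function of two variables. -/
theorem exists_coeff_of_analyticOnNhd {A : ℂ × ℂ → ℂ} {ρ M : ℝ} (hρ : 0 < ρ)
    (hA : AnalyticOnNhd ℂ A (Metric.ball 0 ρ)) (hM : ∀ p ∈ Metric.ball (0 : ℂ × ℂ) ρ, ‖A p‖ ≤ M) :
    ∃ a : ℕ → ℂ → ℂ, (∀ j, DifferentiableOn ℂ (a j) (Metric.ball 0 ρ)) ∧
      (∀ j, ∀ y ∈ Metric.ball (0 : ℂ) ρ, ‖a j y‖ ≤ M * (2 / ρ) ^ j) ∧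
      ∀ y ∈ Metric.ball (0 : ℂ) ρ, ∀ s ∈ Metric.ball (0 : ℂ) ρ,
        HasSum (fun j => a j y * s ^ j) (A (s, y)) := by
  have hmem : ∀ {s y : ℂ}, s ∈ Metric.ball (0 : ℂ) ρ → y ∈ Metric.ball (0 : ℂ) ρ →
      (s, y) ∈ Metric.ball (0 : ℂ × ℂ) ρ := fun hs hy => mk_mem_ball_zero.2 ⟨hs, hy⟩
  have hslice : ∀ {F : ℂ × ℂ → ℂ}, AnalyticOnNhd ℂ F (Metric.ball 0 ρ) →
      ∀ y ∈ Metric.ball (0 : ℂ) ρ, ∀ s ∈ Metric.ball (0 : ℂ) ρ,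
        HasDerivAt (fun s => F (s, y)) (fderiv ℂ F (s, y) (1, 0)) s := by
    intro F hF y hy s hs
    have h1 := (hF _ (hmem hs hy)).differentiableAt.hasFDerivAt
    have h2 : HasDerivAt (fun s : ℂ => (s, y)) ((1, 0) : ℂ × ℂ) s :=
      (hasDerivAt_id s).prodMk (hasDerivAt_const s y)
    exact h1.comp_hasDerivAt s h2
  have hiter : ∀ j : ℕ, ∃ F : ℂ × ℂ → ℂ, AnalyticOnNhd ℂ F (Metric.ball 0 ρ) ∧
      ∀ y ∈ Metric.ball (0 : ℂ) ρ, ∀ s ∈ Metric.ball (0 : ℂ) ρ,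
        iteratedDeriv j (fun s => A (s, y)) s = F (s, y) := by
    intro j
    induction j with
    | zero => exact ⟨A, hA, fun y _ s _ => by simp⟩
    | succ j ih =>
      obtain ⟨F, hF, hFe⟩ := ih
      refine ⟨fun p => fderiv ℂ F p (1, 0), fun p hp => ?_, fun y hy s hs => ?_⟩
      · exact ((ContinuousLinearMap.apply ℂ ℂ ((1, 0) : ℂ × ℂ)).analyticAt _).comp (hF.fderiv p hp)
      rw [iteratedDeriv_succ]
      change _ = fderiv ℂ F (s, y) (1, 0)
      rw [← (hslice hF y hy s hs).deriv]
      refine Filter.EventuallyEq.deriv_eq ?_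
      filter_upwards [Metric.isOpen_ball.mem_nhds hs] with t ht using hFe y hy t ht
  have h0 : (0 : ℂ) ∈ Metric.ball (0 : ℂ) ρ := Metric.mem_ball_self hρ
  have hds : ∀ y ∈ Metric.ball (0 : ℂ) ρ,
      DifferentiableOn ℂ (fun s => A (s, y)) (Metric.ball 0 ρ) := fun y hy s hs =>
    (hslice hA y hy s hs).differentiableAt.differentiableWithinAt
  refine ⟨fun j y => (j.factorial : ℂ)⁻¹ * iteratedDeriv j (fun s => A (s, y)) 0,
    fun j => ?_, fun j y hy => ?_, fun y hy s hs => ?_⟩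
  · obtain ⟨F, hF, hFe⟩ := hiter j
    have : DifferentiableOn ℂ (fun y => F (0, y)) (Metric.ball 0 ρ) := fun y hy =>
      ((hF _ (hmem h0 hy)).differentiableAt.comp y
        ((differentiableAt_const 0).prodMk differentiableAt_id)).differentiableWithinAt
    exact (this.congr fun y hy => hFe y hy 0 h0).const_mul _
  · have hR : 0 < ρ / 2 := by positivity
    have h := Complex.norm_iteratedDeriv_le_of_forall_mem_sphere_norm_le
      (f := fun s => A (s, y)) (c := 0) j hR (C := M) ?_ ?_
    · rw [norm_mul, norm_inv, Complex.norm_natCast]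
      have hl : (0 : ℝ) < j.factorial := by positivity
      calc (j.factorial : ℝ)⁻¹ * ‖iteratedDeriv j (fun s => A (s, y)) 0‖
          ≤ (j.factorial : ℝ)⁻¹ * (j.factorial * M / (ρ / 2) ^ j) := by gcongr
        _ = M * (2 / ρ) ^ j := by
          rw [div_pow, div_pow]; field_simp
    · exact (hds y hy).diffContOnCl_ball (Metric.closedBall_subset_ball (by linarith))
    · intro z hz
      refine hM _ (hmem ?_ hy)
      rw [mem_sphere_zero_iff_norm] at hz
      rw [mem_ball_zero_iff, hz]; linarith
  · have h := Complex.hasSum_taylorSeries_on_ball (hds y hy) hs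
    simpa [mul_comm, mul_left_comm, mul_assoc] using h

/-! ### Linear second-order equations with a holomorphic parameter -/

/-- The coefficients `(x_k, x'_k)` of the power series solution of
`x' = ∑ x'_k s ^ k`, `x'' = a x' + b x` with initial values `c₀`, `c₁`, where `a` and `b` are the
power series with coefficients `a j` and `b j`. -/
noncomputable def odeCoeff (a b : ℕ → ℂ) (c₀ c₁ : ℂ) : ℕ → ℂ × ℂ
  | 0 => (c₀, c₁)
  | k + 1 => ((odeCoeff a b c₀ c₁ k).2 / (k + 1),
      (∑ j : Fin (k + 1), ((odeCoeff a b c₀ c₁ j).2 * a (k - j) +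
        (odeCoeff a b c₀ c₁ j).1 * b (k - j))) / (k + 1))

theorem odeCoeff_succ (a b : ℕ → ℂ) (c₀ c₁ : ℂ) (k : ℕ) :
    odeCoeff a b c₀ c₁ (k + 1) = ((odeCoeff a b c₀ c₁ k).2 / (k + 1),
      (∑ j ∈ Finset.range (k + 1), ((odeCoeff a b c₀ c₁ j).2 * a (k - j) +
        (odeCoeff a b c₀ c₁ j).1 * b (k - j))) / (k + 1)) := by
  rw [odeCoeff, Finset.sum_range]

theorem norm_odeCoeff_le {a b : ℕ → ℂ} {c₀ c₁ : ℂ} {C K L M : ℝ} (hL : 0 ≤ L)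
    (hM : 0 ≤ M) (hLK : L ≤ K) (hK1 : 1 ≤ K) (hMK : 2 * M ≤ K) (ha : ∀ j, ‖a j‖ ≤ M * L ^ j)
    (hb : ∀ j, ‖b j‖ ≤ M * L ^ j) (h0 : ‖c₀‖ ≤ C) (h1 : ‖c₁‖ ≤ C) (k : ℕ) :
    ‖odeCoeff a b c₀ c₁ k‖ ≤ C * K ^ k := by
  have hC : 0 ≤ C := (norm_nonneg _).trans h0
  induction k using Nat.strong_induction_on with
  | _ k ih =>
    cases k with
    | zero => simp [odeCoeff, Prod.norm_def, h0, h1]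
    | succ k =>
      rw [odeCoeff_succ, Prod.norm_def]
      have hk : (0 : ℝ) < k + 1 := by positivity
      have hk' : ‖((k : ℂ) + 1)‖ = k + 1 := by
        rw [← Nat.cast_succ, Complex.norm_natCast]; simp
      refine max_le ?_ ?_
      · simp only [norm_div, hk']
        rw [div_le_iff₀ hk]
        calc _ ≤ C * K ^ k := (norm_snd_le _).trans (ih k (Nat.lt_succ_self k))
          _ ≤ C * K ^ k * (K * (k + 1)) := by
            refine le_mul_of_one_le_right (by positivity) ?_
            nlinarith [(k.cast_nonneg : (0 : ℝ) ≤ k)]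
          _ = C * K ^ (k + 1) * (k + 1) := by ring
      · simp only [norm_div, hk']
        rw [div_le_iff₀ hk]
        have hterm : ∀ j ∈ Finset.range (k + 1), ‖(odeCoeff a b c₀ c₁ j).2 * a (k - j) +
            (odeCoeff a b c₀ c₁ j).1 * b (k - j)‖ ≤ C * K ^ (k + 1) := by
          intro j hj
          have hj' : j < k + 1 := Finset.mem_range.1 hj
          have hx := ih j hj'
          have hak : ∀ c : ℕ → ℂ, (∀ j, ‖c j‖ ≤ M * L ^ j) → ‖c (k - j)‖ ≤ M * K ^ (k - j) :=
            fun c hc => (hc _).trans (by gcongr)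
          calc _ ≤ ‖(odeCoeff a b c₀ c₁ j).2‖ * ‖a (k - j)‖ +
                ‖(odeCoeff a b c₀ c₁ j).1‖ * ‖b (k - j)‖ := by
                refine (norm_add_le _ _).trans_eq ?_
                rw [norm_mul, norm_mul]
            _ ≤ C * K ^ j * (M * K ^ (k - j)) + C * K ^ j * (M * K ^ (k - j)) := by
                gcongr
                · exact (norm_snd_le _).trans hx
                · exact hak a ha
                · exact (norm_fst_le _).trans hx
                · exact hak b hb
            _ = C * (2 * M) * K ^ k := by
                rw [← Nat.add_sub_of_le (Nat.lt_succ_iff.1 hj'), Nat.add_sub_cancel_left, pow_add]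
                ring
            _ ≤ C * K * K ^ k := by gcongr
            _ = C * K ^ (k + 1) := by ring
        calc _ ≤ ∑ j ∈ Finset.range (k + 1), C * K ^ (k + 1) :=
              norm_sum_le_of_le _ hterm
          _ = C * K ^ (k + 1) * (k + 1) := by simp; ring

theorem summable_norm_mul_pow {x : ℕ → ℂ} {C K : ℝ} (hK : 0 < K) (hC : 0 ≤ C)
    (hx : ∀ k, ‖x k‖ ≤ C * K ^ k) {s : ℂ} (hs : s ∈ Metric.ball (0 : ℂ) (1 / (2 * K))) :
    Summable fun k => ‖x k * s ^ k‖ := by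
  rw [mem_ball_zero_iff] at hs
  refine Summable.of_nonneg_of_le (fun _ => norm_nonneg _) (fun k => ?_)
    ((summable_geometric_of_lt_one (r := 1 / 2) (by norm_num) (by norm_num)).mul_left C)
  rw [norm_mul, norm_pow]
  calc ‖x k‖ * ‖s‖ ^ k ≤ (C * K ^ k) * (1 / (2 * K)) ^ k := by
        gcongr
        exact hx k
    _ = C * (1 / 2 : ℝ) ^ k := by
        rw [mul_assoc, ← mul_pow]; congr 2; field_simp

theorem hasDerivAt_tsum_mul_pow {x x' : ℕ → ℂ} {C K : ℝ} (hK : 0 < K) (hC : 0 ≤ C)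
    (hx : ∀ k, ‖x k‖ ≤ C * K ^ k) (hx' : ∀ k, x' k = (k + 1) * x (k + 1)) {s : ℂ}
    (hs : s ∈ Metric.ball (0 : ℂ) (1 / (2 * K))) :
    HasDerivAt (fun s => ∑' k, x k * s ^ k) (∑' k, x' k * s ^ k) s := by
  set u : ℕ → ℝ := fun k => (2 * C * K) * (k * (1 / 2 : ℝ) ^ k) with hudef
  have hu : Summable u := by
    have h := (summable_pow_mul_geometric_of_norm_lt_one (R := ℝ) 1 (r := 1 / 2)
      (by norm_num)).mul_left (2 * C * K)
    simpa only [pow_one] using h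
  have hbound : ∀ k : ℕ, ∀ y ∈ Metric.ball (0 : ℂ) (1 / (2 * K)),
      ‖x k * (k * y ^ (k - 1))‖ ≤ u k := by
    intro k y hy
    rw [mem_ball_zero_iff] at hy
    rcases k with _ | k
    · simp [hudef]
    rw [norm_mul, norm_mul, norm_pow, Complex.norm_natCast, Nat.add_sub_cancel]
    calc _ ≤ (C * K ^ (k + 1)) * (((k + 1 : ℕ) : ℝ) * (1 / (2 * K)) ^ k) := by
          gcongr
          exact hx _
      _ = u (k + 1) := by
          have h2 : (1 / (2 * K)) ^ k * K ^ k = (1 / 2 : ℝ) ^ k := by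
            rw [← mul_pow]; congr 1; field_simp
          rw [hudef]
          simp only [pow_succ, ← h2]
          ring
  have h := hasDerivAt_tsum_of_isPreconnected (g := fun k s => x k * s ^ k)
    (g' := fun k s => x k * (k * s ^ (k - 1))) hu Metric.isOpen_ball
    (convex_ball (0 : ℂ) (1 / (2 * K))).isPreconnected
    (fun k y _ => (hasDerivAt_pow k y).const_mul (x k)) hbound
    (Metric.mem_ball_self (by positivity)) (summable_norm_mul_pow hK hC hx
      (Metric.mem_ball_self (by positivity))).of_norm hs
  have hsum : Summable fun k => x k * (k * s ^ (k - 1)) :=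
    Summable.of_norm_bounded hu fun k => hbound k s hs
  have heq : ∑' k, x' k * s ^ k = ∑' k, x k * (k * s ^ (k - 1)) := by
    rw [hsum.tsum_eq_zero_add]
    simp only [Nat.cast_zero, zero_mul, mul_zero, zero_add, Nat.add_sub_cancel]
    refine tsum_congr fun k => ?_
    rw [hx']; push_cast; ring
  rw [heq]
  exact h

/-- Existence for a linear second-order holomorphic equation `X'' = A X' + B X` in `s` depending
holomorphically on a parameter `y`: the solution with initial values `c₀`, `c₁` is holomorphic in
`(s, y)`, on a polydisc on which the equation holds. -/
theorem exists_linearODE_solution {A B : ℂ × ℂ → ℂ} (hA : AnalyticAt ℂ A 0)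
    (hB : AnalyticAt ℂ B 0) (c₀ c₁ : ℂ) :
    ∃ ρ > 0, ∃ X X' : ℂ × ℂ → ℂ, AnalyticOnNhd ℂ X (Metric.ball 0 ρ) ∧
      AnalyticOnNhd ℂ X' (Metric.ball 0 ρ) ∧
      (∀ y ∈ Metric.ball (0 : ℂ) ρ, X (0, y) = c₀ ∧ X' (0, y) = c₁) ∧
      ∀ s ∈ Metric.ball (0 : ℂ) ρ, ∀ y ∈ Metric.ball (0 : ℂ) ρ,
        HasDerivAt (fun s => X (s, y)) (X' (s, y)) s ∧
        HasDerivAt (fun s => X' (s, y)) (A (s, y) * X' (s, y) + B (s, y) * X (s, y)) s := by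
  obtain ⟨ρ₁, hρ₁, hA₁⟩ := hA.exists_ball_analyticOnNhd
  obtain ⟨ρ₂, hρ₂, hB₁⟩ := hB.exists_ball_analyticOnNhd
  set M : ℝ := max (‖A 0‖ + 1) (‖B 0‖ + 1) with hM
  have hev : ∀ᶠ p in 𝓝 (0 : ℂ × ℂ), ‖A p‖ < M ∧ ‖B p‖ < M :=
    (hA.continuousAt.norm.eventually_lt_const
      (lt_of_lt_of_le (lt_add_one _) (le_max_left _ _))).and
    (hB.continuousAt.norm.eventually_lt_const
      (lt_of_lt_of_le (lt_add_one _) (le_max_right _ _)))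
  obtain ⟨ρ₃, hρ₃, hb⟩ := Metric.eventually_nhds_iff_ball.1 hev
  have hM0 : 0 ≤ M := (by positivity : 0 ≤ ‖A 0‖ + 1).trans (le_max_left _ _)
  set ρ := min ρ₁ (min ρ₂ ρ₃) with hρdef
  have hρ : 0 < ρ := by positivity
  obtain ⟨a, had, hab, has⟩ := exists_coeff_of_analyticOnNhd (A := A) (M := M) hρ
    (hA₁.mono (Metric.ball_subset_ball (min_le_left _ _)))
    (fun p hp => (hb p (Metric.ball_subset_ball
      ((min_le_right _ _).trans (min_le_right _ _)) hp)).1.le)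
  obtain ⟨b, hbd, hbb, hbs⟩ := exists_coeff_of_analyticOnNhd (A := B) (M := M) hρ
    (hB₁.mono (Metric.ball_subset_ball ((min_le_right _ _).trans (min_le_left _ _))))
    (fun p hp => (hb p (Metric.ball_subset_ball
      ((min_le_right _ _).trans (min_le_right _ _)) hp)).2.le)
  set K : ℝ := max (2 / ρ) (max 1 (2 * M)) with hKdef
  have hLK : 2 / ρ ≤ K := le_max_left _ _
  have hK1 : 1 ≤ K := (le_max_left _ _).trans (le_max_right _ _)
  have hMK : 2 * M ≤ K := (le_max_right _ _).trans (le_max_right _ _)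
  have hK : 0 < K := by linarith
  set C : ℝ := max ‖c₀‖ ‖c₁‖ with hCdef
  have hC : 0 ≤ C := (norm_nonneg _).trans (le_max_left _ _)
  set x : ℕ → ℂ → ℂ := fun k y => (odeCoeff (a · y) (b · y) c₀ c₁ k).1 with hx
  set x' : ℕ → ℂ → ℂ := fun k y => (odeCoeff (a · y) (b · y) c₀ c₁ k).2 with hx'
  have hbound : ∀ k, ∀ y ∈ Metric.ball (0 : ℂ) ρ,
      ‖odeCoeff (a · y) (b · y) c₀ c₁ k‖ ≤ C * K ^ k := fun k y hy =>
    norm_odeCoeff_le (by positivity) hM0 hLK hK1 hMK (fun j => hab j y hy) (fun j => hbb j y hy)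
      (le_max_left _ _) (le_max_right _ _) k
  have hxb : ∀ k, ∀ y ∈ Metric.ball (0 : ℂ) ρ, ‖x k y‖ ≤ C * K ^ k := fun k y hy =>
    (norm_fst_le _).trans (hbound k y hy)
  have hxb' : ∀ k, ∀ y ∈ Metric.ball (0 : ℂ) ρ, ‖x' k y‖ ≤ C * K ^ k := fun k y hy =>
    (norm_snd_le _).trans (hbound k y hy)
  have hsucc : ∀ k y, x (k + 1) y = x' k y / (k + 1) := fun k y => by
    simp only [hx, hx', odeCoeff_succ]
  have hsucc' : ∀ k y, x' (k + 1) y = (∑ j ∈ Finset.range (k + 1),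
      (x' j y * a (k - j) y + x j y * b (k - j) y)) / (k + 1) := fun k y => by
    simp only [hx, hx', odeCoeff_succ]
  have hdiff : ∀ k, DifferentiableOn ℂ (x k) (Metric.ball 0 ρ) ∧
      DifferentiableOn ℂ (x' k) (Metric.ball 0 ρ) := by
    intro k
    induction k using Nat.strong_induction_on with
    | _ k ih =>
      cases k with
      | zero =>
        simp only [hx, hx', odeCoeff]
        exact ⟨differentiableOn_const _, differentiableOn_const _⟩
      | succ k =>
        have h1 : x (k + 1) = fun y => x' k y / (k + 1) := funext (hsucc k)
        have h2 : x' (k + 1) = fun y => (∑ j ∈ Finset.range (k + 1),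
          (x' j y * a (k - j) y + x j y * b (k - j) y)) / (k + 1) := funext (hsucc' k)
        rw [h1, h2]
        refine ⟨(ih k (Nat.lt_succ_self k)).2.div_const _, DifferentiableOn.div_const ?_ _⟩
        refine DifferentiableOn.fun_sum fun j hj => ?_
        have hj' := Finset.mem_range.1 hj
        exact ((ih j hj').2.mul (had _)).add ((ih j hj').1.mul (hbd _))
  have hXan := analyticAt_tsum_mul_pow hK hρ hC (fun k => (hdiff k).1) hxb
  have hXan' := analyticAt_tsum_mul_pow hK hρ hC (fun k => (hdiff k).2) hxb'
  obtain ⟨σ₁, hσ₁, hX⟩ := hXan.exists_ball_analyticOnNhd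
  obtain ⟨σ₂, hσ₂, hX'⟩ := hXan'.exists_ball_analyticOnNhd
  set σ : ℝ := min (min σ₁ σ₂) (min ρ (1 / (2 * K))) with hσ
  have hσρ : Metric.ball (0 : ℂ) σ ⊆ Metric.ball (0 : ℂ) ρ :=
    Metric.ball_subset_ball ((min_le_right _ _).trans (min_le_left _ _))
  have hσK : Metric.ball (0 : ℂ) σ ⊆ Metric.ball (0 : ℂ) (1 / (2 * K)) :=
    Metric.ball_subset_ball ((min_le_right _ _).trans (min_le_right _ _))
  refine ⟨σ, by positivity, _, _, hX.mono (Metric.ball_subset_ball ?_),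
    hX'.mono (Metric.ball_subset_ball ?_), fun y hy => ⟨?_, ?_⟩, fun s hs y hy => ⟨?_, ?_⟩⟩
  · exact (min_le_left _ _).trans (min_le_left _ _)
  · exact (min_le_left _ _).trans (min_le_right _ _)
  · change ∑' k, x k y * (0 : ℂ) ^ k = c₀
    rw [tsum_eq_single 0 (fun k hk => by simp [hk])]
    simp [hx, odeCoeff]
  · change ∑' k, x' k y * (0 : ℂ) ^ k = c₁
    rw [tsum_eq_single 0 (fun k hk => by simp [hk])]
    simp [hx', odeCoeff]
  · refine hasDerivAt_tsum_mul_pow hK hC (fun k => hxb k y (hσρ hy)) (fun k => ?_) (hσK hs)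
    rw [hsucc]
    have : (k : ℂ) + 1 ≠ 0 := Nat.cast_add_one_ne_zero k
    field_simp
  · have hconv : ∀ c : ℕ → ℂ, (∀ j, ‖c j‖ ≤ M * (2 / ρ) ^ j) → Summable fun k => ‖c k * s ^ k‖ :=
      fun c hc => summable_norm_mul_pow hK hM0 (fun k => (hc k).trans (by gcongr)) (hσK hs)
    have hsx := summable_norm_mul_pow hK hC (fun k => hxb k y (hσρ hy)) (hσK hs)
    have hsx' := summable_norm_mul_pow hK hC (fun k => hxb' k y (hσρ hy)) (hσK hs)
    have hsa := hconv (a · y) (fun j => hab j y (hσρ hy))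
    have hsb := hconv (b · y) (fun j => hbb j y (hσρ hy))
    have hderiv := hasDerivAt_tsum_mul_pow (x := (x' · y))
      (x' := fun k => ∑ j ∈ Finset.range (k + 1), (x' j y * a (k - j) y + x j y * b (k - j) y))
      hK hC (fun k => hxb' k y (hσρ hy)) (fun k => by
        rw [hsucc']
        have : (k : ℂ) + 1 ≠ 0 := Nat.cast_add_one_ne_zero k
        field_simp) (hσK hs)
    convert! hderiv using 1
    rw [← (has y (hσρ hy) s (hσρ hs)).tsum_eq, ← (hbs y (hσρ hy) s (hσρ hs)).tsum_eq]
    have e1 := tsum_mul_tsum_eq_tsum_sum_range_of_summable_norm hsx' hsa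
    have e2 := tsum_mul_tsum_eq_tsum_sum_range_of_summable_norm hsx hsb
    have s1 := (summable_norm_sum_mul_range_of_summable_norm hsx' hsa).of_norm
    have s2 := (summable_norm_sum_mul_range_of_summable_norm hsx hsb).of_norm
    change (∑' j, a j y * s ^ j) * (∑' k, x' k y * s ^ k) +
      (∑' j, b j y * s ^ j) * (∑' k, x k y * s ^ k) = _
    rw [mul_comm, e1, mul_comm, e2, ← s1.tsum_add s2]
    refine tsum_congr fun k => ?_
    rw [← Finset.sum_add_distrib, Finset.sum_mul]
    refine Finset.sum_congr rfl fun j hj => ?_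
    have hjk : j + (k - j) = k := Nat.add_sub_of_le (Nat.lt_succ_iff.1 (Finset.mem_range.1 hj))
    have hpow : s ^ k = s ^ j * s ^ (k - j) := by rw [← pow_add, hjk]
    rw [hpow]; ring

/-- Uniqueness for a linear second-order equation on a disc, by Grönwall's inequality on rays. -/
theorem eq_zero_of_linearODE {a b f f' : ℂ → ℂ} {σ : ℝ}
    (ha : ContinuousOn a (Metric.ball 0 σ)) (hb : ContinuousOn b (Metric.ball 0 σ))
    (hf : ∀ s ∈ Metric.ball (0 : ℂ) σ, HasDerivAt f (f' s) s)
    (hf' : ∀ s ∈ Metric.ball (0 : ℂ) σ, HasDerivAt f' (a s * f' s + b s * f s) s)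
    (h0 : f 0 = 0) (h0' : f' 0 = 0) : ∀ s ∈ Metric.ball (0 : ℂ) σ, f s = 0 ∧ f' s = 0 := by
  intro s hs
  have hmem : ∀ t ∈ Set.Icc (0 : ℝ) 1, (t : ℂ) * s ∈ Metric.ball (0 : ℂ) σ := by
    intro t ht
    rw [mem_ball_zero_iff] at hs ⊢
    rw [norm_mul, Complex.norm_real, Real.norm_eq_abs, abs_of_nonneg ht.1]
    exact (mul_le_of_le_one_left (norm_nonneg _) ht.2).trans_lt hs
  have hray : Continuous fun t : ℝ => (t : ℂ) * s := by fun_prop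
  obtain ⟨Ka, hKa⟩ := isCompact_Icc.exists_bound_of_continuousOn
    (ha.comp hray.continuousOn (s := Set.Icc (0 : ℝ) 1) hmem)
  obtain ⟨Kb, hKb⟩ := isCompact_Icc.exists_bound_of_continuousOn
    (hb.comp hray.continuousOn (s := Set.Icc (0 : ℝ) 1) hmem)
  have hder : ∀ t ∈ Set.Icc (0 : ℝ) 1, HasDerivAt
      (fun t : ℝ => (f (t * s), f' (t * s)))
      (f' (t * s) * s, (a (t * s) * f' (t * s) + b (t * s) * f (t * s)) * s) t := by
    intro t ht
    have hl : HasDerivAt (fun t : ℂ => t * s) s (t : ℂ) := by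
      simpa using (hasDerivAt_id (t : ℂ)).mul_const s
    exact ((hf _ (hmem t ht)).comp (t : ℂ) hl).comp_ofReal.prodMk
      ((hf' _ (hmem t ht)).comp (t : ℂ) hl).comp_ofReal
  have key := eq_zero_of_abs_deriv_le_mul_abs_self_of_eq_zero_right
    (f := fun t : ℝ => (f (t * s), f' (t * s)))
    (f' := fun t : ℝ => (f' (t * s) * s, (a (t * s) * f' (t * s) + b (t * s) * f (t * s)) * s))
    (K := (1 + |Ka| + |Kb|) * ‖s‖) (a := 0) (b := 1)
    (fun t ht => (hder t ht).continuousAt.continuousWithinAt)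
    (fun t ht => (hder t ⟨ht.1, ht.2.le⟩).hasDerivWithinAt) (by simp [h0, h0'])
    (fun t ht => ?_) 1 (by simp)
  · simpa using key
  · have ht' : t ∈ Set.Icc (0 : ℝ) 1 := ⟨ht.1, ht.2.le⟩
    have h1 : ‖f (t * s)‖ ≤ ‖(f (t * s), f' (t * s))‖ := norm_fst_le (f (t * s), f' (t * s))
    have h2 : ‖f' (t * s)‖ ≤ ‖(f (t * s), f' (t * s))‖ := norm_snd_le (f (t * s), f' (t * s))
    have h3 : ‖a (t * s)‖ ≤ |Ka| := (hKa t ht').trans (le_abs_self _)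
    have h4 : ‖b (t * s)‖ ≤ |Kb| := (hKb t ht').trans (le_abs_self _)
    set N := ‖(f (t * s), f' (t * s))‖
    have hN : 0 ≤ N := norm_nonneg _
    have h5 : 0 ≤ |Ka| * N := by positivity
    have h6 : 0 ≤ |Kb| * N := by positivity
    refine max_le ?_ ?_
    · calc ‖f' (t * s) * s‖ ≤ N * ‖s‖ := by rw [norm_mul]; gcongr
        _ ≤ (1 + |Ka| + |Kb|) * N * ‖s‖ := by gcongr; linarith
        _ = _ := by ring
    · calc ‖(a (t * s) * f' (t * s) + b (t * s) * f (t * s)) * s‖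
          ≤ (‖a (t * s)‖ * ‖f' (t * s)‖ + ‖b (t * s)‖ * ‖f (t * s)‖) * ‖s‖ := by
            rw [norm_mul]
            gcongr
            refine (norm_add_le _ _).trans_eq ?_
            rw [norm_mul, norm_mul]
        _ ≤ (|Ka| * N + |Kb| * N) * ‖s‖ := by gcongr
        _ ≤ (1 + |Ka| + |Kb|) * N * ‖s‖ := by gcongr; linarith
        _ = _ := by ring

/-! ### The logarithmic coordinate on a Segre family -/

/-- The point `y exp (i y ^ n s)`; for fixed `y ≠ 0` the parameter `s` is the logarithmic coordinate
based at `y`, in which the inverse of a Segre variety is the solution of a regular linear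
equation. -/
noncomputable def logPoint (n : ℕ) (s y : ℂ) : ℂ := y * Complex.exp (Complex.I * y ^ n * s)

/-- The factor `exp (- i n y ^ n s) = (y / logPoint n s y) ^ n`. -/
noncomputable def logScale (n : ℕ) (s y : ℂ) : ℂ :=
  Complex.exp (-(n * (Complex.I * y ^ n * s)))

/-- The coefficient of `X'` in the equation `X'' = A X' + B X` that the linear equation
`z'' = (P / w ^ (n + 1)) z' + (Q / w ^ (2 n + 2)) z` becomes in the coordinate `logPoint n`. -/
noncomputable def logCoeffA (n : ℕ) (P : ℂ → ℂ) (p : ℂ × ℂ) : ℂ :=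
  Complex.I * (p.2 ^ n + P (logPoint n p.1 p.2) * logScale n p.1 p.2)

/-- The coefficient of `X` in the equation `X'' = A X' + B X` of `logCoeffA`. -/
noncomputable def logCoeffB (n : ℕ) (Q : ℂ → ℂ) (p : ℂ × ℂ) : ℂ :=
  -(Q (logPoint n p.1 p.2) * logScale n p.1 p.2 ^ 2)

@[simp] theorem logPoint_zero_left (n : ℕ) (y : ℂ) : logPoint n 0 y = y := by simp [logPoint]

@[simp] theorem logPoint_zero_right (n : ℕ) (s : ℂ) : logPoint n s 0 = 0 := by simp [logPoint]

@[simp] theorem logScale_zero_left (n : ℕ) (y : ℂ) : logScale n 0 y = 1 := by simp [logScale]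

theorem logScale_ne_zero (n : ℕ) (s y : ℂ) : logScale n s y ≠ 0 := Complex.exp_ne_zero _

theorem logPoint_ne_zero (n : ℕ) (s : ℂ) {y : ℂ} (hy : y ≠ 0) : logPoint n s y ≠ 0 :=
  mul_ne_zero hy (Complex.exp_ne_zero _)

theorem logPoint_pow_mul_logScale (n : ℕ) (s y : ℂ) :
    logPoint n s y ^ n * logScale n s y = y ^ n := by
  rw [logPoint, logScale, mul_pow, ← Complex.exp_nat_mul, mul_assoc, ← Complex.exp_add]
  simp

theorem logPoint_base_change (n : ℕ) (s t u : ℂ) :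
    logPoint n (logScale n t u * (s - t)) (logPoint n t u) = logPoint n s u := by
  have h := logPoint_pow_mul_logScale n t u
  rw [logPoint, show Complex.I * logPoint n t u ^ n * (logScale n t u * (s - t)) =
    Complex.I * u ^ n * (s - t) by rw [← h]; ring, logPoint, logPoint, mul_assoc,
    ← Complex.exp_add]
  congr 2; ring

theorem logScale_base_change (n : ℕ) (s t u : ℂ) :
    logScale n (logScale n t u * (s - t)) (logPoint n t u) * logScale n t u = logScale n s u := by
  have h := logPoint_pow_mul_logScale n t u
  rw [logScale, show Complex.I * logPoint n t u ^ n * (logScale n t u * (s - t)) =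
    Complex.I * u ^ n * (s - t) by rw [← h]; ring, logScale, logScale, ← Complex.exp_add]
  congr 1; ring

theorem logCoeffA_base_change (n : ℕ) (P : ℂ → ℂ) (s t u : ℂ) :
    logScale n t u * logCoeffA n P (logScale n t u * (s - t), logPoint n t u) =
      logCoeffA n P (s, u) := by
  have h := logPoint_pow_mul_logScale n t u
  simp only [logCoeffA, logPoint_base_change, ← logScale_base_change n s t u]
  rw [← h]; ring

theorem logCoeffB_base_change (n : ℕ) (Q : ℂ → ℂ) (s t u : ℂ) :
    logScale n t u ^ 2 * logCoeffB n Q (logScale n t u * (s - t), logPoint n t u) =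
      logCoeffB n Q (s, u) := by
  simp only [logCoeffB, logPoint_base_change, ← logScale_base_change n s t u]
  ring

theorem hasDerivAt_logPoint (n : ℕ) (s y : ℂ) :
    HasDerivAt (fun s => logPoint n s y) (Complex.I * y ^ n * logPoint n s y) s := by
  have h := (((hasDerivAt_id s).const_mul (Complex.I * y ^ n)).cexp).const_mul y
  convert! h using 1
  simp only [logPoint, id]; ring

theorem hasDerivAt_logScale (n : ℕ) (s y : ℂ) :
    HasDerivAt (fun s => logScale n s y) (-(n * (Complex.I * y ^ n)) * logScale n s y) s := by
  have h := ((((hasDerivAt_id s).const_mul (Complex.I * y ^ n)).const_mul (n : ℂ)).neg).cexp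
  convert! h using 1
  simp only [logScale, id, Pi.neg_apply]; ring

theorem conj_logPoint (n : ℕ) (s : ℂ) (u : ℝ) : conj (logPoint n s u) = logPoint n (-conj s) u := by
  simp [logPoint, ← Complex.exp_conj]

theorem conj_logScale (n : ℕ) (s : ℂ) (u : ℝ) : conj (logScale n s u) = logScale n (-conj s) u := by
  simp [logScale, ← Complex.exp_conj]

theorem analyticAt_logPoint (n : ℕ) (p : ℂ × ℂ) :
    AnalyticAt ℂ (fun p : ℂ × ℂ => logPoint n p.1 p.2) p := by
  exact analyticAt_snd.mul ((analyticAt_const.mul (analyticAt_snd.pow n)).mul analyticAt_fst).cexp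

theorem analyticAt_logScale (n : ℕ) (p : ℂ × ℂ) :
    AnalyticAt ℂ (fun p : ℂ × ℂ => logScale n p.1 p.2) p := by
  exact (analyticAt_const.mul
    ((analyticAt_const.mul (analyticAt_snd.pow n)).mul analyticAt_fst)).neg.cexp

theorem analyticAt_logCoeffA {n : ℕ} {P : ℂ → ℂ} {p : ℂ × ℂ}
    (hP : AnalyticAt ℂ P (logPoint n p.1 p.2)) : AnalyticAt ℂ (logCoeffA n P) p := by
  have h1 : AnalyticAt ℂ (fun p : ℂ × ℂ => P (logPoint n p.1 p.2)) p :=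
    AnalyticAt.fun_comp (f := fun p : ℂ × ℂ => logPoint n p.1 p.2) hP (analyticAt_logPoint n p)
  exact analyticAt_const.mul ((analyticAt_snd.pow n).add (h1.mul (analyticAt_logScale n p)))

theorem analyticAt_logCoeffB {n : ℕ} {Q : ℂ → ℂ} {p : ℂ × ℂ}
    (hQ : AnalyticAt ℂ Q (logPoint n p.1 p.2)) : AnalyticAt ℂ (logCoeffB n Q) p := by
  have h1 : AnalyticAt ℂ (fun p : ℂ × ℂ => Q (logPoint n p.1 p.2)) p :=
    AnalyticAt.fun_comp (f := fun p : ℂ × ℂ => logPoint n p.1 p.2) hQ (analyticAt_logPoint n p)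
  exact (h1.mul ((analyticAt_logScale n p).pow 2)).neg

/-- A holomorphic solution of `X'' = A X' + B X` (in the logarithmic coordinate, with the base point
as parameter) on a polydisc whose points have `logPoint` in the disc of radius `r`; the initial
values at `s = 0` are `c₀` and `c₁`. -/
structure IsLogSolution (n : ℕ) (P Q : ℂ → ℂ) (r ρ : ℝ) (c₀ c₁ : ℂ) (X X' : ℂ × ℂ → ℂ) :
    Prop where
  pos : 0 < ρ
  mem_ball : ∀ s ∈ Metric.ball (0 : ℂ) ρ, ∀ y ∈ Metric.ball (0 : ℂ) ρ,
    logPoint n s y ∈ Metric.ball (0 : ℂ) r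
  analytic : AnalyticOnNhd ℂ X (Metric.ball 0 ρ)
  analytic_deriv : AnalyticOnNhd ℂ X' (Metric.ball 0 ρ)
  init : ∀ y ∈ Metric.ball (0 : ℂ) ρ, X (0, y) = c₀
  init_deriv : ∀ y ∈ Metric.ball (0 : ℂ) ρ, X' (0, y) = c₁
  hasDerivAt : ∀ s ∈ Metric.ball (0 : ℂ) ρ, ∀ y ∈ Metric.ball (0 : ℂ) ρ,
    HasDerivAt (fun s => X (s, y)) (X' (s, y)) s
  hasDerivAt_deriv : ∀ s ∈ Metric.ball (0 : ℂ) ρ, ∀ y ∈ Metric.ball (0 : ℂ) ρ,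
    HasDerivAt (fun s => X' (s, y))
      (logCoeffA n P (s, y) * X' (s, y) + logCoeffB n Q (s, y) * X (s, y)) s

theorem IsLogSolution.mono {n : ℕ} {P Q : ℂ → ℂ} {r ρ ρ' : ℝ} {c₀ c₁ : ℂ} {X X' : ℂ × ℂ → ℂ}
    (h : IsLogSolution n P Q r ρ c₀ c₁ X X') (h0 : 0 < ρ') (hle : ρ' ≤ ρ) :
    IsLogSolution n P Q r ρ' c₀ c₁ X X' := by
  have hb : Metric.ball (0 : ℂ) ρ' ⊆ Metric.ball 0 ρ := Metric.ball_subset_ball hle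
  exact ⟨h0, fun s hs y hy => h.mem_ball s (hb hs) y (hb hy),
    h.analytic.mono (Metric.ball_subset_ball hle),
    h.analytic_deriv.mono (Metric.ball_subset_ball hle), fun y hy => h.init y (hb hy),
    fun y hy => h.init_deriv y (hb hy), fun s hs y hy => h.hasDerivAt s (hb hs) y (hb hy),
    fun s hs y hy => h.hasDerivAt_deriv s (hb hs) y (hb hy)⟩

/-- A property that holds near the origin of `ℂ × ℂ` holds on a polydisc. -/
theorem exists_pos_forall_ball {p : ℂ × ℂ → Prop} (h : ∀ᶠ q in 𝓝 (0 : ℂ × ℂ), p q) :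
    ∃ ρ > 0, ∀ s ∈ Metric.ball (0 : ℂ) ρ, ∀ y ∈ Metric.ball (0 : ℂ) ρ, p (s, y) := by
  obtain ⟨ρ, hρ, hb⟩ := Metric.eventually_nhds_iff_ball.1 h
  exact ⟨ρ, hρ, fun s hs y hy => hb _ (mk_mem_ball_zero.2 ⟨hs, hy⟩)⟩

theorem exists_pos_logPoint_mem_ball (n : ℕ) {r : ℝ} (hr : 0 < r) :
    ∃ ρ > 0, ∀ s ∈ Metric.ball (0 : ℂ) ρ, ∀ y ∈ Metric.ball (0 : ℂ) ρ,
      logPoint n s y ∈ Metric.ball (0 : ℂ) r := by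
  have h : Filter.Tendsto (fun p : ℂ × ℂ => logPoint n p.1 p.2) (𝓝 0) (𝓝 0) := by
    have := (analyticAt_logPoint n 0).continuousAt.tendsto
    simpa using this
  exact exists_pos_forall_ball (h.eventually (Metric.ball_mem_nhds 0 hr))

theorem exists_isLogSolution (n : ℕ) {P Q : ℂ → ℂ} {r : ℝ} (hr : 0 < r)
    (hP : DifferentiableOn ℂ P (Metric.ball 0 r)) (hQ : DifferentiableOn ℂ Q (Metric.ball 0 r))
    (c₀ c₁ : ℂ) : ∃ ρ X X', IsLogSolution n P Q r ρ c₀ c₁ X X' := by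
  obtain ⟨ρ₁, hρ₁, hdom⟩ := exists_pos_logPoint_mem_ball n hr
  have h0 : logPoint n (0 : ℂ × ℂ).1 (0 : ℂ × ℂ).2 = 0 := by simp
  have hP0 := hP.analyticAt (Metric.ball_mem_nhds 0 hr)
  have hQ0 := hQ.analyticAt (Metric.ball_mem_nhds 0 hr)
  rw [← h0] at hP0 hQ0
  obtain ⟨ρ₂, hρ₂, X, X', hX, hX', hi, hode⟩ := exists_linearODE_solution
    (analyticAt_logCoeffA hP0) (analyticAt_logCoeffB hQ0) c₀ c₁
  have h1 : Metric.ball (0 : ℂ) (min ρ₁ ρ₂) ⊆ Metric.ball 0 ρ₁ :=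
    Metric.ball_subset_ball (min_le_left _ _)
  have h2 : Metric.ball (0 : ℂ) (min ρ₁ ρ₂) ⊆ Metric.ball 0 ρ₂ :=
    Metric.ball_subset_ball (min_le_right _ _)
  exact ⟨min ρ₁ ρ₂, X, X', by positivity, fun s hs y hy => hdom s (h1 hs) y (h1 hy),
    hX.mono (Metric.ball_subset_ball (min_le_right _ _)),
    hX'.mono (Metric.ball_subset_ball (min_le_right _ _)),
    fun y hy => (hi y (h2 hy)).1, fun y hy => (hi y (h2 hy)).2,
    fun s hs y hy => (hode s (h2 hs) y (h2 hy)).1, fun s hs y hy => (hode s (h2 hs) y (h2 hy)).2⟩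

/-- A holomorphic function `F(s, y)` with `∂F/∂s ≠ 0` at the origin is injective in `s` near the
origin, uniformly in `y`. -/
theorem exists_pos_injective_fst {F : ℂ × ℂ → ℂ} (hF : AnalyticAt ℂ F 0) {c : ℂ} (hc : c ≠ 0)
    (hd : HasDerivAt (fun s => F (s, 0)) c 0) :
    ∃ σ > 0, ∀ s ∈ Metric.ball (0 : ℂ) σ, ∀ s' ∈ Metric.ball (0 : ℂ) σ,
      ∀ y ∈ Metric.ball (0 : ℂ) σ, F (s, y) = F (s', y) → s = s' := by
  have hs := hF.hasStrictFDerivAt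
  have hD : fderiv ℂ F 0 (1, 0) = c := by
    have h1 : HasDerivAt (fun s : ℂ => (s, (0 : ℂ))) ((1, 0) : ℂ × ℂ) 0 :=
      (hasDerivAt_id _).prodMk (hasDerivAt_const _ _)
    exact (HasFDerivAt.comp_hasDerivAt (f := fun s : ℂ => (s, (0 : ℂ))) 0 hs.hasFDerivAt h1).unique hd
  have hc0 : 0 < ‖c‖ / 2 := by positivity
  have hev := hs.isLittleO.def hc0
  obtain ⟨σ, hσ, hb⟩ := Metric.eventually_nhds_iff_ball.1 hev
  refine ⟨σ, hσ, fun s hs s' hs' y hy heq => ?_⟩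
  have hmem : ((s, y), (s', y)) ∈ Metric.ball ((0 : ℂ × ℂ), (0 : ℂ × ℂ)) σ := by
    rw [← ball_prod_same]
    exact ⟨mk_mem_ball_zero.2 ⟨hs, hy⟩, mk_mem_ball_zero.2 ⟨hs', hy⟩⟩
  have h := hb _ hmem
  have hsub : ((s, y) : ℂ × ℂ) - (s', y) = (s - s') • (1, 0) := by simp
  simp only [heq, hsub, map_smul, hD, sub_self, zero_sub, norm_neg, norm_smul] at h
  have hn : ‖((1, 0) : ℂ × ℂ)‖ = 1 := by simp [Prod.norm_def]
  rw [hn, mul_one] at h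
  by_contra hne
  have : 0 < ‖s - s'‖ := norm_pos_iff.2 (sub_ne_zero.2 hne)
  have h2 : 0 < ‖s - s'‖ * ‖c‖ := by positivity
  nlinarith

/-! ### The inverse equation in the logarithmic coordinate -/

/-- The curve `w = logPoint n (h (z t)) y` satisfies the inverse equation if and only if `h`
satisfies the equation of the inverse function of a solution of `X'' = A X' + B X`. -/
theorem satisfiesInverseODEAt_logPoint_iff {n : ℕ} {P Q h h₁ : ℂ → ℂ} {h₂ y t z : ℂ}
    (hy : y ≠ 0) (ht : t ≠ 0) (hh : ∀ᶠ x in 𝓝 (z * t), HasDerivAt h (h₁ x) x)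
    (hh₁ : HasDerivAt h₁ h₂ (z * t)) :
    SatisfiesInverseODEAt (n + 1) P Q (fun z => logPoint n (h (z * t)) y) z ↔
      h₂ = -logCoeffA n P (h (z * t), y) * h₁ (z * t) ^ 2 -
        logCoeffB n Q (h (z * t), y) * (z * t) * h₁ (z * t) ^ 3 := by
  have hlin : ∀ z : ℂ, HasDerivAt (fun z => z * t) t z := fun z => by
    simpa using (hasDerivAt_id z).mul_const t
  have hd1 : ∀ z', HasDerivAt h (h₁ (z' * t)) (z' * t) →
      HasDerivAt (fun z => logPoint n (h (z * t)) y)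
        (Complex.I * y ^ n * logPoint n (h (z' * t)) y * (h₁ (z' * t) * t)) z' := fun z' hz' =>
    HasDerivAt.comp (h₂ := fun s => logPoint n s y) z' (hasDerivAt_logPoint n (h (z' * t)) y)
      (HasDerivAt.comp (h₂ := h) z' hz' (hlin z'))
  have hev : ∀ᶠ z' in 𝓝 z, HasDerivAt h (h₁ (z' * t)) (z' * t) :=
    (hlin z).continuousAt.eventually hh
  have hderiv : deriv (fun z => logPoint n (h (z * t)) y) =ᶠ[𝓝 z]
      fun z' => Complex.I * y ^ n * logPoint n (h (z' * t)) y * (h₁ (z' * t) * t) := by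
    filter_upwards [hev] with z' hz' using (hd1 z' hz').deriv
  have hd2 : HasDerivAt
      (fun z' => Complex.I * y ^ n * logPoint n (h (z' * t)) y * (h₁ (z' * t) * t)) _ z :=
    ((hd1 z hev.self_of_nhds).const_mul (Complex.I * y ^ n)).mul
      ((HasDerivAt.comp (h₂ := h₁) z hh₁ (hlin z)).mul_const t)
  rw [SatisfiesInverseODEAt, hderiv.deriv_eq, hd2.deriv, hderiv.self_of_nhds]
  simp only [logCoeffA, logCoeffB]
  have hg := logPoint_ne_zero n (h (z * t)) hy
  have hν := logScale_ne_zero n (h (z * t)) y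
  have hgν := logPoint_pow_mul_logScale n (h (z * t)) y
  set g := logPoint n (h (z * t)) y
  set ν := logScale n (h (z * t)) y
  set k := h₁ (z * t)
  have hyn : y ^ n ≠ 0 := pow_ne_zero n hy
  have hI2 : Complex.I ^ 2 = -1 := Complex.I_sq
  have e1 : P g / g ^ (n + 1) * (Complex.I * y ^ n * g * (k * t)) ^ 2 =
      -(P g * ν * y ^ n * g * k ^ 2 * t ^ 2) := by
    rw [pow_succ, ← hgν]
    field_simp
    rw [hI2]; ring
  have e2 : Q g / g ^ (2 * (n + 1)) * (Complex.I * y ^ n * g * (k * t)) ^ 3 * z =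
      -(Complex.I * Q g * ν ^ 2 * y ^ n * g * k ^ 3 * t ^ 2 * (z * t)) := by
    rw [show 2 * (n + 1) = n * 2 + 2 by ring, pow_add, pow_mul, ← hgν]
    field_simp
    rw [hI2]; ring
  rw [neg_mul, e1, e2]
  have hI : Complex.I ≠ 0 := Complex.I_ne_zero
  have hc : Complex.I * y ^ n * g * t ^ 2 ≠ 0 := by positivity
  have key : (Complex.I * y ^ n * (Complex.I * y ^ n * g * (k * t)) * (k * t) +
      Complex.I * y ^ n * g * (h₂ * t * t)) - (- -(P g * ν * y ^ n * g * k ^ 2 * t ^ 2) -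
        -(Complex.I * Q g * ν ^ 2 * y ^ n * g * k ^ 3 * t ^ 2 * (z * t))) =
      Complex.I * y ^ n * g * t ^ 2 * (h₂ - (-(Complex.I * (y ^ n + P g * ν)) * k ^ 2 -
        -(Q g * ν ^ 2) * (z * t) * k ^ 3)) := by
    linear_combination -(P g * ν * y ^ n * g * k ^ 2 * t ^ 2) * hI2
  rw [← sub_eq_zero, ← sub_eq_zero (a := h₂)]
  refine Iff.trans ?_ (mul_eq_zero_iff_left hc)
  rw [← key]

theorem PositiveSegreFamily.graph_eq_logPoint (S : PositiveSegreFamily) (n : ℕ) (p : ℂ × ℂ) (z : ℂ) :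
    S.graph (n + 1) p z = logPoint n (S.ψ (z * conj p.1, conj p.2)) (conj p.2) := rfl

theorem PositiveSegreFamily.tendsto_psi (S : PositiveSegreFamily) :
    Filter.Tendsto S.ψ (𝓝 0) (𝓝 0) := by
  have hδ : (0 : ℝ) < S.δ ^ 2 := by have := S.δ_pos; positivity
  have hn : Metric.ball (0 : ℂ) (S.δ ^ 2) ×ˢ Metric.ball (0 : ℂ) S.ε ∈ 𝓝 (0 : ℂ × ℂ) :=
    prod_mem_nhds (Metric.ball_mem_nhds _ hδ) (Metric.ball_mem_nhds _ S.ε_pos)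
  have h := (S.holo.differentiableAt hn).continuousAt.tendsto
  rwa [← Prod.mk_zero_zero, S.psi_zero 0 (Metric.mem_ball_self S.ε_pos)] at h

theorem PositiveSegreFamily.differentiableOn_slice (S : PositiveSegreFamily) {y : ℂ}
    (hy : y ∈ Metric.ball (0 : ℂ) S.ε) :
    DifferentiableOn ℂ (fun x => S.ψ (x, y)) (Metric.ball 0 (S.δ ^ 2)) :=
  S.holo.comp (differentiableOn_id.prodMk (differentiableOn_const y)) fun _ hx => ⟨hx, hy⟩

/-- If a Segre family is associated with the equation, then `ψ(·, y)` is, for small `y ≠ 0`, the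
inverse function of the solution `X(·, y)` with initial values `0`, `1`. -/
theorem PositiveSegreFamily.exists_psi_inverse (S : PositiveSegreFamily) {n : ℕ} {P Q : ℂ → ℂ}
    {r ρ : ℝ} {X X' : ℂ × ℂ → ℂ} (hQ : DifferentiableOn ℂ Q (Metric.ball 0 r))
    (hS : S.IsAssociatedWithODE (n + 1) P Q) (hX : IsLogSolution n P Q r ρ 0 1 X X') :
    ∃ σ > 0, σ ≤ ρ ∧
      (∀ x ∈ Metric.ball (0 : ℂ) σ, ∀ y ∈ Metric.ball (0 : ℂ) σ, y ≠ 0 →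
        S.ψ (x, y) ∈ Metric.ball (0 : ℂ) ρ ∧ X (S.ψ (x, y), y) = x) ∧
      ∀ s ∈ Metric.ball (0 : ℂ) σ, ∀ y ∈ Metric.ball (0 : ℂ) σ, y ≠ 0 → S.ψ (X (s, y), y) = s := by
  have hρ := hX.pos
  obtain ⟨δ', ε', hδ', hδS, hε', hεS, hode⟩ := hS
  obtain ⟨ρ₁, hρ₁, hdom⟩ := exists_pos_logPoint_mem_ball n hε'
  obtain ⟨σ₁, hσ₁, hψ₁⟩ := exists_pos_forall_ball
    (S.tendsto_psi.eventually (Metric.ball_mem_nhds 0 (lt_min hρ hρ₁)))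
  set t : ℝ := δ' / 2 with ht
  have ht0 : 0 < t := by positivity
  have htC : (t : ℂ) ≠ 0 := by exact_mod_cast ht0.ne'
  have htS : t ^ 2 < S.δ ^ 2 := by
    have : t < S.δ := by rw [ht]; linarith
    gcongr
  set σ₂ : ℝ := min (min (t ^ 2) ε') (min σ₁ (min ρ ρ₁)) with hσ₂
  have hσ₂0 : 0 < σ₂ := by positivity
  have hleft : ∀ x ∈ Metric.ball (0 : ℂ) σ₂, ∀ y ∈ Metric.ball (0 : ℂ) σ₂, y ≠ 0 →
      S.ψ (x, y) ∈ Metric.ball (0 : ℂ) ρ ∧ X (S.ψ (x, y), y) = x := by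
    intro x hx y hy hy0
    have hsub₁ : Metric.ball (0 : ℂ) σ₂ ⊆ Metric.ball 0 σ₁ :=
      Metric.ball_subset_ball ((min_le_right _ _).trans (min_le_left _ _))
    have hsubρ : Metric.ball (0 : ℂ) σ₂ ⊆ Metric.ball 0 ρ :=
      Metric.ball_subset_ball ((min_le_right _ _).trans ((min_le_right _ _).trans (min_le_left _ _)))
    have hsubρ₁ : Metric.ball (0 : ℂ) σ₂ ⊆ Metric.ball 0 ρ₁ :=
      Metric.ball_subset_ball
        ((min_le_right _ _).trans ((min_le_right _ _).trans (min_le_right _ _)))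
    have hsubε : Metric.ball (0 : ℂ) σ₂ ⊆ Metric.ball 0 ε' :=
      Metric.ball_subset_ball ((min_le_left _ _).trans (min_le_right _ _))
    have hsubδ : Metric.ball (0 : ℂ) σ₂ ⊆ Metric.ball 0 (S.δ ^ 2) :=
      Metric.ball_subset_ball ((min_le_left _ _).trans ((min_le_left _ _).trans htS.le))
    have hyS : y ∈ Metric.ball (0 : ℂ) S.ε := Metric.ball_subset_ball hεS (hsubε hy)
    set h : ℂ → ℂ := fun x => S.ψ (x, y) with hh
    have hhd : DifferentiableOn ℂ h (Metric.ball 0 (S.δ ^ 2)) := S.differentiableOn_slice hyS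
    have hh₁ : ∀ x ∈ Metric.ball (0 : ℂ) (S.δ ^ 2), HasDerivAt h (deriv h x) x := fun x hx =>
      (hhd.differentiableAt (Metric.isOpen_ball.mem_nhds hx)).hasDerivAt
    have hh₂ : ∀ x ∈ Metric.ball (0 : ℂ) (S.δ ^ 2), HasDerivAt (deriv h) (deriv (deriv h) x) x :=
      fun x hx => ((hhd.deriv Metric.isOpen_ball).differentiableAt
        (Metric.isOpen_ball.mem_nhds hx)).hasDerivAt
    have hval : ∀ x ∈ Metric.ball (0 : ℂ) σ₂, h x ∈ Metric.ball (0 : ℂ) ρ ∧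
        h x ∈ Metric.ball (0 : ℂ) ρ₁ := fun x hx => by
      have := hψ₁ x (hsub₁ hx) y (hsub₁ hy)
      exact ⟨Metric.ball_subset_ball (min_le_left _ _) this,
        Metric.ball_subset_ball (min_le_right _ _) this⟩
    have heq : ∀ x ∈ Metric.ball (0 : ℂ) σ₂, deriv (deriv h) x =
        -logCoeffA n P (h x, y) * deriv h x ^ 2 - logCoeffB n Q (h x, y) * x * deriv h x ^ 3 := by
      intro x hx
      have hxt : x / t * t = x := div_mul_cancel₀ x htC
      have hgraph : S.graph (n + 1) ((t : ℂ), conj y) = fun z => logPoint n (h (z * t)) y := by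
        funext z
        rw [S.graph_eq_logPoint]
        simp [hh]
      have h1 := hode ((t : ℂ), conj y) ?_ ?_ ?_ (x / t) ?_ ?_
      · rw [hgraph, satisfiesInverseODEAt_logPoint_iff (h₁ := deriv h) (h₂ := deriv (deriv h) x)
          hy0 htC ?_ ?_] at h1
        · rwa [hxt] at h1
        · rw [hxt]
          filter_upwards [Metric.isOpen_ball.mem_nhds (hsubδ hx)] with x' hx' using hh₁ x' hx'
        · rw [hxt]; exact hh₂ x (hsubδ hx)
      · rw [mem_ball_zero_iff, Complex.norm_real, Real.norm_eq_abs, abs_of_pos ht0, ht]; linarith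
      · have := hsubε hy
        rw [mem_ball_zero_iff] at this ⊢
        simpa using this
      · simpa using hy0
      · have hx2 : ‖x‖ < t ^ 2 :=
          (mem_ball_zero_iff.1 hx).trans_le ((min_le_left _ _).trans (min_le_left _ _))
        rw [mem_ball_zero_iff, norm_div, Complex.norm_real, Real.norm_eq_abs, abs_of_pos ht0,
          div_lt_iff₀ ht0]
        calc ‖x‖ < t ^ 2 := hx2
          _ = t * t := sq t
          _ ≤ δ' * t := by gcongr; rw [ht]; linarith
      · rw [hgraph]
        change logPoint n (h (x / t * t)) y ∈ _
        rw [hxt]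
        exact hdom _ (hval x hx).2 y (hsubρ₁ hy)
    refine ⟨(hval x hx).1, ?_⟩
    have hcB : ContinuousOn (fun x => logCoeffB n Q (h x, y)) (Metric.ball 0 σ₂) := by
      intro x hx
      have h1 : AnalyticAt ℂ (logCoeffB n Q) (h x, y) := analyticAt_logCoeffB
        (hQ.analyticAt (Metric.isOpen_ball.mem_nhds
          (hX.mem_ball _ (hval x hx).1 y (hsubρ hy))))
      have h2 : ContinuousAt (fun x => (h x, y)) x :=
        (hh₁ x (hsubδ hx)).continuousAt.prodMk continuousAt_const
      exact (ContinuousAt.comp (f := fun x => (h x, y)) h1.continuousAt h2).continuousWithinAt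
    have hch : ContinuousOn (deriv h) (Metric.ball 0 σ₂) := fun x hx =>
      (hh₂ x (hsubδ hx)).continuousAt.continuousWithinAt
    have hmem0 : (0 : ℂ) ∈ Metric.ball (0 : ℂ) σ₂ := Metric.mem_ball_self hσ₂0
    have hh0 : h 0 = 0 := S.psi_zero y hyS
    have hh0' : deriv h 0 = 1 := (S.psi_deriv y hyS).deriv
    have hXh : ∀ x ∈ Metric.ball (0 : ℂ) σ₂, HasDerivAt (fun x => X (h x, y))
        (X' (h x, y) * deriv h x) x := fun x hx =>
      HasDerivAt.comp (h₂ := fun s => X (s, y)) x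
        (hX.hasDerivAt _ (hval x hx).1 y (hsubρ hy)) (hh₁ x (hsubδ hx))
    have hXh' : ∀ x ∈ Metric.ball (0 : ℂ) σ₂, HasDerivAt (fun x => X' (h x, y))
        ((logCoeffA n P (h x, y) * X' (h x, y) + logCoeffB n Q (h x, y) * X (h x, y)) *
          deriv h x) x := fun x hx =>
      HasDerivAt.comp (h₂ := fun s => X' (s, y)) x
        (hX.hasDerivAt_deriv _ (hval x hx).1 y (hsubρ hy)) (hh₁ x (hsubδ hx))
    have hz := eq_zero_of_linearODE (σ := σ₂)
      (f := fun x => X (h x, y) - x) (f' := fun x => X' (h x, y) * deriv h x - 1)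
      (a := fun x => -(x * (logCoeffB n Q (h x, y) * deriv h x ^ 2)))
      (b := fun x => logCoeffB n Q (h x, y) * deriv h x ^ 2)
      ((continuousOn_id.mul (hcB.mul (hch.pow 2))).neg) (hcB.mul (hch.pow 2))
      (fun x hx => (hXh x hx).sub (hasDerivAt_id x))
      (fun x hx => by
        have h1 := ((hXh' x hx).mul (hh₂ x (hsubδ hx))).sub_const (1 : ℂ)
        convert! h1 using 1
        rw [heq x hx]; ring)
      (by simp only [hh0, hX.init y (hsubρ hy), sub_zero])
      (by simp only [hh0, hh0', hX.init_deriv y (hsubρ hy), mul_one, sub_self]) x hx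
    exact sub_eq_zero.1 hz.1
  have h0 : (0 : ℂ) ∈ Metric.ball (0 : ℂ) ρ := Metric.mem_ball_self hρ
  have hXan : AnalyticAt ℂ X 0 := hX.analytic 0 (Metric.mem_ball_self hρ)
  obtain ⟨σ₃, hσ₃, hinj⟩ := exists_pos_injective_fst hXan (c := 1) one_ne_zero (by
    simpa [hX.init_deriv 0 h0] using hX.hasDerivAt 0 h0 0 h0)
  obtain ⟨σ₄, hσ₄, hψ₄⟩ := exists_pos_forall_ball
    (S.tendsto_psi.eventually (Metric.ball_mem_nhds 0 hσ₃))
  have hX0 : X 0 = 0 := hX.init 0 h0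
  have hXt : Filter.Tendsto X (𝓝 0) (𝓝 0) := by simpa [hX0] using hXan.continuousAt.tendsto
  obtain ⟨σ₅, hσ₅, hX₅⟩ := exists_pos_forall_ball
    (hXt.eventually (Metric.ball_mem_nhds 0 (lt_min hσ₂0 hσ₄)))
  set σ : ℝ := min (min σ₂ σ₃) (min σ₄ σ₅) with hσ
  have hs2 : Metric.ball (0 : ℂ) σ ⊆ Metric.ball 0 σ₂ :=
    Metric.ball_subset_ball ((min_le_left _ _).trans (min_le_left _ _))
  have hs3 : Metric.ball (0 : ℂ) σ ⊆ Metric.ball 0 σ₃ :=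
    Metric.ball_subset_ball ((min_le_left _ _).trans (min_le_right _ _))
  have hs4 : Metric.ball (0 : ℂ) σ ⊆ Metric.ball 0 σ₄ :=
    Metric.ball_subset_ball ((min_le_right _ _).trans (min_le_left _ _))
  have hs5 : Metric.ball (0 : ℂ) σ ⊆ Metric.ball 0 σ₅ :=
    Metric.ball_subset_ball ((min_le_right _ _).trans (min_le_right _ _))
  refine ⟨σ, by positivity, ?_, fun x hx y hy => hleft x (hs2 hx) y (hs2 hy),
    fun s hs y hy hy0 => ?_⟩
  · exact (min_le_left _ _).trans ((min_le_left _ _).trans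
      ((min_le_right _ _).trans ((min_le_right _ _).trans (min_le_left _ _))))
  · have hXs := hX₅ s (hs5 hs) y (hs5 hy)
    have hXs2 : X (s, y) ∈ Metric.ball (0 : ℂ) σ₂ := Metric.ball_subset_ball (min_le_left _ _) hXs
    have hXs4 : X (s, y) ∈ Metric.ball (0 : ℂ) σ₄ := Metric.ball_subset_ball (min_le_right _ _) hXs
    exact hinj _ (hψ₄ _ hXs4 y (hs4 hy)) s (hs3 hs) y (hs3 hy) (hleft _ hXs2 y (hs2 hy) hy0).2

/-! ### Change of base point, adjoint equation and reflection -/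

theorem exists_pos_baseChange_mem (n : ℕ) {ρ : ℝ} (hρ : 0 < ρ) :
    ∃ σ > 0, σ ≤ ρ ∧ ∀ s ∈ Metric.ball (0 : ℂ) σ, ∀ t ∈ Metric.ball (0 : ℂ) σ,
      ∀ u ∈ Metric.ball (0 : ℂ) σ, logScale n t u * (s - t) ∈ Metric.ball (0 : ℂ) ρ ∧
        logPoint n t u ∈ Metric.ball (0 : ℂ) ρ := by
  obtain ⟨σ₁, hσ₁, h₁⟩ := exists_pos_logPoint_mem_ball n hρ
  have hev : ∀ᶠ p : ℂ × ℂ in 𝓝 0, ‖logScale n p.1 p.2‖ < 2 := by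
    have := (analyticAt_logScale n 0).continuousAt.norm
    refine this.eventually_lt_const ?_
    simp
  obtain ⟨σ₂, hσ₂, h₂⟩ := exists_pos_forall_ball hev
  refine ⟨min (min σ₁ σ₂) (ρ / 4), by positivity, (min_le_right _ _).trans (by linarith),
    fun s hs t ht u hu => ⟨?_, ?_⟩⟩
  · have hs' : ‖s‖ < ρ / 4 := (mem_ball_zero_iff.1 hs).trans_le (min_le_right _ _)
    have ht' : ‖t‖ < ρ / 4 := (mem_ball_zero_iff.1 ht).trans_le (min_le_right _ _)
    have hsub : Metric.ball (0 : ℂ) (min (min σ₁ σ₂) (ρ / 4)) ⊆ Metric.ball 0 σ₂ :=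
      Metric.ball_subset_ball ((min_le_left _ _).trans (min_le_right _ _))
    have h2 := h₂ t (hsub ht) u (hsub hu)
    rw [mem_ball_zero_iff, norm_mul]
    calc ‖logScale n t u‖ * ‖s - t‖ ≤ 2 * (‖s‖ + ‖t‖) := by
          gcongr
          exact norm_sub_le _ _
      _ < ρ := by linarith
  · have hsub : Metric.ball (0 : ℂ) (min (min σ₁ σ₂) (ρ / 4)) ⊆ Metric.ball 0 σ₁ :=
      Metric.ball_subset_ball ((min_le_left _ _).trans (min_le_left _ _))
    exact h₁ t (hsub ht) u (hsub hu)

/-- The solution based at `logPoint n t u` also solves the equation based at `u`, after the affine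
change of the logarithmic coordinate. -/
theorem IsLogSolution.hasDerivAt_baseChange {n : ℕ} {P Q : ℂ → ℂ} {r ρ : ℝ} {c₀ c₁ : ℂ}
    {X X' : ℂ × ℂ → ℂ} (hX : IsLogSolution n P Q r ρ c₀ c₁ X X') {s t u : ℂ}
    (hs : logScale n t u * (s - t) ∈ Metric.ball (0 : ℂ) ρ)
    (hy : logPoint n t u ∈ Metric.ball (0 : ℂ) ρ) :
    HasDerivAt (fun s => X (logScale n t u * (s - t), logPoint n t u))
      (logScale n t u * X' (logScale n t u * (s - t), logPoint n t u)) s ∧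
    HasDerivAt (fun s => logScale n t u * X' (logScale n t u * (s - t), logPoint n t u))
      (logCoeffA n P (s, u) * (logScale n t u * X' (logScale n t u * (s - t), logPoint n t u)) +
        logCoeffB n Q (s, u) * X (logScale n t u * (s - t), logPoint n t u)) s := by
  have hl : HasDerivAt (fun s => logScale n t u * (s - t)) (logScale n t u) s := by
    simpa using ((hasDerivAt_id s).sub_const t).const_mul (logScale n t u)
  have h1 := HasDerivAt.comp (h₂ := fun s => X (s, logPoint n t u)) s
    (hX.hasDerivAt _ hs _ hy) hl
  have h2 := (HasDerivAt.comp (h₂ := fun s => X' (s, logPoint n t u)) s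
    (hX.hasDerivAt_deriv _ hs _ hy) hl).const_mul (logScale n t u)
  refine ⟨by convert! h1 using 1; ring, ?_⟩
  convert! h2 using 1
  rw [← logCoeffA_base_change n P s t u, ← logCoeffB_base_change n Q s t u]
  ring

/-- Lagrange's identity for `f'' = a f' + b f` and its (rescaled) adjoint equation. -/
theorem adjoint_pairing_const {a a₁ b f f' g g' : ℂ → ℂ} {σ : ℝ} {μ : ℂ}
    (ha : ∀ s ∈ Metric.ball (0 : ℂ) σ, HasDerivAt a (a₁ s) s)
    (hf : ∀ s ∈ Metric.ball (0 : ℂ) σ, HasDerivAt f (f' s) s)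
    (hf' : ∀ s ∈ Metric.ball (0 : ℂ) σ, HasDerivAt f' (a s * f' s + b s * f s) s)
    (hg : ∀ s ∈ Metric.ball (0 : ℂ) σ, HasDerivAt g (g' s) s)
    (hg' : ∀ s ∈ Metric.ball (0 : ℂ) σ, HasDerivAt g'
      ((-2 * μ - a s) * g' s + (b s - a₁ s - μ * (μ + a s)) * g s) s)
    {s t : ℂ} (hs : s ∈ Metric.ball (0 : ℂ) σ) (ht : t ∈ Metric.ball (0 : ℂ) σ) :
    Complex.exp (μ * s) * (f' s * g s - f s * g' s - (μ + a s) * f s * g s) =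
      Complex.exp (μ * t) * (f' t * g t - f t * g' t - (μ + a t) * f t * g t) := by
  have hD : ∀ s ∈ Metric.ball (0 : ℂ) σ, HasDerivAt (fun s => Complex.exp (μ * s) *
      (f' s * g s - f s * g' s - (μ + a s) * f s * g s)) 0 s := by
    intro s hs
    have he : HasDerivAt (fun s => Complex.exp (μ * s)) (Complex.exp (μ * s) * μ) s := by
      simpa using ((hasDerivAt_id s).const_mul μ).cexp
    have h1 := he.mul ((((hf' s hs).mul (hg s hs)).sub ((hf s hs).mul (hg' s hs))).sub
      ((((ha s hs).const_add μ).mul (hf s hs)).mul (hg s hs)))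
    convert! h1 using 1
    simp only [Pi.mul_apply, Pi.sub_apply]
    ring
  exact Metric.isOpen_ball.is_const_of_deriv_eq_zero (convex_ball (0 : ℂ) σ).isPreconnected
    (fun s hs => (hD s hs).differentiableAt.differentiableWithinAt)
    (fun s hs => (hD s hs).deriv) hs ht

theorem hasDerivAt_logCoeffA {n : ℕ} {P : ℂ → ℂ} {r : ℝ}
    (hP : DifferentiableOn ℂ P (Metric.ball 0 r)) {s u : ℂ}
    (h : logPoint n s u ∈ Metric.ball (0 : ℂ) r) :
    HasDerivAt (fun s => logCoeffA n P (s, u)) (deriv (fun s => logCoeffA n P (s, u)) s) s := by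
  have h1 : AnalyticAt ℂ (logCoeffA n P) (s, u) :=
    analyticAt_logCoeffA (hP.analyticAt (Metric.isOpen_ball.mem_nhds h))
  exact (DifferentiableAt.comp (f := fun s => (s, u)) s h1.differentiableAt
    (differentiableAt_id.prodMk (differentiableAt_const u))).hasDerivAt

/-- Reciprocity between the solutions of the equation and of its adjoint: the initial data, at
the base point `u`, of the solution `X` based at `logPoint n t u` compute the adjoint solutions
at `t`. -/
theorem IsLogSolution.adjoint_eq {n : ℕ} {P Q : ℂ → ℂ} {r ρ σ : ℝ} {X X' : ℂ × ℂ → ℂ}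
    (hP : DifferentiableOn ℂ P (Metric.ball 0 r)) (hX : IsLogSolution n P Q r ρ 0 1 X X')
    (hσ : σ ≤ ρ) {u t : ℂ} (hu : u ∈ Metric.ball (0 : ℂ) σ)
    (hmem : ∀ s ∈ Metric.ball (0 : ℂ) σ, logScale n t u * (s - t) ∈ Metric.ball (0 : ℂ) ρ)
    (hmem' : logPoint n t u ∈ Metric.ball (0 : ℂ) ρ) {g g' : ℂ → ℂ} {σ' : ℝ} (hσ' : σ' ≤ σ)
    (ht' : t ∈ Metric.ball (0 : ℂ) σ')
    (hg : ∀ s ∈ Metric.ball (0 : ℂ) σ', HasDerivAt g (g' s) s)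
    (hg' : ∀ s ∈ Metric.ball (0 : ℂ) σ', HasDerivAt g'
      ((-2 * (n * (Complex.I * u ^ n)) - logCoeffA n P (s, u)) * g' s +
        (logCoeffB n Q (s, u) - deriv (fun s => logCoeffA n P (s, u)) s -
          n * (Complex.I * u ^ n) * (n * (Complex.I * u ^ n) + logCoeffA n P (s, u))) * g s) s) :
    g t = logScale n t u * X' (logScale n t u * (0 - t), logPoint n t u) * g 0 -
      X (logScale n t u * (0 - t), logPoint n t u) *
        (g' 0 + (n * (Complex.I * u ^ n) + logCoeffA n P (0, u)) * g 0) := by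
  have hsub : Metric.ball (0 : ℂ) σ' ⊆ Metric.ball 0 σ := Metric.ball_subset_ball hσ'
  have hsubρ : Metric.ball (0 : ℂ) σ ⊆ Metric.ball 0 ρ := Metric.ball_subset_ball hσ
  have h0 : (0 : ℂ) ∈ Metric.ball (0 : ℂ) σ' :=
    Metric.mem_ball_self ((norm_nonneg t).trans_lt (mem_ball_zero_iff.1 ht'))
  have key := adjoint_pairing_const (a := fun s => logCoeffA n P (s, u))
    (b := fun s => logCoeffB n Q (s, u))
    (fun s hs => hasDerivAt_logCoeffA hP
      (hX.mem_ball s (hsubρ (hsub hs)) u (hsubρ hu)))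
    (fun s hs => (hX.hasDerivAt_baseChange (hmem s (hsub hs)) hmem').1)
    (fun s hs => (hX.hasDerivAt_baseChange (hmem s (hsub hs)) hmem').2) hg hg' ht' h0
  have he : Complex.exp (n * (Complex.I * u ^ n) * t) * logScale n t u = 1 := by
    rw [logScale, ← Complex.exp_add, ← Complex.exp_zero]; congr 1; ring
  simp only [sub_self, mul_zero, hX.init _ hmem', hX.init_deriv _ hmem', Complex.exp_zero] at key
  linear_combination key - g t * he

theorem hasDerivAt_conj_neg_conj {f : ℂ → ℂ} {f' s : ℂ} (hf : HasDerivAt f f' (-conj s)) :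
    HasDerivAt (fun s => conj (f (-conj s))) (-conj f') s := by
  have h1 : HasDerivAt (fun s => f (-s)) (-f') (conj s) := by
    have h := HasDerivAt.comp (h₂ := f) (conj s) hf (hasDerivAt_neg (conj s))
    simpa only [Function.comp_def, mul_neg, mul_one] using h
  have h2 := h1.conj_conj
  simpa [Function.comp_def] using h2

theorem neg_conj_mem_ball {s : ℂ} {ρ : ℝ} (hs : s ∈ Metric.ball (0 : ℂ) ρ) :
    -conj s ∈ Metric.ball (0 : ℂ) ρ := by
  simpa using hs

/-- The equation satisfied by the reflection `s ↦ conj (X (-conj s, u))` of a solution at a real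
base point `u`. -/
theorem IsLogSolution.hasDerivAt_reflect {n : ℕ} {P Q : ℂ → ℂ} {r ρ : ℝ} {c₀ c₁ : ℂ}
    {X X' : ℂ × ℂ → ℂ} (hX : IsLogSolution n P Q r ρ c₀ c₁ X X') {s u : ℂ}
    (hs : s ∈ Metric.ball (0 : ℂ) ρ) (hu : u ∈ Metric.ball (0 : ℂ) ρ) :
    HasDerivAt (fun s => conj (X (-conj s, u))) (-conj (X' (-conj s, u))) s ∧
    HasDerivAt (fun s => -conj (X' (-conj s, u)))
      (-conj (logCoeffA n P (-conj s, u)) * -conj (X' (-conj s, u)) +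
        conj (logCoeffB n Q (-conj s, u)) * conj (X (-conj s, u))) s := by
  have hs' := neg_conj_mem_ball hs
  refine ⟨hasDerivAt_conj_neg_conj (hX.hasDerivAt _ hs' u hu), ?_⟩
  have h := (hasDerivAt_conj_neg_conj (hX.hasDerivAt_deriv _ hs' u hu)).neg
  convert! h using 1
  simp

/-- For `P = 2 i a - (n + 1) w ^ n` the coefficient of the logarithmic equation in terms of `a`. -/
theorem logCoeffA_eq {n : ℕ} {P a : ℂ → ℂ} {s u : ℂ}
    (h : P (logPoint n s u) = 2 * Complex.I * a (logPoint n s u) -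
      ((n : ℂ) + 1) * logPoint n s u ^ n) :
    logCoeffA n P (s, u) =
      -(n * (Complex.I * u ^ n)) - 2 * a (logPoint n s u) * logScale n s u := by
  have hw := logPoint_pow_mul_logScale n s u
  simp only [logCoeffA]
  rw [h]
  linear_combination (-Complex.I * ((n : ℂ) + 1)) * hw +
    (2 * a (logPoint n s u) * logScale n s u) * Complex.I_sq

theorem reflect_logCoeffA {n : ℕ} {P a : ℂ → ℂ} {r : ℝ}
    (hPa : ∀ w ∈ Metric.ball (0 : ℂ) r, P w = 2 * Complex.I * a w - ((n : ℂ) + 1) * w ^ n)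
    (ha : ∀ w ∈ Metric.ball (0 : ℂ) r, conj (a (conj w)) = a w) {s : ℂ} {u : ℝ}
    (h : logPoint n s u ∈ Metric.ball (0 : ℂ) r)
    (h' : logPoint n (-conj s) u ∈ Metric.ball (0 : ℂ) r) :
    -conj (logCoeffA n P (-conj s, (u : ℂ))) =
      -2 * (n * (Complex.I * (u : ℂ) ^ n)) - logCoeffA n P (s, (u : ℂ)) := by
  rw [logCoeffA_eq (hPa _ h), logCoeffA_eq (hPa _ h')]
  rw [← conj_logPoint, ← conj_logScale] at *
  have := ha _ h
  simp only [map_sub, map_neg, map_mul, map_pow, Complex.conj_I, Complex.conj_ofReal,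
    Complex.conj_conj, this, map_natCast, map_ofNat]
  ring

theorem reflect_logCoeffB {n : ℕ} {P Q a : ℂ → ℂ} {r : ℝ}
    (hPa : ∀ w ∈ Metric.ball (0 : ℂ) r, P w = 2 * Complex.I * a w - ((n : ℂ) + 1) * w ^ n)
    (had : DifferentiableOn ℂ a (Metric.ball 0 r)) {s : ℂ} {u : ℝ}
    (h : logPoint n s u ∈ Metric.ball (0 : ℂ) r) :
    logCoeffB n Q (s, u) - deriv (fun s => logCoeffA n P (s, (u : ℂ))) s -
        n * (Complex.I * (u : ℂ) ^ n) * (n * (Complex.I * (u : ℂ) ^ n) + logCoeffA n P (s, u)) -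
        conj (logCoeffB n Q (-conj s, (u : ℂ))) =
      -(Q (logPoint n s u) - conj (Q (conj (logPoint n s u))) -
        2 * Complex.I * logPoint n s u ^ (n + 1) * deriv a (logPoint n s u)) *
        logScale n s u ^ 2 := by
  have hw := logPoint_pow_mul_logScale n s u
  have hev : (fun s => logCoeffA n P (s, (u : ℂ))) =ᶠ[𝓝 s] fun s =>
      -(n * (Complex.I * (u : ℂ) ^ n)) - 2 * a (logPoint n s u) * logScale n s u := by
    have hc := (hasDerivAt_logPoint n s u).continuousAt.eventually
      (Metric.isOpen_ball.mem_nhds h)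
    filter_upwards [hc] with s' hs' using logCoeffA_eq (hPa _ hs')
  have hda := (had.differentiableAt (Metric.isOpen_ball.mem_nhds h)).hasDerivAt
  have hd := (((HasDerivAt.comp (h₂ := a) s hda (hasDerivAt_logPoint n s u)).const_mul 2).mul
    (hasDerivAt_logScale n s u)).const_sub (-(n * (Complex.I * (u : ℂ) ^ n)))
  have hderiv : deriv (fun s => logCoeffA n P (s, (u : ℂ))) s = _ := hev.deriv_eq.trans hd.deriv
  rw [hderiv, logCoeffA_eq (hPa _ h)]
  simp only [logCoeffB, Function.comp_apply, map_neg, map_mul, map_pow]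
  rw [conj_logScale, ← conj_logPoint]
  simp only [map_neg, Complex.conj_conj, neg_neg]
  rw [pow_succ, ← hw]
  ring

/-! ### Functions that are real on the real axis -/

theorem eq_zero_of_eq_zero_on_real {f : ℂ → ℂ} {R : ℝ}
    (hf : DifferentiableOn ℂ f (Metric.ball 0 R)) (h : ∀ᶠ t : ℝ in 𝓝[≠] 0, f t = 0) {w : ℂ}
    (hw : w ∈ Metric.ball (0 : ℂ) R) : f w = 0 := by
  have hR : 0 < R := (norm_nonneg w).trans_lt (mem_ball_zero_iff.1 hw)
  have ht : Filter.Tendsto (fun t : ℝ => (t : ℂ)) (𝓝[≠] 0) (𝓝[≠] 0) := by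
    refine tendsto_nhdsWithin_of_tendsto_nhds_of_eventually_within _ ?_ ?_
    · exact (Complex.continuous_ofReal.tendsto' 0 0 Complex.ofReal_zero).mono_left
        nhdsWithin_le_nhds
    · filter_upwards [self_mem_nhdsWithin] with t ht
      simpa using ht
  exact (hf.analyticOnNhd Metric.isOpen_ball).eqOn_zero_of_preconnected_of_frequently_eq_zero
    (convex_ball (0 : ℂ) R).isPreconnected (Metric.mem_ball_self hR)
    (ht.frequently h.frequently) hw

theorem conj_mem_ball {w : ℂ} {R : ℝ} (hw : w ∈ Metric.ball (0 : ℂ) R) :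
    conj w ∈ Metric.ball (0 : ℂ) R := by
  simpa using hw

/-- The Schwarz reflection principle on a disc. -/
theorem conj_apply_conj_of_real {f : ℂ → ℂ} {R : ℝ}
    (hf : DifferentiableOn ℂ f (Metric.ball 0 R)) (h : ∀ᶠ t : ℝ in 𝓝[≠] 0, conj (f t) = f t)
    {w : ℂ} (hw : w ∈ Metric.ball (0 : ℂ) R) : conj (f (conj w)) = f w := by
  have hd : DifferentiableOn ℂ (fun w => conj (f (conj w)) - f w) (Metric.ball 0 R) := by
    intro w hw
    have h1 := hf.differentiableAt (Metric.isOpen_ball.mem_nhds (conj_mem_ball hw))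
    have h2 : DifferentiableAt ℂ (fun w => conj (f (conj w))) w := by
      simpa [Function.comp_def] using h1.hasDerivAt.conj_conj.differentiableAt
    exact (h2.sub (hf.differentiableAt (Metric.isOpen_ball.mem_nhds hw))).differentiableWithinAt
  refine sub_eq_zero.1 (eq_zero_of_eq_zero_on_real hd ?_ hw)
  filter_upwards [h] with t ht
  rw [Complex.conj_ofReal, ht, sub_self]

theorem isRealPowerSeriesOn_of_conj {a : ℂ → ℂ} {r : ℝ}
    (hd : DifferentiableOn ℂ a (Metric.ball 0 r))
    (hc : ∀ w ∈ Metric.ball (0 : ℂ) r, conj (a (conj w)) = a w) : IsRealPowerSeriesOn a r := by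
  set c : ℕ → ℂ := fun j => (j.factorial : ℂ)⁻¹ * iteratedDeriv j a 0 with hcdef
  have hsum : ∀ w ∈ Metric.ball (0 : ℂ) r, HasSum (fun j => c j * w ^ j) (a w) := fun w hw => by
    have h := Complex.hasSum_taylorSeries_on_ball hd hw
    simpa [hcdef, mul_comm, mul_left_comm, mul_assoc] using h
  refine ⟨fun j => (c j).re, fun w hw => ?_⟩
  have h1 := hsum w hw
  have h2 := Complex.hasSum_conj'.2 (hsum _ (conj_mem_ball hw))
  rw [hc w hw] at h2
  have h3 := (h1.add h2).mul_left (1 / 2 : ℂ)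
  convert! h3 using 1
  · funext j
    rw [Complex.re_eq_add_conj]
    simp only [map_mul, map_pow, Complex.conj_conj]
    ring
  · ring

theorem IsRealPowerSeriesOn.conj_apply_conj {a : ℂ → ℂ} {r : ℝ} (ha : IsRealPowerSeriesOn a r)
    {w : ℂ} (hw : w ∈ Metric.ball (0 : ℂ) r) : conj (a (conj w)) = a w := by
  obtain ⟨c, hc⟩ := ha
  have h2 := Complex.hasSum_conj'.2 (hc _ (conj_mem_ball hw))
  refine h2.unique ?_
  simpa using hc w hw

theorem conj_deriv_conj {a : ℂ → ℂ} {r : ℝ} (hd : DifferentiableOn ℂ a (Metric.ball 0 r))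
    (hc : ∀ w ∈ Metric.ball (0 : ℂ) r, conj (a (conj w)) = a w) {w : ℂ}
    (hw : w ∈ Metric.ball (0 : ℂ) r) : conj (deriv a (conj w)) = deriv a w := by
  have h1 := (hd.differentiableAt
    (Metric.isOpen_ball.mem_nhds (conj_mem_ball hw))).hasDerivAt.conj_conj
  rw [Complex.conj_conj] at h1
  have h2 : a =ᶠ[𝓝 w] conj ∘ a ∘ conj := by
    filter_upwards [Metric.isOpen_ball.mem_nhds hw] with w' hw' using (hc w' hw').symm
  exact (h1.congr_of_eventuallyEq h2).deriv.symm

/-! ### Symmetry of the Segre family of a real hypersurface -/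

/-- The complexification of a real-valued function is Hermitian: on the complex line
`t ↦ (A + t B, conj A + t conj B)` it is a function of `t` that is real on the real axis, and every
pair `(Z, χ)` is the point `t = i` of such a line. -/
theorem eventually_conj_complexification {φ : (ℂ × ℂ) × (ℂ × ℂ) → ℂ} {g : ℂ × ℂ → ℝ}
    (hφ : AnalyticAt ℂ φ 0)
    (hg : ∀ᶠ Z : ℂ × ℂ in 𝓝 0, φ (Z, (conj Z.1, conj Z.2)) = (g Z : ℂ)) :
    ∀ᶠ q : (ℂ × ℂ) × (ℂ × ℂ) in 𝓝 0,
      φ ((conj q.2.1, conj q.2.2), (conj q.1.1, conj q.1.2)) = conj (φ q) := by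
  obtain ⟨R₁, hR₁, hφ₁⟩ := hφ.exists_ball_analyticOnNhd
  obtain ⟨R₂, hR₂, hg₂⟩ := Metric.eventually_nhds_iff_ball.1 hg
  set R := min R₁ R₂ with hR
  have hR0 : 0 < R := by positivity
  filter_upwards [Metric.ball_mem_nhds (0 : (ℂ × ℂ) × (ℂ × ℂ)) (show 0 < R / 4 by positivity)]
    with q hq
  obtain ⟨⟨z, w⟩, ⟨χ, ω⟩⟩ := q
  simp only [mem_ball_zero_iff, Prod.norm_def, max_lt_iff] at hq
  obtain ⟨⟨hz, hw⟩, hχ, hω⟩ := hq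
  set A₁ := (z + conj χ) / 2 with hA₁
  set A₂ := (w + conj ω) / 2 with hA₂
  set B₁ := (z - conj χ) / (2 * Complex.I) with hB₁
  set B₂ := (w - conj ω) / (2 * Complex.I) with hB₂
  have hadd : ∀ x y : ℂ, ‖x‖ < R / 4 → ‖y‖ < R / 4 → ‖(x + conj y) / 2‖ < R / 4 := by
    intro x y hx hy
    have h2 : ‖(2 : ℂ)‖ = 2 := by simp
    rw [norm_div, h2, div_lt_iff₀ (by norm_num)]
    have := norm_add_le x (conj y)
    rw [Complex.norm_conj] at this
    linarith
  have hsub : ∀ x y : ℂ, ‖x‖ < R / 4 → ‖y‖ < R / 4 →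
      ‖(x - conj y) / (2 * Complex.I)‖ < R / 4 := by
    intro x y hx hy
    have h2 : ‖(2 * Complex.I : ℂ)‖ = 2 := by simp
    rw [norm_div, h2, div_lt_iff₀ (by norm_num)]
    have := norm_sub_le x (conj y)
    rw [Complex.norm_conj] at this
    linarith
  have hlin : ∀ {a b t : ℂ}, ‖a‖ < R / 4 → ‖b‖ < R / 4 → t ∈ Metric.ball (0 : ℂ) 2 →
      ‖a + t * b‖ < R := by
    intro a b t ha hb ht
    rw [mem_ball_zero_iff] at ht
    have := norm_add_le a (t * b)
    rw [norm_mul] at this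
    nlinarith [norm_nonneg b, norm_nonneg t]
  have hA₁n := hadd z χ hz hχ
  have hA₂n := hadd w ω hw hω
  have hB₁n := hsub z χ hz hχ
  have hB₂n := hsub w ω hw hω
  set ℓ : ℂ → (ℂ × ℂ) × (ℂ × ℂ) := fun t =>
    ((A₁ + t * B₁, A₂ + t * B₂), (conj A₁ + t * conj B₁, conj A₂ + t * conj B₂)) with hℓ
  have hmem : ∀ t ∈ Metric.ball (0 : ℂ) 2, ℓ t ∈ Metric.ball (0 : (ℂ × ℂ) × (ℂ × ℂ)) R := by
    intro t ht
    simp only [hℓ, mem_ball_zero_iff, Prod.norm_def, max_lt_iff]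
    exact ⟨⟨hlin hA₁n hB₁n ht, hlin hA₂n hB₂n ht⟩,
      hlin (by rwa [Complex.norm_conj]) (by rwa [Complex.norm_conj]) ht,
      hlin (by rwa [Complex.norm_conj]) (by rwa [Complex.norm_conj]) ht⟩
  have hf : DifferentiableOn ℂ (fun t => φ (ℓ t)) (Metric.ball 0 2) := by
    intro t ht
    have h1 := (hφ₁ _ (Metric.ball_subset_ball (min_le_left _ _) (hmem t ht))).differentiableAt
    have h2 : DifferentiableAt ℂ ℓ t := by fun_prop
    exact (DifferentiableAt.comp t h1 h2).differentiableWithinAt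
  have hreal : ∀ᶠ t : ℝ in 𝓝[≠] 0, conj (φ (ℓ t)) = φ (ℓ t) := by
    have hb : ∀ᶠ t : ℝ in 𝓝 0, (t : ℂ) ∈ Metric.ball (0 : ℂ) 2 :=
      (Complex.continuous_ofReal.tendsto' 0 0 Complex.ofReal_zero).eventually
        (Metric.ball_mem_nhds 0 (by norm_num))
    filter_upwards [nhdsWithin_le_nhds hb] with t ht
    have h1 := hmem t ht
    have h2 : (ℓ t).1 ∈ Metric.ball (0 : ℂ × ℂ) R₂ := by
      rw [mem_ball_zero_iff] at h1 ⊢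
      exact ((norm_fst_le _).trans_lt h1).trans_le (min_le_right _ _)
    have h3 := hg₂ _ h2
    have h4 : ℓ t = ((ℓ t).1, (conj (ℓ t).1.1, conj (ℓ t).1.2)) := by
      simp [hℓ]
    rw [h4, h3, Complex.conj_ofReal]
  have hI : Complex.I ∈ Metric.ball (0 : ℂ) 2 := by simp
  have key := conj_apply_conj_of_real hf hreal hI
  have hmid : ∀ x y : ℂ, (x + conj y) / 2 + Complex.I * ((x - conj y) / (2 * Complex.I)) = x ∧
      (x + conj y) / 2 + -Complex.I * ((x - conj y) / (2 * Complex.I)) = conj y ∧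
      conj ((x + conj y) / 2) + Complex.I * conj ((x - conj y) / (2 * Complex.I)) = y ∧
      conj ((x + conj y) / 2) + -Complex.I * conj ((x - conj y) / (2 * Complex.I)) = conj x := by
    intro x y
    have hI0 := Complex.I_ne_zero
    simp only [map_div₀, map_add, map_sub, map_mul, Complex.conj_conj, Complex.conj_I, map_ofNat]
    refine ⟨?_, ?_, ?_, ?_⟩ <;> field_simp <;> ring
  have e1 : ℓ Complex.I = ((z, w), (χ, ω)) := by
    simp only [hℓ, hA₁, hA₂, hB₁, hB₂]
    rw [(hmid z χ).1, (hmid w ω).1, (hmid z χ).2.2.1, (hmid w ω).2.2.1]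
  have e2 : ℓ (conj Complex.I) = ((conj χ, conj ω), (conj z, conj w)) := by
    simp only [hℓ, hA₁, hA₂, hB₁, hB₂, Complex.conj_I]
    rw [(hmid z χ).2.1, (hmid w ω).2.1, (hmid z χ).2.2.2, (hmid w ω).2.2.2]
  rw [e1, e2] at key
  rw [← key, Complex.conj_conj]

theorem IsSegreFamilyOf.eventually_symm {ρ : ℂ × ℂ → ℂ → ℂ} {M : Set (ℂ × ℂ)}
    (h : IsSegreFamilyOf ρ M) : ∀ᶠ q : (ℂ × ℂ) × (ℂ × ℂ) in 𝓝 0,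
      q.1.2 = ρ q.2 q.1.1 ↔ q.2.2 = ρ q.1 q.2.1 := by
  obtain ⟨φ, g, hφ, -, hg, hρ⟩ := h
  have hswap : Filter.Tendsto (fun q : (ℂ × ℂ) × (ℂ × ℂ) => (q.2, q.1)) (𝓝 0) (𝓝 0) :=
    (continuous_snd.prodMk continuous_fst).tendsto' _ _ rfl
  have hconj : Filter.Tendsto
      (fun q : (ℂ × ℂ) × (ℂ × ℂ) => (q.1, (conj q.2.1, conj q.2.2))) (𝓝 0) (𝓝 0) := by
    refine Continuous.tendsto' ?_ _ _ (by simp)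
    have := Complex.continuous_conj
    fun_prop
  filter_upwards [hρ, hswap.eventually hρ,
    hconj.eventually (eventually_conj_complexification hφ hg)] with q h1 h2 h3
  rw [← h1, ← h2]
  simp only [Complex.conj_conj] at h3
  rw [show φ (q.2, (conj q.1.1, conj q.1.2)) = conj (φ (q.1, (conj q.2.1, conj q.2.2))) from h3,
    map_eq_zero]

theorem IsSegreFamilyOf.eventually_mem_iff {ρ : ℂ × ℂ → ℂ → ℂ} {M : Set (ℂ × ℂ)}
    (h : IsSegreFamilyOf ρ M) : ∀ᶠ q : ℂ × ℂ in 𝓝 0, q ∈ M ↔ q.2 = ρ q q.1 := by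
  obtain ⟨φ, g, hφ, hgM, hg, hρ⟩ := h
  have hdiag : Filter.Tendsto (fun q : ℂ × ℂ => (q, q)) (𝓝 0) (𝓝 0) :=
    (continuous_id.prodMk continuous_id).tendsto' _ _ rfl
  filter_upwards [hgM.mem_iff, hg, hdiag.eventually hρ] with q h1 h2 h3
  rw [h1, ← h3, h2]
  simp

/-! ### The real form of the coefficients -/

theorem logPoint_injective {n : ℕ} {s s' y : ℂ} (hy : y ≠ 0) (hy1 : ‖y‖ ≤ 1) (hs : ‖s‖ < 1)
    (hs' : ‖s'‖ < 1) (h : logPoint n s y = logPoint n s' y) : s = s' := by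
  have h1 := mul_left_cancel₀ hy h
  have hb : ∀ s : ℂ, ‖s‖ < 1 → -Real.pi < (Complex.I * y ^ n * s).im ∧
      (Complex.I * y ^ n * s).im ≤ Real.pi := by
    intro s hs
    have h2 : ‖Complex.I * y ^ n * s‖ ≤ 1 := by
      rw [norm_mul, norm_mul, norm_pow, Complex.norm_I, one_mul]
      exact mul_le_one₀ (pow_le_one₀ (norm_nonneg _) hy1) (norm_nonneg _) hs.le
    have h3 := abs_le.1 ((Complex.abs_im_le_norm _).trans h2)
    have := Real.pi_gt_three
    constructor <;> linarith
  have h4 := Complex.exp_inj_of_neg_pi_lt_of_le_pi (hb s hs).1 (hb s hs).2 (hb s' hs').1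
    (hb s' hs').2 h1
  exact mul_left_cancel₀ (mul_ne_zero Complex.I_ne_zero (pow_ne_zero n hy)) h4

/-- The Segre symmetry of a real hypersurface, expressed through the solution `X` of the equation:
its value at the point `u`, based at `logPoint n t u`, is its reflection based at `u`. -/
theorem exists_reflection_of_isSegreFamilyOf {S : PositiveSegreFamily} {n : ℕ} {P Q : ℂ → ℂ}
    {r ρ : ℝ} {X X' : ℂ × ℂ → ℂ} {M : Set (ℂ × ℂ)} (hQ : DifferentiableOn ℂ Q (Metric.ball 0 r))
    (hS : S.IsAssociatedWithODE (n + 1) P Q) (hM : IsSegreFamilyOf (S.graph (n + 1)) M)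
    (hX : IsLogSolution n P Q r ρ 0 1 X X') (hρ1 : ρ ≤ 1) :
    ∃ σ > 0, ∀ u : ℝ, u ≠ 0 → (u : ℂ) ∈ Metric.ball (0 : ℂ) σ → ∀ t ∈ Metric.ball (0 : ℂ) σ,
      X (logScale n t u * (0 - t), logPoint n t u) = conj (X (-conj t, u)) := by
  obtain ⟨σ₀, hσ₀, hσρ, hleft, hright⟩ := S.exists_psi_inverse hQ hS hX
  obtain ⟨R, hR, hsymm⟩ := Metric.eventually_nhds_iff_ball.1 hM.eventually_symm
  have hXan : AnalyticAt ℂ X 0 := hX.analytic 0 (Metric.mem_ball_self hX.pos)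
  have hX0 : X 0 = 0 := hX.init 0 (Metric.mem_ball_self hX.pos)
  have hXt : Filter.Tendsto X (𝓝 0) (𝓝 0) := by simpa [hX0] using hXan.continuousAt.tendsto
  have hR4 : 0 < R ^ 2 / 4 := by positivity
  obtain ⟨σ₁, hσ₁, hX₁⟩ := exists_pos_forall_ball
    (hXt.eventually (Metric.ball_mem_nhds 0 (lt_min hσ₀ hR4)))
  obtain ⟨σ₂, hσ₂, -, hbase⟩ := exists_pos_baseChange_mem n (lt_min (lt_min hσ₀ hσ₁) hR)
  refine ⟨min (min σ₂ σ₀) (min R 1), by positivity, fun u hu0 hu t ht => ?_⟩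
  have huC : (u : ℂ) ≠ 0 := by exact_mod_cast hu0
  have hs2 : Metric.ball (0 : ℂ) (min (min σ₂ σ₀) (min R 1)) ⊆ Metric.ball 0 σ₂ :=
    Metric.ball_subset_ball ((min_le_left _ _).trans (min_le_left _ _))
  have hs0 : Metric.ball (0 : ℂ) (min (min σ₂ σ₀) (min R 1)) ⊆ Metric.ball 0 σ₀ :=
    Metric.ball_subset_ball ((min_le_left _ _).trans (min_le_right _ _))
  have hu1 : ‖(u : ℂ)‖ < min R 1 := (mem_ball_zero_iff.1 hu).trans_le (min_le_right _ _)
  have ht1 : ‖t‖ < 1 :=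
    (mem_ball_zero_iff.1 ht).trans_le ((min_le_right _ _).trans (min_le_right _ _))
  obtain ⟨hsm, hym⟩ := hbase 0 (Metric.mem_ball_self hσ₂) t (hs2 ht) u (hs2 hu)
  set y := logPoint n t u with hy
  set s' := logScale n t u * (0 - t) with hs'
  have hy0 : y ≠ 0 := logPoint_ne_zero n t huC
  have b0 : Metric.ball (0 : ℂ) (min (min σ₀ σ₁) R) ⊆ Metric.ball 0 σ₀ :=
    Metric.ball_subset_ball ((min_le_left _ _).trans (min_le_left _ _))
  have b1 : Metric.ball (0 : ℂ) (min (min σ₀ σ₁) R) ⊆ Metric.ball 0 σ₁ :=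
    Metric.ball_subset_ball ((min_le_left _ _).trans (min_le_right _ _))
  have hyR : ‖y‖ < R := (mem_ball_zero_iff.1 hym).trans_le (min_le_right _ _)
  have hxm := hX₁ s' (b1 hsm) y (b1 hym)
  set x := X (s', y) with hx
  have hxR : ‖x‖ < R ^ 2 / 4 := (mem_ball_zero_iff.1 hxm).trans_le (min_le_right _ _)
  have hx0 : x ∈ Metric.ball (0 : ℂ) σ₀ := Metric.ball_subset_ball (min_le_left _ _) hxm
  have hψ : S.ψ (x, y) = s' := hright s' (b0 hsm) y (b0 hym) hy0
  have hRC : ((R / 2 : ℝ) : ℂ) ≠ 0 := by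
    have : (R / 2 : ℝ) ≠ 0 := by positivity
    exact_mod_cast this
  have hxdiv : x / ((R / 2 : ℝ) : ℂ) * ((R / 2 : ℝ) : ℂ) = x := div_mul_cancel₀ x hRC
  have hmem : ((x / ((R / 2 : ℝ) : ℂ), (u : ℂ)), (((R / 2 : ℝ) : ℂ), conj y)) ∈
      Metric.ball (0 : (ℂ × ℂ) × (ℂ × ℂ)) R := by
    have hRn : ‖((R / 2 : ℝ) : ℂ)‖ = R / 2 := by
      rw [Complex.norm_real, Real.norm_eq_abs, abs_of_pos (by positivity)]
    simp only [mem_ball_zero_iff, Prod.norm_def, max_lt_iff, norm_div, hRn, Complex.norm_conj]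
    refine ⟨⟨?_, hu1.trans_le (min_le_left _ _)⟩, by linarith, hyR⟩
    rw [div_lt_iff₀ (by positivity)]
    nlinarith
  have hiff := hsymm _ hmem
  simp only [S.graph_eq_logPoint, Complex.conj_conj, Complex.conj_ofReal, hxdiv, hψ,
    map_div₀] at hiff
  rw [mul_div_cancel₀ _ hRC] at hiff
  have hbc : logPoint n s' y = u := by
    rw [hs', hy, logPoint_base_change, logPoint_zero_left]
  have h2 := hiff.1 hbc.symm
  obtain ⟨h3, h4⟩ := hleft _ (conj_mem_ball hx0) u (hs0 hu) huC
  rw [hy, conj_logPoint] at h2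
  have h5 := logPoint_injective huC (hu1.le.trans (min_le_right _ _))
    (by simpa using ht1) ((mem_ball_zero_iff.1 h3).trans_le hρ1) h2
  rw [← h5] at h4
  rw [h4, Complex.conj_conj]

/-- The reflection of `X` at a real base point `u` satisfies, besides the reflected equation, the
adjoint one: by reciprocity it is the adjoint solution with initial values `0`, `-1`. -/
theorem IsLogSolution.eventually_adjoint_reflect {n : ℕ} {P Q : ℂ → ℂ} {r ρ σ : ℝ}
    {X X' : ℂ × ℂ → ℂ} (hP : DifferentiableOn ℂ P (Metric.ball 0 r))
    (hQ : DifferentiableOn ℂ Q (Metric.ball 0 r))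
    (hX : IsLogSolution n P Q r ρ 0 1 X X') (hσ : σ ≤ ρ)
    (hbase : ∀ s ∈ Metric.ball (0 : ℂ) σ, ∀ t ∈ Metric.ball (0 : ℂ) σ,
      ∀ u ∈ Metric.ball (0 : ℂ) σ, logScale n t u * (s - t) ∈ Metric.ball (0 : ℂ) ρ ∧
        logPoint n t u ∈ Metric.ball (0 : ℂ) ρ) {u : ℂ} (hu : u ∈ Metric.ball (0 : ℂ) σ)
    (hrefl : ∀ t ∈ Metric.ball (0 : ℂ) σ,
      X (logScale n t u * (0 - t), logPoint n t u) = conj (X (-conj t, u))) :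
    ∀ᶠ s in 𝓝 (0 : ℂ), (-2 * (n * (Complex.I * u ^ n)) - logCoeffA n P (s, u)) *
        -conj (X' (-conj s, u)) +
        (logCoeffB n Q (s, u) - deriv (fun s => logCoeffA n P (s, u)) s -
          n * (Complex.I * u ^ n) * (n * (Complex.I * u ^ n) + logCoeffA n P (s, u))) *
          conj (X (-conj s, u)) =
      -conj (logCoeffA n P (-conj s, u)) * -conj (X' (-conj s, u)) +
        conj (logCoeffB n Q (-conj s, u)) * conj (X (-conj s, u)) := by
  have hσ0 : 0 < σ := (norm_nonneg u).trans_lt (mem_ball_zero_iff.1 hu)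
  have huρ : u ∈ Metric.ball (0 : ℂ) ρ := Metric.ball_subset_ball hσ hu
  have hρ0 : (0 : ℂ) ∈ Metric.ball (0 : ℂ) ρ := Metric.mem_ball_self hX.pos
  have hw := Metric.isOpen_ball.mem_nhds (hX.mem_ball 0 hρ0 u huρ)
  have hpair : AnalyticAt ℂ (fun s : ℂ => (s, u)) 0 := analyticAt_id.prod analyticAt_const
  have hA : AnalyticAt ℂ (fun s => logCoeffA n P (s, u)) 0 :=
    AnalyticAt.fun_comp (f := fun s : ℂ => (s, u)) (analyticAt_logCoeffA (hP.analyticAt hw)) hpair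
  have hB : AnalyticAt ℂ (fun s => logCoeffB n Q (s, u)) 0 :=
    AnalyticAt.fun_comp (f := fun s : ℂ => (s, u)) (analyticAt_logCoeffB (hQ.analyticAt hw)) hpair
  have hA1 : AnalyticAt ℂ (fun s => -2 * (n * (Complex.I * u ^ n)) - logCoeffA n P (s, u)) 0 :=
    analyticAt_const.sub hA
  have hB1 : AnalyticAt ℂ (fun s => logCoeffB n Q (s, u) -
      deriv (fun s => logCoeffA n P (s, u)) s -
      n * (Complex.I * u ^ n) * (n * (Complex.I * u ^ n) + logCoeffA n P (s, u))) 0 :=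
    (hB.sub hA.deriv).sub (analyticAt_const.mul (analyticAt_const.add hA))
  obtain ⟨ρ', hρ', G, G', -, -, hinit, hode⟩ := exists_linearODE_solution
    (AnalyticAt.fun_comp (f := fun p : ℂ × ℂ => p.1) (x := 0) hA1 analyticAt_fst)
    (AnalyticAt.fun_comp (f := fun p : ℂ × ℂ => p.1) (x := 0) hB1 analyticAt_fst) 0 (-1)
  have h0 : (0 : ℂ) ∈ Metric.ball (0 : ℂ) ρ' := Metric.mem_ball_self hρ'
  set σ' := min σ ρ' with hσ'
  have hsub : Metric.ball (0 : ℂ) σ' ⊆ Metric.ball 0 σ := Metric.ball_subset_ball (min_le_left _ _)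
  have hsub' : Metric.ball (0 : ℂ) σ' ⊆ Metric.ball 0 ρ' :=
    Metric.ball_subset_ball (min_le_right _ _)
  have hG : ∀ t ∈ Metric.ball (0 : ℂ) σ', G (t, 0) = conj (X (-conj t, u)) := by
    intro t ht
    have h := hX.adjoint_eq hP hσ hu (fun s hs => (hbase s hs t (hsub ht) u hu).1)
      (hbase t (hsub ht) t (hsub ht) u hu).2 (min_le_left σ ρ') ht
      (g := fun s => G (s, 0)) (g' := fun s => G' (s, 0))
      (fun s hs => (hode s (hsub' hs) 0 h0).1) (fun s hs => (hode s (hsub' hs) 0 h0).2)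
    rw [h, (hinit 0 h0).1, (hinit 0 h0).2, hrefl t (hsub ht)]
    ring
  have hG' : ∀ t ∈ Metric.ball (0 : ℂ) σ', G' (t, 0) = -conj (X' (-conj t, u)) := by
    intro t ht
    have h1 := (hX.hasDerivAt_reflect (Metric.ball_subset_ball hσ (hsub ht)) huρ).1
    refine ((hode t (hsub' ht) 0 h0).1.congr_of_eventuallyEq ?_).unique h1
    filter_upwards [Metric.isOpen_ball.mem_nhds ht] with s hs using (hG s hs).symm
  filter_upwards [Metric.ball_mem_nhds (0 : ℂ) (show 0 < σ' by positivity)] with t ht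
  have h1 := (hX.hasDerivAt_reflect (Metric.ball_subset_ball hσ (hsub ht)) huρ).2
  have h2 := (hode t (hsub' ht) 0 h0).2
  rw [hG t ht, hG' t ht] at h2
  refine (h2.congr_of_eventuallyEq ?_).unique h1
  filter_upwards [Metric.isOpen_ball.mem_nhds ht] with s hs using (hG' s hs).symm

theorem eventually_real_mem_ball {σ : ℝ} (hσ : 0 < σ) :
    ∀ᶠ u : ℝ in 𝓝[≠] 0, u ≠ 0 ∧ (u : ℂ) ∈ Metric.ball (0 : ℂ) σ := by
  refine (eventually_mem_nhdsWithin).and (nhdsWithin_le_nhds ?_)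
  exact (Complex.continuous_ofReal.tendsto' 0 0 Complex.ofReal_zero).eventually
    (Metric.ball_mem_nhds 0 hσ)

/-- The Segre symmetry forces the real form of the coefficients: at a real base point `u` the
adjoint and the reflected equation have a common solution vanishing to first order at `0`, which
gives first `P`, then the equality of the two equations, and thereby `Q`. -/
theorem exists_real_form_of_reflection {n : ℕ} {P Q : ℂ → ℂ} {r ρ : ℝ}
    {X X' : ℂ × ℂ → ℂ} (hP : DifferentiableOn ℂ P (Metric.ball 0 r))
    (hQ : DifferentiableOn ℂ Q (Metric.ball 0 r)) (hX : IsLogSolution n P Q r ρ 0 1 X X')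
    (hrefl : ∃ σ > 0, ∀ u : ℝ, u ≠ 0 → (u : ℂ) ∈ Metric.ball (0 : ℂ) σ →
      ∀ t ∈ Metric.ball (0 : ℂ) σ,
        X (logScale n t u * (0 - t), logPoint n t u) = conj (X (-conj t, u))) :
    ∃ a b : ℂ → ℂ, IsRealPowerSeriesOn a r ∧ IsRealPowerSeriesOn b r ∧
      DifferentiableOn ℂ a (Metric.ball 0 r) ∧ ∀ w ∈ Metric.ball (0 : ℂ) r,
        P w = 2 * Complex.I * a w - ((n : ℂ) + 1) * w ^ n ∧
        Q w = b w + Complex.I * w ^ (n + 1) * deriv a w := by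
  obtain ⟨σ₁, hσ₁, hrefl⟩ := hrefl
  obtain ⟨σ₂, hσ₂, hσ₂ρ, hbase⟩ := exists_pos_baseChange_mem n hX.pos
  set σ := min σ₁ σ₂ with hσ
  have hσ0 : 0 < σ := by positivity
  have hs1 : Metric.ball (0 : ℂ) σ ⊆ Metric.ball 0 σ₁ := Metric.ball_subset_ball (min_le_left _ _)
  have hs2 : Metric.ball (0 : ℂ) σ ⊆ Metric.ball 0 σ₂ := Metric.ball_subset_ball (min_le_right _ _)
  have hσρ : σ ≤ ρ := (min_le_right _ _).trans hσ₂ρ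
  have hsρ : Metric.ball (0 : ℂ) σ ⊆ Metric.ball 0 ρ := Metric.ball_subset_ball hσρ
  have h0ρ : (0 : ℂ) ∈ Metric.ball (0 : ℂ) ρ := Metric.mem_ball_self hX.pos
  have hadj : ∀ u : ℝ, u ≠ 0 → (u : ℂ) ∈ Metric.ball (0 : ℂ) σ → _ := fun u hu0 hu =>
    hX.eventually_adjoint_reflect hP hQ hσρ
      (fun s hs t ht u hu => hbase s (hs2 hs) t (hs2 ht) u (hs2 hu)) hu
      (fun t ht => hrefl u hu0 (hs1 hu) t (hs1 ht))
  have hI0 := Complex.I_ne_zero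
  set a : ℂ → ℂ := fun w => (P w + ((n : ℂ) + 1) * w ^ n) / (2 * Complex.I) with ha
  have hPa : ∀ w ∈ Metric.ball (0 : ℂ) r,
      P w = 2 * Complex.I * a w - ((n : ℂ) + 1) * w ^ n := fun w _ => by
    rw [ha]; field_simp; ring
  have had : DifferentiableOn ℂ a (Metric.ball 0 r) :=
    (hP.add (by fun_prop)).div_const _
  have hareal : ∀ᶠ u : ℝ in 𝓝[≠] 0, conj (a u) = a u := by
    filter_upwards [eventually_real_mem_ball hσ0] with u ⟨hu0, hu⟩
    have h := (hadj u hu0 hu).self_of_nhds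
    simp only [map_zero, neg_zero, hX.init u (hsρ hu), hX.init_deriv u (hsρ hu), map_one, mul_zero,
      add_zero, logCoeffA, logPoint_zero_left, logScale_zero_left, mul_one, map_mul, map_add,
      map_pow, Complex.conj_I, Complex.conj_ofReal] at h
    simp only [ha, map_div₀, map_add, map_mul, map_pow, Complex.conj_ofReal, map_natCast, map_one,
      Complex.conj_I, map_ofNat]
    have h' : conj (P u) = -(2 * ((n : ℂ) + 1) * (u : ℂ) ^ n) - P u :=
      mul_left_cancel₀ hI0 (by linear_combination h)
    rw [h']; field_simp; ring
  have hac : ∀ w ∈ Metric.ball (0 : ℂ) r, conj (a (conj w)) = a w := fun w hw =>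
    conj_apply_conj_of_real had hareal hw
  have hda : DifferentiableOn ℂ (deriv a) (Metric.ball 0 r) := had.deriv Metric.isOpen_ball
  set b : ℂ → ℂ := fun w => Q w - Complex.I * w ^ (n + 1) * deriv a w with hb
  have hbd : DifferentiableOn ℂ b (Metric.ball 0 r) := by
    refine hQ.sub (DifferentiableOn.mul ?_ hda)
    fun_prop
  have hbreal : ∀ᶠ u : ℝ in 𝓝[≠] 0, conj (b u) = b u := by
    filter_upwards [eventually_real_mem_ball hσ0] with u ⟨hu0, hu⟩
    have hur : (u : ℂ) ∈ Metric.ball (0 : ℂ) r := by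
      simpa using hX.mem_ball 0 h0ρ u (hsρ hu)
    set k : ℂ → ℂ := fun s => Q (logPoint n s u) - conj (Q (conj (logPoint n s u))) -
      2 * Complex.I * logPoint n s u ^ (n + 1) * deriv a (logPoint n s u) with hk
    have hkc : ContinuousAt k 0 := by
      have hl : ContinuousAt (fun s => logPoint n s (u : ℂ)) 0 :=
        (hasDerivAt_logPoint n 0 u).continuousAt
      have hnb := Metric.isOpen_ball.mem_nhds hur
      have hl0 : logPoint n 0 (u : ℂ) = u := logPoint_zero_left n u
      have hQc : ContinuousAt Q (logPoint n 0 u) := by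
        rw [hl0]; exact (hQ.differentiableAt hnb).continuousAt
      have hQc' : ContinuousAt Q (conj (logPoint n 0 (u : ℂ))) := by
        rw [hl0, Complex.conj_ofReal]; exact (hQ.differentiableAt hnb).continuousAt
      have hac' : ContinuousAt (deriv a) (logPoint n 0 u) := by
        rw [hl0]; exact (hda.differentiableAt hnb).continuousAt
      have c1 : ContinuousAt (fun s => Q (logPoint n s u)) 0 :=
        ContinuousAt.comp (f := fun s => logPoint n s (u : ℂ)) hQc hl
      have c2 : ContinuousAt (fun s => conj (logPoint n s (u : ℂ))) 0 :=
        Complex.continuous_conj.continuousAt.comp hl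
      have c3 : ContinuousAt (fun s => Q (conj (logPoint n s (u : ℂ)))) 0 :=
        ContinuousAt.comp (f := fun s => conj (logPoint n s (u : ℂ))) hQc' c2
      have c4 : ContinuousAt (fun s => conj (Q (conj (logPoint n s (u : ℂ))))) 0 :=
        Complex.continuous_conj.continuousAt.comp c3
      have c5 : ContinuousAt (fun s => deriv a (logPoint n s u)) 0 :=
        ContinuousAt.comp (f := fun s => logPoint n s (u : ℂ)) hac' hl
      exact (c1.sub c4).sub ((continuousAt_const.mul (hl.pow (n + 1))).mul c5)
    have hne : ∀ᶠ s in 𝓝[≠] (0 : ℂ), conj (X (-conj s, u)) ≠ 0 := by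
      refine (hX.hasDerivAt_reflect h0ρ (hsρ hu)).1.eventually_ne ?_
      simp [hX.init_deriv u (hsρ hu)]
    have hk0 : ∀ᶠ s in 𝓝[≠] (0 : ℂ), k s = 0 := by
      filter_upwards [hne, nhdsWithin_le_nhds (hadj u hu0 hu),
        nhdsWithin_le_nhds (Metric.ball_mem_nhds (0 : ℂ) hX.pos)] with s h1 h2 hs
      have hm := hX.mem_ball s hs u (hsρ hu)
      have hm' := hX.mem_ball _ (neg_conj_mem_ball hs) u (hsρ hu)
      rw [reflect_logCoeffA hPa hac hm hm'] at h2
      have h3 := mul_right_cancel₀ h1 (add_left_cancel h2)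
      have h4 := reflect_logCoeffB (Q := Q) hPa had hm
      rw [h3, sub_self] at h4
      have h5 := mul_eq_zero.1 h4.symm
      exact neg_eq_zero.1 (h5.resolve_right (pow_ne_zero 2 (logScale_ne_zero n s u)))
    have hk00 : k 0 = 0 := tendsto_nhds_unique (hkc.tendsto.mono_left nhdsWithin_le_nhds)
      (tendsto_const_nhds.congr' (by filter_upwards [hk0] with s hs using hs.symm))
    simp only [hk, logPoint_zero_left, Complex.conj_ofReal] at hk00
    have hda' : conj (deriv a u) = deriv a u := by
      simpa using conj_deriv_conj had hac hur
    simp only [hb, map_sub, map_mul, map_pow, Complex.conj_I, Complex.conj_ofReal, hda']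
    linear_combination -hk00
  refine ⟨a, b, isRealPowerSeriesOn_of_conj had hac, isRealPowerSeriesOn_of_conj hbd
    (fun w hw => conj_apply_conj_of_real hbd hbreal hw), had, fun w hw => ⟨hPa w hw, ?_⟩⟩
  rw [hb]; ring

/-! ### Spherical points are Levi nondegenerate -/

theorem analyticAt_norm_sq {f : ℂ × ℂ → ℂ} {p : ℂ × ℂ} (hf : AnalyticAt ℂ f p) :
    AnalyticAt ℝ (fun q => ‖f q‖ ^ 2) p := by
  have h1 : AnalyticAt ℝ f p := hf.restrictScalars
  have h2 : AnalyticAt ℝ (fun q => inner ℝ (f q) (f q)) p :=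
    AnalyticAt.fun_comp (f := fun q => (f q, f q))
      ((innerSL ℝ (E := ℂ)).analyticAt_bilinear _) (h1.prod h1)
  simpa only [real_inner_self_eq_norm_sq] using h2

/-- The Levi form of `‖f‖ ^ 2` for holomorphic `f`: the terms with the second derivative of `f` in
the directions `t` and `i t` cancel. -/
theorem fderiv_norm_sq_of_analyticAt {f : ℂ × ℂ → ℂ} {p : ℂ × ℂ} (hf : AnalyticAt ℂ f p)
    (t : ℂ × ℂ) :
    fderiv ℝ (fun q => ‖f q‖ ^ 2) p t = 2 * inner ℝ (f p) (fderiv ℂ f p t) ∧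
    fderiv ℝ (fderiv ℝ (fun q => ‖f q‖ ^ 2)) p t t +
      fderiv ℝ (fderiv ℝ (fun q => ‖f q‖ ^ 2)) p (Complex.I • t) (Complex.I • t) =
      4 * ‖fderiv ℂ f p t‖ ^ 2 := by
  have hN : ∀ q, AnalyticAt ℂ f q → ∀ t, fderiv ℝ (fun q => ‖f q‖ ^ 2) q t =
      2 * inner ℝ (f q) (fderiv ℂ f q t) := by
    intro q hq t
    have h1 := (hq.differentiableAt.hasFDerivAt.restrictScalars ℝ).norm_sq
    rw [h1.fderiv]
    change 2 • inner ℝ (f q) (fderiv ℂ f q t) = _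
    rw [nsmul_eq_mul, Nat.cast_ofNat]
  refine ⟨hN p hf t, ?_⟩
  have hNan := analyticAt_norm_sq hf
  have hd2 : DifferentiableAt ℝ (fderiv ℝ (fun q => ‖f q‖ ^ 2)) p := hNan.fderiv.differentiableAt
  have hsecond : ∀ t, fderiv ℝ (fderiv ℝ (fun q => ‖f q‖ ^ 2)) p t t =
      2 * (inner ℝ (f p) (fderiv ℂ (fun q => fderiv ℂ f q t) p t) +
        inner ℝ (fderiv ℂ f p t) (fderiv ℂ f p t)) := by
    intro t
    have h1 : fderiv ℝ (fun q => fderiv ℝ (fun q => ‖f q‖ ^ 2) q t) p t =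
        fderiv ℝ (fderiv ℝ (fun q => ‖f q‖ ^ 2)) p t t := by
      rw [fderiv_clm_apply hd2 (differentiableAt_const t)]
      simp
    rw [← h1]
    have h2 : (fun q => fderiv ℝ (fun q => ‖f q‖ ^ 2) q t) =ᶠ[𝓝 p]
        fun q => 2 * inner ℝ (f q) (fderiv ℂ f q t) := by
      filter_upwards [hf.eventually_analyticAt] with q hq using hN q hq t
    rw [h2.fderiv_eq]
    have h3 := hf.differentiableAt.hasFDerivAt.restrictScalars ℝ
    have h4 : AnalyticAt ℂ (fun q => fderiv ℂ f q t) p :=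
      ((ContinuousLinearMap.apply ℂ ℂ t).analyticAt _).comp hf.fderiv
    have h5 := h4.differentiableAt.hasFDerivAt.restrictScalars ℝ
    have h6 := (h3.inner ℝ h5).const_mul 2
    rw [h6.fderiv]
    simp [fderivInnerCLM_apply]
  have hlin : ∀ q, fderiv ℂ f q (Complex.I • t) = Complex.I * fderiv ℂ f q t := fun q => by simp
  have hf4 : AnalyticAt ℂ (fun q => fderiv ℂ f q t) p :=
    ((ContinuousLinearMap.apply ℂ ℂ t).analyticAt _).comp hf.fderiv
  rw [hsecond t, hsecond (Complex.I • t)]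
  simp only [hlin]
  rw [fderiv_const_mul hf4.differentiableAt]
  simp only [smul_apply, map_smul, smul_eq_mul]
  rw [← mul_assoc, Complex.I_mul_I, neg_one_mul, inner_neg_right, real_inner_self_eq_norm_sq,
    real_inner_self_eq_norm_sq, norm_mul, Complex.norm_I]
  ring

/-- A spherical point is Levi nondegenerate: pull back the defining function of the sphere. -/
theorem IsSphericalAt.isLeviNondegenerateAt {M : Set (ℂ × ℂ)} {p : ℂ × ℂ}
    (h : IsSphericalAt M p) : IsLeviNondegenerateAt M p := by
  obtain ⟨hp, Φ, hΦ, hbij, hM⟩ := h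
  have h1 : AnalyticAt ℂ (fun q => (Φ q).1) p := AnalyticAt.fun_comp analyticAt_fst hΦ
  have h2 : AnalyticAt ℂ (fun q => (Φ q).2) p := AnalyticAt.fun_comp analyticAt_snd hΦ
  have hN1 := analyticAt_norm_sq h1
  have hN2 := analyticAt_norm_sq h2
  have hD : ∀ t, fderiv ℂ Φ p t =
      (fderiv ℂ (fun q => (Φ q).1) p t, fderiv ℂ (fun q => (Φ q).2) p t) := by
    intro t
    have := DifferentiableAt.fderiv_prodMk h1.differentiableAt h2.differentiableAt
    change fderiv ℂ (fun q => ((Φ q).1, (Φ q).2)) p t = _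
    rw [this]; rfl
  set g : ℂ × ℂ → ℝ := fun q => ‖(Φ q).1‖ ^ 2 + ‖(Φ q).2‖ ^ 2 - 1 with hg
  have hgd : ∀ q, DifferentiableAt ℝ (fun q => ‖(Φ q).1‖ ^ 2) q →
      DifferentiableAt ℝ (fun q => ‖(Φ q).2‖ ^ 2) q → fderiv ℝ g q =
      fderiv ℝ (fun q => ‖(Φ q).1‖ ^ 2) q + fderiv ℝ (fun q => ‖(Φ q).2‖ ^ 2) q := by
    intro q hq1 hq2
    rw [hg, fderiv_sub_const, fderiv_fun_add hq1 hq2]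
  have hgp := hgd p hN1.differentiableAt hN2.differentiableAt
  refine ⟨g, ⟨hp, (hN1.add hN2).sub analyticAt_const, ?_, ?_⟩, fun t ht _ _ => ?_⟩
  · intro h0
    obtain ⟨t, ht⟩ := hbij.2 (Φ p)
    rw [hD t, Prod.ext_iff] at ht
    dsimp only at ht
    have h3 : fderiv ℝ g p t = 0 := by rw [h0]; rfl
    rw [hgp, add_apply, (fderiv_norm_sq_of_analyticAt h1 t).1,
      (fderiv_norm_sq_of_analyticAt h2 t).1, ht.1, ht.2, real_inner_self_eq_norm_sq,
      real_inner_self_eq_norm_sq] at h3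
    have h4 := hM.self_of_nhds.1 hp
    linarith
  · filter_upwards [hM] with q hq
    rw [hq, hg]
    constructor <;> intro h <;> linarith
  · have hev : fderiv ℝ g =ᶠ[𝓝 p] fun q =>
        fderiv ℝ (fun q => ‖(Φ q).1‖ ^ 2) q + fderiv ℝ (fun q => ‖(Φ q).2‖ ^ 2) q := by
      filter_upwards [hN1.eventually_analyticAt, hN2.eventually_analyticAt] with q hq1 hq2
        using hgd q hq1.differentiableAt hq2.differentiableAt
    have h3 : fderiv ℝ (fderiv ℝ g) p = fderiv ℝ (fderiv ℝ (fun q => ‖(Φ q).1‖ ^ 2)) p +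
        fderiv ℝ (fderiv ℝ (fun q => ‖(Φ q).2‖ ^ 2)) p := by
      rw [hev.fderiv_eq, fderiv_fun_add hN1.fderiv.differentiableAt hN2.fderiv.differentiableAt]
    have h4 : leviForm g p t = ‖fderiv ℂ (fun q => (Φ q).1) p t‖ ^ 2 +
        ‖fderiv ℂ (fun q => (Φ q).2) p t‖ ^ 2 := by
      have e1 := (fderiv_norm_sq_of_analyticAt h1 t).2
      have e2 := (fderiv_norm_sq_of_analyticAt h2 t).2
      rw [leviForm, h3]
      simp only [add_apply]
      linarith
    rw [h4]
    intro h5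
    refine ht (hbij.1 ?_)
    have h6 := sq_nonneg ‖fderiv ℂ (fun q => (Φ q).1) p t‖
    have h7 := sq_nonneg ‖fderiv ℂ (fun q => (Φ q).2) p t‖
    have h8 : ‖fderiv ℂ (fun q => (Φ q).1) p t‖ ^ 2 = 0 := by linarith
    have h9 : ‖fderiv ℂ (fun q => (Φ q).2) p t‖ ^ 2 = 0 := by linarith
    rw [hD t, map_zero, norm_eq_zero.1 (pow_eq_zero_iff two_ne_zero |>.1 h8),
      norm_eq_zero.1 (pow_eq_zero_iff two_ne_zero |>.1 h9)]
    rfl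

theorem isSphericalAt_of_fibered {M : Set (ℂ × ℂ)} {p : ℂ × ℂ} (hp : p ∈ M) {d θ : ℂ → ℂ}
    (hd : AnalyticAt ℂ d p.2) (hθ : AnalyticAt ℂ θ p.2) (hd0 : d p.2 ≠ 0) (hθ0 : deriv θ p.2 ≠ 0)
    (h : ∀ᶠ q in 𝓝 p, q ∈ M ↔ ‖q.1 * d q.2‖ ^ 2 + ‖θ q.2‖ ^ 2 = 1) : IsSphericalAt M p := by
  have h1 : AnalyticAt ℂ (fun q : ℂ × ℂ => q.1 * d q.2) p :=
    analyticAt_fst.mul (AnalyticAt.fun_comp (f := fun q : ℂ × ℂ => q.2) hd analyticAt_snd)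
  have h2 : AnalyticAt ℂ (fun q : ℂ × ℂ => θ q.2) p :=
    AnalyticAt.fun_comp (f := fun q : ℂ × ℂ => q.2) hθ analyticAt_snd
  refine ⟨hp, fun q => (q.1 * d q.2, θ q.2), h1.prod h2, ?_, h⟩
  have hsnd : HasFDerivAt (fun q : ℂ × ℂ => q.2) (ContinuousLinearMap.snd ℂ ℂ ℂ) p := hasFDerivAt_snd
  have hdc := HasDerivAt.comp_hasFDerivAt p hd.differentiableAt.hasDerivAt hsnd
  have hθc := HasDerivAt.comp_hasFDerivAt p hθ.differentiableAt.hasDerivAt hsnd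
  have hF := ((hasFDerivAt_fst (𝕜 := ℂ) (p := p)).mul hdc).prodMk hθc
  have hF' : fderiv ℂ (fun q : ℂ × ℂ => (q.1 * d q.2, θ q.2)) p = _ := hF.fderiv
  have hinj : Function.Injective (fderiv ℂ (fun q : ℂ × ℂ => (q.1 * d q.2, θ q.2)) p) := by
    rw [hF', injective_iff_map_eq_zero]
    intro t ht
    have ht1 := congrArg Prod.fst ht
    have ht2 := congrArg Prod.snd ht
    simp only [ContinuousLinearMap.prod_apply, add_apply, smul_apply, ContinuousLinearMap.coe_snd',
      ContinuousLinearMap.coe_fst', smul_eq_mul, Prod.fst_zero, Prod.snd_zero,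
      Function.comp_apply] at ht1 ht2
    have h3 : t.2 = 0 := (mul_eq_zero.1 ht2).resolve_left hθ0
    rw [h3, mul_zero, mul_zero, zero_add] at ht1
    exact Prod.ext ((mul_eq_zero.1 ht1).resolve_left hd0) h3
  exact ⟨hinj, (LinearMap.injective_iff_surjective
    (f := (fderiv ℂ (fun q : ℂ × ℂ => (q.1 * d q.2, θ q.2)) p).toLinearMap)).1 hinj⟩

/-! ### Sphericity of associated hypersurfaces -/

/-- The real form of the coefficients, as used in computations: `P = 2 i a - (n + 1) w ^ n` with `a`
real on the real axis, and the skew part of `Q` is `i w ^ (n + 1) a'`. -/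
structure HasRealForm (n : ℕ) (P Q : ℂ → ℂ) (r : ℝ) (a : ℂ → ℂ) : Prop where
  differentiableOn : DifferentiableOn ℂ a (Metric.ball 0 r)
  conj_apply_conj : ∀ w ∈ Metric.ball (0 : ℂ) r, conj (a (conj w)) = a w
  P_eq : ∀ w ∈ Metric.ball (0 : ℂ) r, P w = 2 * Complex.I * a w - ((n : ℂ) + 1) * w ^ n
  Q_skew : ∀ w ∈ Metric.ball (0 : ℂ) r,
    Q w - conj (Q (conj w)) = 2 * Complex.I * w ^ (n + 1) * deriv a w

theorem hasRealForm_of_isRealPowerSeriesOn {n : ℕ} {P Q a b : ℂ → ℂ} {r : ℝ}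
    (ha : IsRealPowerSeriesOn a r) (hb : IsRealPowerSeriesOn b r)
    (had : DifferentiableOn ℂ a (Metric.ball 0 r))
    (h : ∀ w ∈ Metric.ball (0 : ℂ) r, P w = 2 * Complex.I * a w - ((n : ℂ) + 1) * w ^ n ∧
      Q w = b w + Complex.I * w ^ (n + 1) * deriv a w) : HasRealForm n P Q r a := by
  refine ⟨had, fun w hw => ha.conj_apply_conj hw, fun w hw => (h w hw).1, fun w hw => ?_⟩
  have h1 := conj_deriv_conj had (fun w hw => ha.conj_apply_conj hw) hw
  have h2 := hb.conj_apply_conj hw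
  rw [(h w hw).2, (h _ (conj_mem_ball hw)).2]
  simp only [map_add, map_mul, map_pow, Complex.conj_I, Complex.conj_conj, h1, h2]
  ring

/-- For coefficients of real form the reflection of a solution solves the adjoint equation. -/
theorem IsLogSolution.hasDerivAt_reflect_adjoint {n : ℕ} {P Q a : ℂ → ℂ} {r ρ : ℝ} {c₀ c₁ : ℂ}
    {X X' : ℂ × ℂ → ℂ} (hX : IsLogSolution n P Q r ρ c₀ c₁ X X') (hPQ : HasRealForm n P Q r a)
    {s : ℂ} {u : ℝ} (hs : s ∈ Metric.ball (0 : ℂ) ρ) (hu : (u : ℂ) ∈ Metric.ball (0 : ℂ) ρ) :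
    HasDerivAt (fun s => -conj (X' (-conj s, (u : ℂ))))
      ((-2 * (n * (Complex.I * (u : ℂ) ^ n)) - logCoeffA n P (s, u)) * -conj (X' (-conj s, u)) +
        (logCoeffB n Q (s, u) - deriv (fun s => logCoeffA n P (s, (u : ℂ))) s -
          n * (Complex.I * (u : ℂ) ^ n) * (n * (Complex.I * (u : ℂ) ^ n) +
            logCoeffA n P (s, u))) * conj (X (-conj s, u))) s := by
  have hm := hX.mem_ball s hs u hu
  have hm' := hX.mem_ball _ (neg_conj_mem_ball hs) u hu
  have h1 := reflect_logCoeffB (Q := Q) hPQ.P_eq hPQ.differentiableOn hm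
  rw [hPQ.Q_skew _ hm, sub_self, neg_zero, zero_mul] at h1
  rw [sub_eq_zero.1 h1, ← reflect_logCoeffA hPQ.P_eq hPQ.conj_apply_conj hm hm']
  exact (hX.hasDerivAt_reflect hs hu).2

/-- For coefficients of real form, the value at `s = 0` of the solution based at `logPoint n t u`
is the reflection of the solution based at `u`. -/
theorem IsLogSolution.baseChange_zero_eq {n : ℕ} {P Q a : ℂ → ℂ} {r ρ σ : ℝ} {X X' : ℂ × ℂ → ℂ}
    (hP : DifferentiableOn ℂ P (Metric.ball 0 r)) (hX : IsLogSolution n P Q r ρ 0 1 X X')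
    (hPQ : HasRealForm n P Q r a) (hσ : σ ≤ ρ)
    (hbase : ∀ s ∈ Metric.ball (0 : ℂ) σ, ∀ t ∈ Metric.ball (0 : ℂ) σ,
      ∀ u ∈ Metric.ball (0 : ℂ) σ, logScale n t u * (s - t) ∈ Metric.ball (0 : ℂ) ρ ∧
        logPoint n t u ∈ Metric.ball (0 : ℂ) ρ)
    {t : ℂ} {u : ℝ} (ht : t ∈ Metric.ball (0 : ℂ) σ) (hu : (u : ℂ) ∈ Metric.ball (0 : ℂ) σ) :
    X (logScale n t u * (0 - t), logPoint n t u) = conj (X (-conj t, u)) := by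
  have hsρ : Metric.ball (0 : ℂ) σ ⊆ Metric.ball 0 ρ := Metric.ball_subset_ball hσ
  have h := hX.adjoint_eq hP hσ hu (fun s hs => (hbase s hs t ht u hu).1)
    (hbase t ht t ht u hu).2 le_rfl ht
    (fun s hs => (hX.hasDerivAt_reflect (hsρ hs) (hsρ hu)).1)
    (fun s hs => hX.hasDerivAt_reflect_adjoint hPQ (hsρ hs) (hsρ hu))
  simp only [map_zero, neg_zero, hX.init _ (hsρ hu), hX.init_deriv _ (hsρ hu), map_one] at h
  rw [h]; ring

/-- The solution based at `logPoint n t u`, expressed through the fundamental solutions `X`, `Y`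
based at the real point `u` and their reflections: a Hermitian form. -/
theorem IsLogSolution.baseChange_eq {n : ℕ} {P Q a : ℂ → ℂ} {r ρ σ : ℝ} {X X' Y Y' : ℂ × ℂ → ℂ}
    (hP : DifferentiableOn ℂ P (Metric.ball 0 r)) (hQ : DifferentiableOn ℂ Q (Metric.ball 0 r))
    (hX : IsLogSolution n P Q r ρ 0 1 X X') (hY : IsLogSolution n P Q r ρ 1 0 Y Y')
    (hPQ : HasRealForm n P Q r a) (hσ : σ ≤ ρ)
    (hbase : ∀ s ∈ Metric.ball (0 : ℂ) σ, ∀ t ∈ Metric.ball (0 : ℂ) σ,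
      ∀ u ∈ Metric.ball (0 : ℂ) σ, logScale n t u * (s - t) ∈ Metric.ball (0 : ℂ) ρ ∧
        logPoint n t u ∈ Metric.ball (0 : ℂ) ρ)
    {s t : ℂ} {u : ℝ} (hs : s ∈ Metric.ball (0 : ℂ) σ) (ht : t ∈ Metric.ball (0 : ℂ) σ)
    (hu : (u : ℂ) ∈ Metric.ball (0 : ℂ) σ) :
    X (logScale n t u * (s - t), logPoint n t u) =
      (conj (Y (-conj t, u)) - 2 * a u * conj (X (-conj t, u))) * X (s, u) +
        conj (X (-conj t, u)) * Y (s, u) := by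
  have hsρ : Metric.ball (0 : ℂ) σ ⊆ Metric.ball 0 ρ := Metric.ball_subset_ball hσ
  have h0 : (0 : ℂ) ∈ Metric.ball (0 : ℂ) σ :=
    Metric.mem_ball_self ((norm_nonneg t).trans_lt (mem_ball_zero_iff.1 ht))
  have hX0 := hX.baseChange_zero_eq hP hPQ hσ hbase ht hu
  have hmY := (hbase t ht t ht u hu).2
  have hc : n * (Complex.I * (u : ℂ) ^ n) + logCoeffA n P (0, (u : ℂ)) = -(2 * a u) := by
    rw [logCoeffA_eq (hPQ.P_eq _ (hX.mem_ball 0 (hsρ h0) u (hsρ hu)))]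
    simp only [logPoint_zero_left, logScale_zero_left]
    ring
  have hX1 : logScale n t u * X' (logScale n t u * (0 - t), logPoint n t u) =
      conj (Y (-conj t, u)) - 2 * a u * conj (X (-conj t, u)) := by
    have h := hX.adjoint_eq hP hσ hu (fun s hs => (hbase s hs t ht u hu).1)
      hmY le_rfl ht
      (fun s hs => (hY.hasDerivAt_reflect (hsρ hs) (hsρ hu)).1)
      (fun s hs => hY.hasDerivAt_reflect_adjoint hPQ (hsρ hs) (hsρ hu))
    simp only [map_zero, neg_zero, hY.init _ (hsρ hu), hY.init_deriv _ (hsρ hu), map_one,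
      hc, hX0] at h
    rw [h]; ring
  set α := conj (Y (-conj t, u)) - 2 * a u * conj (X (-conj t, u)) with hα
  set β := conj (X (-conj t, u)) with hβ
  have hcont : ∀ F : ℂ × ℂ → ℂ, (∀ s ∈ Metric.ball (0 : ℂ) σ, AnalyticAt ℂ F (s, (u : ℂ))) →
      ContinuousOn (fun s => F (s, (u : ℂ))) (Metric.ball 0 σ) := fun F hF s hs =>
    (ContinuousAt.comp (f := fun s : ℂ => (s, (u : ℂ))) (hF s hs).continuousAt
      (continuousAt_id.prodMk continuousAt_const)).continuousWithinAt
  have hz := eq_zero_of_linearODE (σ := σ)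
    (a := fun s => logCoeffA n P (s, (u : ℂ))) (b := fun s => logCoeffB n Q (s, (u : ℂ)))
    (f := fun s => X (logScale n t u * (s - t), logPoint n t u) -
      (α * X (s, u) + β * Y (s, u)))
    (f' := fun s => logScale n t u * X' (logScale n t u * (s - t), logPoint n t u) -
      (α * X' (s, u) + β * Y' (s, u)))
    (hcont _ fun s hs => analyticAt_logCoeffA (hP.analyticAt
      (Metric.isOpen_ball.mem_nhds (hX.mem_ball s (hsρ hs) u (hsρ hu)))))
    (hcont _ fun s hs => analyticAt_logCoeffB (hQ.analyticAt
      (Metric.isOpen_ball.mem_nhds (hX.mem_ball s (hsρ hs) u (hsρ hu)))))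
    (fun s hs => (hX.hasDerivAt_baseChange (hbase s hs t ht u hu).1 hmY).1.sub
      (((hX.hasDerivAt s (hsρ hs) u (hsρ hu)).const_mul α).add
        ((hY.hasDerivAt s (hsρ hs) u (hsρ hu)).const_mul β)))
    (fun s hs => by
      have h1 := (hX.hasDerivAt_baseChange (hbase s hs t ht u hu).1 hmY).2.sub
        (((hX.hasDerivAt_deriv s (hsρ hs) u (hsρ hu)).const_mul α).add
          ((hY.hasDerivAt_deriv s (hsρ hs) u (hsρ hu)).const_mul β))
      convert! h1 using 1
      ring)
    (by simp only [hX0, hX.init _ (hsρ hu), hY.init _ (hsρ hu)]; ring)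
    (by simp only [hX1, hX.init_deriv _ (hsρ hu), hY.init_deriv _ (hsρ hu)]; ring) s hs
  exact sub_eq_zero.1 hz.1

/-- Near a point with real base point `u`, the hypersurface is a sphere in terms of the fundamental
solutions `X`, `Y` based at `u`. -/
theorem exists_mem_iff_sphere {S : PositiveSegreFamily} {n : ℕ} {P Q a : ℂ → ℂ} {r ρ : ℝ}
    {X X' Y Y' : ℂ × ℂ → ℂ} {M : Set (ℂ × ℂ)} (hP : DifferentiableOn ℂ P (Metric.ball 0 r))
    (hQ : DifferentiableOn ℂ Q (Metric.ball 0 r))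
    (hS : S.IsAssociatedWithODE (n + 1) P Q) (hM : IsSegreFamilyOf (S.graph (n + 1)) M)
    (hX : IsLogSolution n P Q r ρ 0 1 X X') (hY : IsLogSolution n P Q r ρ 1 0 Y Y')
    (hρ1 : ρ ≤ 1) (hPQ : HasRealForm n P Q r a) :
    ∃ σ > 0, σ ≤ ρ ∧ ∀ u : ℝ, u ≠ 0 → (u : ℂ) ∈ Metric.ball (0 : ℂ) σ →
      ∀ s ∈ Metric.ball (0 : ℂ) σ, ∀ z ∈ Metric.ball (0 : ℂ) σ,
        ((z, logPoint n s u) ∈ M ↔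
          2 * ‖z‖ ^ 2 + ‖Y (s, u) - a u * X (s, u) - X (s, u)‖ ^ 2 =
            ‖Y (s, u) - a u * X (s, u) + X (s, u)‖ ^ 2) := by
  have hρ := hX.pos
  obtain ⟨σ₀, hσ₀, hσρ, hleft, hright⟩ := S.exists_psi_inverse hQ hS hX
  obtain ⟨R, hR, hmem⟩ := Metric.eventually_nhds_iff_ball.1 hM.eventually_mem_iff
  obtain ⟨σ₂, hσ₂, hσ₂ρ, hbase⟩ := exists_pos_baseChange_mem n (lt_min hσ₀ hR)
  have hσρ' : min σ₀ R ≤ ρ := (min_le_left _ _).trans hσρ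
  refine ⟨min (min σ₂ σ₀) R, by positivity,
    (min_le_left _ _).trans ((min_le_right _ _).trans hσρ), fun u hu0 hu s hs z hz => ?_⟩
  have huC : (u : ℂ) ≠ 0 := by exact_mod_cast hu0
  have hs2 : Metric.ball (0 : ℂ) (min (min σ₂ σ₀) R) ⊆ Metric.ball 0 σ₂ :=
    Metric.ball_subset_ball ((min_le_left _ _).trans (min_le_left _ _))
  have hs0 : Metric.ball (0 : ℂ) (min (min σ₂ σ₀) R) ⊆ Metric.ball 0 σ₀ :=
    Metric.ball_subset_ball ((min_le_left _ _).trans (min_le_right _ _))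
  have hsR : Metric.ball (0 : ℂ) (min (min σ₂ σ₀) R) ⊆ Metric.ball 0 R :=
    Metric.ball_subset_ball (min_le_right _ _)
  have hbρ : Metric.ball (0 : ℂ) (min σ₀ R) ⊆ Metric.ball 0 ρ := Metric.ball_subset_ball hσρ'
  have hb0 : Metric.ball (0 : ℂ) (min σ₀ R) ⊆ Metric.ball 0 σ₀ :=
    Metric.ball_subset_ball (min_le_left _ _)
  set w := logPoint n s u with hw
  set t := -conj s with ht
  have htm : t ∈ Metric.ball (0 : ℂ) σ₂ := neg_conj_mem_ball (hs2 hs)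
  have hts : -conj t = s := by simp [ht]
  have hwt : logPoint n t u = conj w := by rw [hw, conj_logPoint]
  have hw0 : conj w ≠ 0 := by
    rw [← hwt]; exact logPoint_ne_zero n t huC
  set s' := logScale n t u * (s - t) with hs'
  obtain ⟨hs'm, hwm⟩ := hbase s (hs2 hs) t htm u (hs2 hu)
  rw [hwt] at hwm
  have hbc : logPoint n s' (conj w) = w := by rw [hs', ← hwt, logPoint_base_change]
  have hbase' : ∀ s ∈ Metric.ball (0 : ℂ) σ₂, ∀ t ∈ Metric.ball (0 : ℂ) σ₂,
      ∀ u ∈ Metric.ball (0 : ℂ) σ₂, logScale n t u * (s - t) ∈ Metric.ball (0 : ℂ) ρ ∧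
        logPoint n t u ∈ Metric.ball (0 : ℂ) ρ := fun s hs t ht u hu =>
    ⟨hbρ (hbase s hs t ht u hu).1, hbρ (hbase s hs t ht u hu).2⟩
  have hrep := hX.baseChange_eq hP hQ hY hPQ (hσ₂ρ.trans hσρ') hbase' (hs2 hs) htm (hs2 hu)
  rw [hts, ← hs', hwt] at hrep
  have hwR : w ∈ Metric.ball (0 : ℂ) R := by
    have h1 := Metric.ball_subset_ball (min_le_right σ₀ R) hwm
    simpa using h1
  have hzn : ‖z‖ < 1 := (mem_ball_zero_iff.1 (hs0 hz)).trans_le (hσρ.trans hρ1)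
  have hzz : z * conj z ∈ Metric.ball (0 : ℂ) σ₀ := by
    have h1 := mem_ball_zero_iff.1 (hs0 hz)
    rw [mem_ball_zero_iff, norm_mul, Complex.norm_conj]
    nlinarith [norm_nonneg z]
  obtain ⟨hψm, hψ⟩ := hleft _ hzz _ (hb0 hwm) hw0
  have hiff : (z, w) ∈ M ↔ z * conj z = X (s', conj w) := by
    rw [hmem (z, w) (mk_mem_ball_zero.2 ⟨hsR hz, hwR⟩), S.graph_eq_logPoint]
    constructor
    · intro h
      have h1 : s' = S.ψ (z * conj z, conj w) := by
        refine logPoint_injective hw0 ?_ ?_ ?_ (hbc.trans h)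
        · exact (mem_ball_zero_iff.1 (hbρ hwm)).le.trans hρ1
        · exact (mem_ball_zero_iff.1 (hbρ hs'm)).trans_le hρ1
        · exact (mem_ball_zero_iff.1 hψm).trans_le hρ1
      rw [h1, hψ]
    · intro h
      change w = logPoint n (S.ψ (z * conj z, conj w)) (conj w)
      rw [h, hright s' (hb0 hs'm) _ (hb0 hwm) hw0, hbc]
  rw [hiff, hrep]
  have hur : (u : ℂ) ∈ Metric.ball (0 : ℂ) r := by
    have h1 : (u : ℂ) ∈ Metric.ball (0 : ℂ) ρ := Metric.ball_subset_ball hσρ (hs0 hu)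
    simpa using hX.mem_ball 0 (Metric.mem_ball_self hρ) u h1
  have hau : conj (a u) = a u := by simpa using hPQ.conj_apply_conj u hur
  have hsq : ∀ x : ℂ, ((‖x‖ ^ 2 : ℝ) : ℂ) = x * conj x := fun x => by
    rw [Complex.mul_conj, Complex.normSq_eq_norm_sq]
  rw [← Complex.ofReal_inj (z := 2 * ‖z‖ ^ 2 + _)]
  rw [Complex.ofReal_add, Complex.ofReal_mul, hsq, hsq, hsq]
  simp only [map_sub, map_add, map_mul, hau, Complex.ofReal_ofNat]
  constructor
  · intro h; linear_combination 2 * h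
  · intro h; linear_combination (1 / 2 : ℂ) * h

/-- Off the complex locus an associated hypersurface is spherical: the local biholomorphism is
`(z, w) ↦ (√2 z / (e + X), (e - X) / (e + X))` with `e = Y - a(u) X`, where `X`, `Y` are the
fundamental solutions at the base point `u = Re w` of the given point, as functions of `w`. -/
theorem eventually_isSphericalAt {n : ℕ} {P Q a : ℂ → ℂ} {r : ℝ} (hr : 0 < r) {M : Set (ℂ × ℂ)}
    (hP : DifferentiableOn ℂ P (Metric.ball 0 r)) (hQ : DifferentiableOn ℂ Q (Metric.ball 0 r))
    (hM : IsPositivelyAssociatedHypersurface (n + 1) P Q M) (hPQ : HasRealForm n P Q r a) :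
    ∀ᶠ p : ℂ × ℂ in 𝓝 0, p ∈ M → p.2 ≠ 0 → IsSphericalAt M p := by
  obtain ⟨⟨H, hH, hH0, hMH⟩, S, hS, hSM⟩ := hM
  obtain ⟨ρ₁, X, X', hX₁⟩ := exists_isLogSolution n hr hP hQ 0 1
  obtain ⟨ρ₂, Y, Y', hY₁⟩ := exists_isLogSolution n hr hP hQ 1 0
  have hρ₁ := hX₁.pos
  have hρ₂ := hY₁.pos
  set ρ := min (min ρ₁ ρ₂) 1 with hρdef
  have hρ : 0 < ρ := by positivity
  have hX := hX₁.mono hρ ((min_le_left _ _).trans (min_le_left _ _))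
  have hY := hY₁.mono hρ ((min_le_left _ _).trans (min_le_right _ _))
  obtain ⟨σ₁, hσ₁, hσ₁ρ, hsphere⟩ :=
    exists_mem_iff_sphere hP hQ hS hSM hX hY (min_le_right _ _) hPQ
  have hm0 : (0 : ℂ × ℂ) ∈ Metric.ball (0 : ℂ × ℂ) ρ := Metric.mem_ball_self hρ
  have h0 : (0 : ℂ) ∈ Metric.ball (0 : ℂ) ρ := Metric.mem_ball_self hρ
  have haan : AnalyticAt ℂ (fun p : ℂ × ℂ => a p.2) 0 :=
    AnalyticAt.fun_comp (f := fun p : ℂ × ℂ => p.2) (x := 0)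
      (hPQ.differentiableOn.analyticAt (Metric.ball_mem_nhds 0 hr)) analyticAt_snd
  set den : ℂ × ℂ → ℂ := fun p => Y p - a p.2 * X p + X p with hden
  set wr : ℂ × ℂ → ℂ := fun p => (Y' p - a p.2 * X' p) * X p - (Y p - a p.2 * X p) * X' p with hwr
  have hXc := (hX.analytic 0 hm0).continuousAt
  have hXc' := (hX.analytic_deriv 0 hm0).continuousAt
  have hYc := (hY.analytic 0 hm0).continuousAt
  have hYc' := (hY.analytic_deriv 0 hm0).continuousAt
  have hac := haan.continuousAt
  have hX0 : X 0 = 0 := hX.init 0 h0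
  have hX0' : X' 0 = 1 := hX.init_deriv 0 h0
  have hY0 : Y 0 = 1 := hY.init 0 h0
  have hY0' : Y' 0 = 0 := hY.init_deriv 0 h0
  have hdenc : ContinuousAt den 0 := (hYc.sub (hac.mul hXc)).add hXc
  have hwrc : ContinuousAt wr 0 :=
    ((hYc'.sub (hac.mul hXc')).mul hXc).sub ((hYc.sub (hac.mul hXc)).mul hXc')
  have hden0 : den 0 ≠ 0 := by simp [hden, hX0, hY0]
  have hwr0 : wr 0 ≠ 0 := by simp [hwr, hX0, hY0, hX0', hY0']
  obtain ⟨σ₂, hσ₂, hne⟩ := exists_pos_forall_ball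
    ((hdenc.eventually_ne hden0).and (hwrc.eventually_ne hwr0))
  set σ := min (min σ₁ σ₂) 1 with hσ
  have hσ0 : 0 < σ := by positivity
  have hHt : Filter.Tendsto (fun p : ℂ × ℂ => H (‖p.1‖ ^ 2, p.2.re)) (𝓝 0) (𝓝 0) := by
    have h1 : H 0 = 0 := hH0.self_of_nhds.1
    have h2 : Filter.Tendsto (fun p : ℂ × ℂ => ((‖p.1‖ ^ 2, p.2.re) : ℝ × ℝ)) (𝓝 0) (𝓝 0) := by
      refine Continuous.tendsto' ?_ _ _ (by simp)
      have := Complex.continuous_re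
      fun_prop
    have h3 := hH.continuousAt.tendsto.comp h2
    rw [h1] at h3
    exact h3
  have hHs : ∀ᶠ p : ℂ × ℂ in 𝓝 0, |H (‖p.1‖ ^ 2, p.2.re)| < min (1 / 2) (σ / 2) := by
    have := hHt.abs
    rw [abs_zero] at this
    exact this.eventually_lt_const (by positivity)
  filter_upwards [hMH, hHs, Metric.ball_mem_nhds (0 : ℂ × ℂ) hσ0] with p hp1 hp2 hp3 hpM hpw
  obtain ⟨z₀, w₀⟩ := p
  obtain ⟨hz₀, hw₀⟩ := mk_mem_ball_zero.1 hp3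
  dsimp only at hp1 hp2 hpw
  have him := hp1.1 hpM
  set u : ℝ := w₀.re with hu
  set η : ℝ := H (‖z₀‖ ^ 2, u) with hη
  have hu0 : u ≠ 0 := by
    intro h
    rw [h, zero_pow (Nat.succ_ne_zero n), zero_mul] at him
    exact hpw (Complex.ext h him)
  have huC : (u : ℂ) ≠ 0 := by exact_mod_cast hu0
  have huσ : (u : ℂ) ∈ Metric.ball (0 : ℂ) σ := by
    rw [mem_ball_zero_iff] at hw₀ ⊢
    rw [Complex.norm_real, Real.norm_eq_abs]
    exact (Complex.abs_re_le_norm w₀).trans_lt hw₀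
  have hu1 : |u| ≤ 1 := by
    have := (mem_ball_zero_iff.1 huσ).le.trans (min_le_right _ _)
    rwa [Complex.norm_real, Real.norm_eq_abs] at this
  have hun : Complex.I * (u : ℂ) ^ n ≠ 0 := mul_ne_zero Complex.I_ne_zero (pow_ne_zero n huC)
  have hratio : w₀ / u = 1 + Complex.I * (u : ℂ) ^ n * η := by
    rw [div_eq_iff huC, ← Complex.re_add_im w₀, him, ← hu]
    push_cast
    ring
  -- the logarithmic coordinate based at `u`
  set L : ℂ → ℂ := fun w => Complex.log (w / u) / (Complex.I * (u : ℂ) ^ n) with hL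
  have hslit : w₀ / u ∈ Complex.slitPlane := by
    left
    rw [hu, Complex.div_ofReal_re, div_self hu0]
    exact one_pos
  have hLan : AnalyticAt ℂ L w₀ :=
    ((analyticAt_id.div analyticAt_const huC).clog hslit).div analyticAt_const hun
  have hLpt : ∀ w, w ≠ 0 → logPoint n (L w) u = w := by
    intro w hw
    rw [logPoint, hL, mul_div_cancel₀ _ hun, Complex.exp_log (div_ne_zero hw huC),
      mul_div_cancel₀ _ huC]
  have hLσ : L w₀ ∈ Metric.ball (0 : ℂ) σ := by
    have hnorm : ‖Complex.I * (u : ℂ) ^ n * η‖ = ‖Complex.I * (u : ℂ) ^ n‖ * |η| := by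
      rw [norm_mul, Complex.norm_real, Real.norm_eq_abs]
    have hle1 : ‖Complex.I * (u : ℂ) ^ n‖ ≤ 1 := by
      rw [norm_mul, Complex.norm_I, one_mul, norm_pow, Complex.norm_real, Real.norm_eq_abs]
      exact pow_le_one₀ (abs_nonneg u) hu1
    have hpos : 0 < ‖Complex.I * (u : ℂ) ^ n‖ := norm_pos_iff.2 hun
    have h1 := Complex.norm_log_one_add_half_le_self (z := Complex.I * (u : ℂ) ^ n * η) (by
      rw [hnorm]
      have := hp2.le.trans (min_le_left _ _)
      nlinarith [abs_nonneg η])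
    have h2 := hp2.trans_le (min_le_right _ _)
    rw [mem_ball_zero_iff, hL]
    dsimp only
    rw [hratio, norm_div, div_lt_iff₀ hpos]
    rw [hnorm] at h1
    nlinarith
  have hsub1 : Metric.ball (0 : ℂ) σ ⊆ Metric.ball 0 σ₁ :=
    Metric.ball_subset_ball ((min_le_left _ _).trans (min_le_left _ _))
  have hsub2 : Metric.ball (0 : ℂ) σ ⊆ Metric.ball 0 σ₂ :=
    Metric.ball_subset_ball ((min_le_left _ _).trans (min_le_right _ _))
  have hsubρ : Metric.ball (0 : ℂ) σ ⊆ Metric.ball 0 ρ :=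
    hsub1.trans (Metric.ball_subset_ball hσ₁ρ)
  have hLmem : (L w₀, (u : ℂ)) ∈ Metric.ball (0 : ℂ × ℂ) ρ :=
    mk_mem_ball_zero.2 ⟨hsubρ hLσ, hsubρ huσ⟩
  have hpairL : AnalyticAt ℂ (fun w => (L w, (u : ℂ))) w₀ := hLan.prod analyticAt_const
  have hXw : AnalyticAt ℂ (fun w => X (L w, u)) w₀ :=
    AnalyticAt.fun_comp (f := fun w => (L w, (u : ℂ))) (hX.analytic _ hLmem) hpairL
  have hYw : AnalyticAt ℂ (fun w => Y (L w, u)) w₀ :=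
    AnalyticAt.fun_comp (f := fun w => (L w, (u : ℂ))) (hY.analytic _ hLmem) hpairL
  have hew : AnalyticAt ℂ (fun w => Y (L w, u) - a u * X (L w, u)) w₀ :=
    hYw.sub (analyticAt_const.mul hXw)
  have hdw : AnalyticAt ℂ (fun w => Y (L w, u) - a u * X (L w, u) + X (L w, u)) w₀ :=
    hew.add hXw
  obtain ⟨hd0, hw0⟩ := hne _ (hsub2 hLσ) _ (hsub2 huσ)
  have hLd : HasDerivAt L (1 / (Complex.I * (u : ℂ) ^ n * w₀)) w₀ := by
    have h1 := (((hasDerivAt_id w₀).div_const (u : ℂ)).clog hslit).div_const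
      (Complex.I * (u : ℂ) ^ n)
    convert! h1 using 1
    simp only [id]
    field_simp
  have hXd := HasDerivAt.comp (h₂ := fun s => X (s, (u : ℂ))) w₀
    (hX.hasDerivAt _ (hsubρ hLσ) u (hsubρ huσ)) hLd
  have hYd := HasDerivAt.comp (h₂ := fun s => Y (s, (u : ℂ))) w₀
    (hY.hasDerivAt _ (hsubρ hLσ) u (hsubρ huσ)) hLd
  have hed := hYd.sub (hXd.const_mul (a u))
  have hθd := (hed.sub hXd).div (hed.add hXd) hd0
  refine isSphericalAt_of_fibered hpM
    (d := fun w => (√2 : ℂ) / (Y (L w, u) - a u * X (L w, u) + X (L w, u)))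
    (θ := fun w => (Y (L w, u) - a u * X (L w, u) - X (L w, u)) /
      (Y (L w, u) - a u * X (L w, u) + X (L w, u)))
    (analyticAt_const.div hdw hd0) ((hew.sub hXw).div hdw hd0) ?_ ?_ ?_
  · refine div_ne_zero ?_ hd0
    simp
  · have h1 : deriv (fun w => (Y (L w, u) - a u * X (L w, u) - X (L w, u)) /
      (Y (L w, u) - a u * X (L w, u) + X (L w, u))) w₀ = _ := hθd.deriv
    rw [h1]
    refine div_ne_zero ?_ (pow_ne_zero 2 hd0)
    have h2 : 2 * wr (L w₀, u) * (1 / (Complex.I * (u : ℂ) ^ n * w₀)) ≠ 0 :=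
      mul_ne_zero (mul_ne_zero two_ne_zero hw0)
        (one_div_ne_zero (mul_ne_zero hun hpw))
    convert h2 using 1
    simp only [hwr, Function.comp_apply, Pi.sub_apply, Pi.add_apply]
    ring
  · have hzev : ∀ᶠ q : ℂ × ℂ in 𝓝 (z₀, w₀), q.1 ∈ Metric.ball (0 : ℂ) σ :=
      continuousAt_fst.eventually (Metric.isOpen_ball.mem_nhds hz₀)
    have hwev : ∀ᶠ q : ℂ × ℂ in 𝓝 (z₀, w₀), q.2 ≠ 0 := continuousAt_snd.eventually_ne hpw
    have hLev : ∀ᶠ q : ℂ × ℂ in 𝓝 (z₀, w₀), L q.2 ∈ Metric.ball (0 : ℂ) σ :=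
      (ContinuousAt.comp (f := fun q : ℂ × ℂ => q.2) (x := (z₀, w₀)) hLan.continuousAt
        continuousAt_snd).eventually (Metric.isOpen_ball.mem_nhds hLσ)
    filter_upwards [hzev, hwev, hLev] with q h1 h2 h3
    have h4 := hsphere u hu0 (hsub1 huσ) (L q.2) (hsub1 h3) q.1 (hsub1 h1)
    rw [hLpt _ h2] at h4
    change q ∈ M ↔ _ at h4
    rw [h4]
    have h5 : Y (L q.2, u) - a u * X (L q.2, u) + X (L q.2, u) ≠ 0 :=
      (hne _ (hsub2 h3) _ (hsub2 huσ)).1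
    have h6 : 0 < ‖Y (L q.2, u) - a u * X (L q.2, u) + X (L q.2, u)‖ ^ 2 := by positivity
    have h7 : ‖(√2 : ℂ)‖ ^ 2 = 2 := by
      rw [Complex.norm_real, Real.norm_eq_abs, sq_abs, Real.sq_sqrt (by norm_num)]
    rw [norm_mul, norm_div, norm_div, mul_pow, div_pow, div_pow, h7, ← mul_div_assoc, ← add_div,
      div_eq_one_iff_eq h6.ne', mul_comm]

/-! ### Inversion in the first variable -/

/-- Holomorphic inverse function theorem with a parameter: a function `f (s, y)` with
`∂f/∂s ≠ 0` at the origin is invertible in `s`, and the inverse is jointly holomorphic. -/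
theorem exists_inverse_fst {f : ℂ × ℂ → ℂ} (hf : AnalyticAt ℂ f 0) (hf0 : f 0 = 0) {c : ℂ}
    (hc : c ≠ 0) (hd : HasDerivAt (fun s => f (s, 0)) c 0) :
    ∃ g : ℂ × ℂ → ℂ, AnalyticAt ℂ g 0 ∧ g 0 = 0 ∧ (∀ᶠ p in 𝓝 (0 : ℂ × ℂ), f (g p, p.2) = p.1) ∧
      ∀ᶠ p in 𝓝 (0 : ℂ × ℂ), g (f p, p.2) = p.1 := by
  have hD : fderiv ℂ f 0 (1, 0) = c := by
    have h1 : HasDerivAt (fun s : ℂ => (s, (0 : ℂ))) ((1, 0) : ℂ × ℂ) 0 :=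
      (hasDerivAt_id _).prodMk (hasDerivAt_const _ _)
    exact (HasFDerivAt.comp_hasDerivAt (f := fun s : ℂ => (s, (0 : ℂ))) 0
      hf.differentiableAt.hasFDerivAt h1).unique hd
  set Φ : ℂ × ℂ → ℂ × ℂ := fun p => (f p, p.2) with hΦ
  have hΦa : AnalyticAt ℂ Φ 0 := hf.prod analyticAt_snd
  have hΦ0 : Φ 0 = 0 := Prod.ext hf0 rfl
  have hΦ' : fderiv ℂ Φ 0 = (fderiv ℂ f 0).prod (ContinuousLinearMap.snd ℂ ℂ ℂ) :=
    (hf.differentiableAt.hasFDerivAt.prodMk hasFDerivAt_snd).fderiv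
  have hinj : Function.Injective (fderiv ℂ Φ 0) := by
    rw [hΦ', injective_iff_map_eq_zero]
    intro t ht
    have ht1 := congrArg Prod.fst ht
    have ht2 : t.2 = 0 := congrArg Prod.snd ht
    have h3 : t = t.1 • ((1, 0) : ℂ × ℂ) := Prod.ext (by simp) (by simp [ht2])
    simp only [ContinuousLinearMap.prod_apply, Prod.fst_zero] at ht1
    rw [h3, map_smul, hD, smul_eq_mul] at ht1
    exact Prod.ext ((mul_eq_zero.1 ht1).resolve_right hc) ht2
  have hsurj : Function.Surjective (fderiv ℂ Φ 0) :=
    (LinearMap.injective_iff_surjective (f := (fderiv ℂ Φ 0).toLinearMap)).1 hinj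
  set i : (ℂ × ℂ) ≃L[ℂ] (ℂ × ℂ) := ContinuousLinearEquiv.ofBijective (fderiv ℂ Φ 0)
    (LinearMap.ker_eq_bot.2 hinj) (LinearMap.range_eq_top.2 hsurj) with hi
  have hi' : fderiv ℂ Φ 0 = i := by ext <;> rfl
  have hs : HasStrictFDerivAt Φ (i : ℂ × ℂ →L[ℂ] ℂ × ℂ) 0 := hi' ▸ hΦa.hasStrictFDerivAt
  set e := hs.toOpenPartialHomeomorph Φ with he
  have hcoe : ⇑e = Φ := hs.toOpenPartialHomeomorph_coe
  have hmem : (0 : ℂ × ℂ) ∈ e.source := hs.mem_toOpenPartialHomeomorph_source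
  have hsym : AnalyticAt ℂ e.symm 0 := by
    have h := e.analyticAt_symm' (i := i) hmem (by rwa [hcoe]) (by rw [hcoe, hi'])
    rwa [hcoe, hΦ0] at h
  have hmem' : (0 : ℂ × ℂ) ∈ e.target := by
    have h := e.map_source hmem
    rwa [hcoe, hΦ0] at h
  have hright : ∀ᶠ p in 𝓝 (0 : ℂ × ℂ), Φ (e.symm p) = p := by
    filter_upwards [e.open_target.mem_nhds hmem'] with p hp
    rw [← hcoe, e.right_inv hp]
  have hleft : ∀ᶠ p in 𝓝 (0 : ℂ × ℂ), e.symm (Φ p) = p := by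
    filter_upwards [e.open_source.mem_nhds hmem] with p hp
    rw [← hcoe, e.left_inv hp]
  refine ⟨fun p => (e.symm p).1, AnalyticAt.fun_comp (f := e.symm) analyticAt_fst hsym, ?_, ?_, ?_⟩
  · have h := hleft.self_of_nhds
    rw [hΦ0] at h
    exact congrArg Prod.fst h
  · filter_upwards [hright] with p hp
    obtain ⟨h1, h2⟩ := Prod.ext_iff.1 hp
    simp only [hΦ] at h1 h2
    rw [← h2]
    exact h1
  · filter_upwards [hleft] with p hp
    exact congrArg Prod.fst hp

/-! ### The Segre family of the equation -/

/-- The inverse in `s` of a solution `X (s, y)` that vanishes to first order at `s = 0`: it solves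
the equation of the Segre varieties in the logarithmic coordinate. -/
theorem IsLogSolution.exists_inverse {n : ℕ} {P Q : ℂ → ℂ} {r ρ : ℝ} {X X' : ℂ × ℂ → ℂ}
    (hX : IsLogSolution n P Q r ρ 0 1 X X') :
    ∃ ψ ψ' : ℂ × ℂ → ℂ, ∃ R > 0, R ≤ ρ ∧
      (∀ x ∈ Metric.ball (0 : ℂ) R, ∀ y ∈ Metric.ball (0 : ℂ) R,
        AnalyticAt ℂ ψ (x, y) ∧ ψ (x, y) ∈ Metric.ball (0 : ℂ) ρ ∧ X (ψ (x, y), y) = x ∧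
        HasDerivAt (fun x => ψ (x, y)) (ψ' (x, y)) x ∧
        HasDerivAt (fun x => ψ' (x, y)) (-logCoeffA n P (ψ (x, y), y) * ψ' (x, y) ^ 2 -
          logCoeffB n Q (ψ (x, y), y) * x * ψ' (x, y) ^ 3) x) ∧
      (∀ y ∈ Metric.ball (0 : ℂ) R, ψ (0, y) = 0 ∧ ψ' (0, y) = 1) ∧
      ∀ᶠ p in 𝓝 (0 : ℂ × ℂ), ψ (X p, p.2) = p.1 := by
  have h0 : (0 : ℂ) ∈ Metric.ball (0 : ℂ) ρ := Metric.mem_ball_self hX.pos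
  have h00 : (0 : ℂ × ℂ) ∈ Metric.ball (0 : ℂ × ℂ) ρ := Metric.mem_ball_self hX.pos
  have hX00 : X 0 = 0 := hX.init 0 h0
  have hd : HasDerivAt (fun s => X (s, 0)) 1 0 := by
    have := hX.hasDerivAt 0 h0 0 h0
    rwa [hX.init_deriv 0 h0] at this
  obtain ⟨ψ, hψ, hψ0, hr, hl⟩ := exists_inverse_fst (hX.analytic 0 h00) hX00 one_ne_zero hd
  have hpair : AnalyticAt ℂ (fun p : ℂ × ℂ => (ψ p, p.2)) 0 := hψ.prod analyticAt_snd
  have hpair0 : ((ψ 0, (0 : ℂ × ℂ).2) : ℂ × ℂ) = 0 := Prod.ext hψ0 rfl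
  have hev1 : ∀ᶠ p in 𝓝 (0 : ℂ × ℂ), ((ψ p, p.2) : ℂ × ℂ) ∈ Metric.ball (0 : ℂ × ℂ) ρ := by
    refine hpair.continuousAt.eventually (Metric.isOpen_ball.mem_nhds ?_)
    change ((ψ 0, (0 : ℂ × ℂ).2) : ℂ × ℂ) ∈ _
    rw [hpair0]
    exact h00
  have hev2 : ∀ᶠ p in 𝓝 (0 : ℂ × ℂ), X' (ψ p, p.2) ≠ 0 := by
    have hc : ContinuousAt (fun p : ℂ × ℂ => X' (ψ p, p.2)) 0 :=
      ContinuousAt.comp (g := X') (f := fun p : ℂ × ℂ => (ψ p, p.2))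
        (by rw [hpair0]; exact (hX.analytic_deriv 0 h00).continuousAt) hpair.continuousAt
    refine hc.eventually_ne ?_
    rw [hpair0, show X' 0 = 1 from hX.init_deriv 0 h0]
    exact one_ne_zero
  obtain ⟨R₁, hR₁, hb⟩ := exists_pos_forall_ball
    (hr.and (hl.and (hev1.and (hev2.and hψ.eventually_analyticAt))))
  set R := min R₁ ρ with hRdef
  have hR : 0 < R := lt_min hR₁ hX.pos
  have hs1 : Metric.ball (0 : ℂ) R ⊆ Metric.ball 0 R₁ := Metric.ball_subset_ball (min_le_left _ _)
  have hs2 : Metric.ball (0 : ℂ) R ⊆ Metric.ball 0 ρ := Metric.ball_subset_ball (min_le_right _ _)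
  have hR0 : (0 : ℂ) ∈ Metric.ball (0 : ℂ) R := Metric.mem_ball_self hR
  have hψd : ∀ x ∈ Metric.ball (0 : ℂ) R, ∀ y ∈ Metric.ball (0 : ℂ) R,
      HasDerivAt (fun x => ψ (x, y)) (X' (ψ (x, y), y))⁻¹ x := by
    intro x hx y hy
    obtain ⟨-, -, h3, h4, h5⟩ := hb x (hs1 hx) y (hs1 hy)
    have h6 : DifferentiableAt ℂ (fun x => ψ (x, y)) x :=
      DifferentiableAt.comp (g := ψ) (f := fun x : ℂ => (x, y)) x h5.differentiableAt
        (differentiableAt_id.prodMk (differentiableAt_const _))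
    have h7 := HasDerivAt.comp (h₂ := fun s => X (s, y)) x
      (hX.hasDerivAt _ (mk_mem_ball_zero.1 h3).1 y (hs2 hy)) h6.hasDerivAt
    have h8 : ((fun s => X (s, y)) ∘ fun x => ψ (x, y)) =ᶠ[𝓝 x] id := by
      filter_upwards [Metric.isOpen_ball.mem_nhds hx] with x' hx'
        using (hb x' (hs1 hx') y (hs1 hy)).1
    have h9 := (h8.hasDerivAt_iff.1 h7).unique (hasDerivAt_id x)
    rw [← eq_inv_of_mul_eq_one_right h9]
    exact h6.hasDerivAt
  have hψz : ∀ y ∈ Metric.ball (0 : ℂ) R, ψ (0, y) = 0 := by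
    intro y hy
    have h := (hb 0 (hs1 hR0) y (hs1 hy)).2.1
    simpa only [hX.init y (hs2 hy)] using h
  refine ⟨ψ, fun p => (X' (ψ p, p.2))⁻¹, R, hR, min_le_right _ _, fun x hx y hy => ?_,
    fun y hy => ⟨hψz y hy, ?_⟩, hl⟩
  · obtain ⟨h1, -, h3, h4, h5⟩ := hb x (hs1 hx) y (hs1 hy)
    have hm := (mk_mem_ball_zero.1 h3).1
    refine ⟨h5, hm, h1, hψd x hx y hy, ?_⟩
    dsimp only at h1 h4
    have h6 := (HasDerivAt.comp (h₂ := fun s => X' (s, y)) x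
      (hX.hasDerivAt_deriv _ hm y (hs2 hy)) (hψd x hx y hy)).inv h4
    rw [h1] at h6
    convert! h6 using 1
    simp only [Function.comp_apply]
    field_simp
    ring
  · simp only [hψz y hy, hX.init_deriv y (hs2 hy), inv_one]

/-- Every equation has an associated positive Segre family. -/
theorem IsLogSolution.exists_segreFamily {n : ℕ} {P Q : ℂ → ℂ} {r ρ : ℝ} {X X' : ℂ × ℂ → ℂ}
    (hX : IsLogSolution n P Q r ρ 0 1 X X') :
    ∃ S : PositiveSegreFamily, S.IsAssociatedWithODE (n + 1) P Q ∧ AnalyticAt ℂ S.ψ 0 ∧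
      (∀ᶠ p in 𝓝 (0 : ℂ × ℂ), X (S.ψ p, p.2) = p.1) ∧
      ∀ᶠ p in 𝓝 (0 : ℂ × ℂ), S.ψ (X p, p.2) = p.1 := by
  obtain ⟨ψ, ψ', R, hR, -, hψ, hψ0, hl⟩ := hX.exists_inverse
  have hR0 : (0 : ℂ) ∈ Metric.ball (0 : ℂ) R := Metric.mem_ball_self hR
  have hδ : 0 < min 1 R := by positivity
  have hδR : (min 1 R) ^ 2 ≤ R := by
    have h1 : min 1 R ≤ 1 := min_le_left _ _
    have h2 : min 1 R ≤ R := min_le_right _ _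
    nlinarith
  refine ⟨⟨min 1 R, R, hδ, hR, ψ, ?_, fun y hy => (hψ0 y hy).1, fun y hy => ?_⟩,
    ⟨min 1 R, R, hδ, le_rfl, hR, le_rfl, ?_⟩, (hψ 0 hR0 0 hR0).1, ?_, hl⟩
  · rintro ⟨x, y⟩ ⟨hx, hy⟩
    exact (hψ x (Metric.ball_subset_ball hδR hx) y hy).1.differentiableAt.differentiableWithinAt
  · have h := (hψ 0 hR0 y hy).2.2.2.1
    rwa [(hψ0 y hy).2] at h
  · rintro ⟨ξ, η⟩ hξ hη hη0 z hz -
    dsimp only at hξ hη hη0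
    have hyη : conj η ∈ Metric.ball (0 : ℂ) R := conj_mem_ball hη
    have hy0 : conj η ≠ 0 := (map_ne_zero _).2 hη0
    change SatisfiesInverseODEAt (n + 1) P Q
      (fun z => logPoint n (ψ (z * conj ξ, conj η)) (conj η)) z
    by_cases hξ0 : ξ = 0
    · have hconst : (fun z => logPoint n (ψ (z * conj ξ, conj η)) (conj η)) = fun _ => conj η := by
        funext z
        rw [hξ0, map_zero, mul_zero, (hψ0 _ hyη).1, logPoint_zero_left]
      rw [hconst]
      simp [SatisfiesInverseODEAt]
    · have hx : z * conj ξ ∈ Metric.ball (0 : ℂ) R := by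
        rw [mem_ball_zero_iff] at *
        rw [norm_mul, RCLike.norm_conj]
        nlinarith [norm_nonneg z, norm_nonneg ξ]
      refine (satisfiesInverseODEAt_logPoint_iff (h := fun x => ψ (x, conj η))
        (h₁ := fun x => ψ' (x, conj η)) hy0 ((map_ne_zero _).2 hξ0) ?_
        (hψ _ hx _ hyη).2.2.2.2).2 rfl
      filter_upwards [Metric.isOpen_ball.mem_nhds hx] with x hx
        using (hψ x hx _ hyη).2.2.2.1
  · filter_upwards [Metric.ball_mem_nhds (0 : ℂ × ℂ) hR] with p hp
    obtain ⟨h1, h2⟩ := mk_mem_ball_zero.1 (show (p.1, p.2) ∈ Metric.ball (0 : ℂ × ℂ) R from hp)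
    exact (hψ _ h1 _ h2).2.2.1

/-! ### Symmetry of the Segre family -/

/-- For coefficients of real form the family `w = logPoint n (ψ (x, y)) y` is symmetric: if the
Segre variety of one point contains another one, then the converse holds as well. -/
theorem IsLogSolution.eventually_logPoint_symm {n : ℕ} {P Q a : ℂ → ℂ} {r ρ : ℝ}
    {X X' ψ : ℂ × ℂ → ℂ} (hP : DifferentiableOn ℂ P (Metric.ball 0 r))
    (hX : IsLogSolution n P Q r ρ 0 1 X X') (hPQ : HasRealForm n P Q r a)
    (hψ : AnalyticAt ℂ ψ 0) (hr : ∀ᶠ p in 𝓝 (0 : ℂ × ℂ), X (ψ p, p.2) = p.1)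
    (hl : ∀ᶠ p in 𝓝 (0 : ℂ × ℂ), ψ (X p, p.2) = p.1) :
    ∀ᶠ p in 𝓝 (0 : ℂ × ℂ),
      logPoint n (ψ (p.1, conj (logPoint n (ψ (conj p.1, conj p.2)) (conj p.2))))
        (conj (logPoint n (ψ (conj p.1, conj p.2)) (conj p.2))) = p.2 := by
  have hψ0 : ψ 0 = 0 := by
    have h := hl.self_of_nhds
    rwa [show X 0 = 0 from hX.init 0 (Metric.mem_ball_self hX.pos)] at h
  obtain ⟨σ, hσ, hσρ, hbase⟩ := exists_pos_baseChange_mem n hX.pos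
  set F : ℂ × ℂ → ℂ := fun p => logPoint n (ψ p) p.2 with hF
  have hpair : AnalyticAt ℂ (fun p : ℂ × ℂ => (ψ p, p.2)) 0 := hψ.prod analyticAt_snd
  have hFa : AnalyticAt ℂ F 0 := AnalyticAt.fun_comp (f := fun p : ℂ × ℂ => (ψ p, p.2))
    (g := fun p : ℂ × ℂ => logPoint n p.1 p.2) (analyticAt_logPoint n _) hpair
  have hF0 : F 0 = 0 := by simp [hF]
  -- the reflected family; the claim is `F (x, Fc (x, y)) = y`
  set Fc : ℂ × ℂ → ℂ := fun p => conj (F (conj p.1, conj p.2)) with hFc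
  have hconj : Continuous fun p : ℂ × ℂ => ((conj p.1, conj p.2) : ℂ × ℂ) := by
    have := Complex.continuous_conj
    fun_prop
  have hconj0 : Filter.Tendsto (fun p : ℂ × ℂ => ((conj p.1, conj p.2) : ℂ × ℂ)) (𝓝 0) (𝓝 0) :=
    hconj.tendsto' _ _ (by simp)
  have hFc0 : Filter.Tendsto Fc (𝓝 0) (𝓝 0) := by
    have h1 : Filter.Tendsto F (𝓝 0) (𝓝 0) := by simpa [hF0] using hFa.continuousAt.tendsto
    have h2 := (Complex.continuous_conj.tendsto 0).comp (h1.comp hconj0)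
    rw [map_zero] at h2
    exact h2
  have hpt : Filter.Tendsto (fun p : ℂ × ℂ => (p.1, Fc p)) (𝓝 0) (𝓝 0) := by
    have h1 : Filter.Tendsto (fun p : ℂ × ℂ => p.1) (𝓝 0) (𝓝 0) :=
      continuous_fst.tendsto' _ _ rfl
    exact h1.prodMk_nhds hFc0
  have hψσ : ∀ᶠ p in 𝓝 (0 : ℂ × ℂ), ψ p ∈ Metric.ball (0 : ℂ) σ := by
    refine hψ.continuousAt.eventually (Metric.isOpen_ball.mem_nhds ?_)
    rw [hψ0]
    exact Metric.mem_ball_self hσ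
  -- `ψ` inverts `X` at the points that occur in `IsLogSolution.baseChange_zero_eq`
  have hbl : ∀ᶠ p in 𝓝 (0 : ℂ × ℂ), ψ (X (logScale n p.1 p.2 * (0 - p.1), logPoint n p.1 p.2),
      logPoint n p.1 p.2) = logScale n p.1 p.2 * (0 - p.1) := by
    have hc : Filter.Tendsto (fun p : ℂ × ℂ =>
        ((logScale n p.1 p.2 * (0 - p.1), logPoint n p.1 p.2) : ℂ × ℂ)) (𝓝 0) (𝓝 0) := by
      have h1 := ((analyticAt_logScale n 0).mul (analyticAt_const.sub analyticAt_fst)).prod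
        (analyticAt_logPoint n 0) (f := fun p : ℂ × ℂ => logScale n p.1 p.2 * (0 - p.1))
      have h2 := h1.continuousAt.tendsto
      simp only [Prod.fst_zero, Prod.snd_zero, sub_zero, mul_zero, logPoint_zero_left] at h2
      exact h2
    exact hc.eventually hl
  have hneg : Filter.Tendsto (fun p : ℂ × ℂ => ((-conj (ψ (conj p.1, conj p.2)), p.2) : ℂ × ℂ))
      (𝓝 0) (𝓝 0) := by
    have h1 : Filter.Tendsto ψ (𝓝 0) (𝓝 0) := by simpa [hψ0] using hψ.continuousAt.tendsto
    have h2 := ((Complex.continuous_conj.tendsto 0).comp (h1.comp hconj0)).neg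
    rw [map_zero, neg_zero] at h2
    exact h2.prodMk_nhds (continuous_snd.tendsto' _ _ rfl)
  obtain ⟨R₁, hR₁, hb⟩ := exists_pos_forall_ball ((hneg.eventually hbl).and
    ((hconj0.eventually hr).and ((hconj0.eventually hψσ).and
      ((hpt.eventually hFa.eventually_analyticAt).and
        (hconj0.eventually hFa.eventually_analyticAt)))))
  set R := min R₁ σ
  have hR : 0 < R := lt_min hR₁ hσ
  have hs1 : Metric.ball (0 : ℂ) R ⊆ Metric.ball 0 R₁ := Metric.ball_subset_ball (min_le_left _ _)
  have hs2 : Metric.ball (0 : ℂ) R ⊆ Metric.ball 0 σ := Metric.ball_subset_ball (min_le_right _ _)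
  filter_upwards [Metric.ball_mem_nhds (0 : ℂ × ℂ) hR] with p hp
  obtain ⟨x, y⟩ := p
  obtain ⟨hx, hy⟩ := mk_mem_ball_zero.1 hp
  suffices h : F (x, Fc (x, y)) - y = 0 from sub_eq_zero.1 h
  -- by the identity theorem in `y` real base points suffice
  refine eq_zero_of_eq_zero_on_real (f := fun y => F (x, Fc (x, y)) - y) (R := R) ?_ ?_ hy
  · intro y hy
    obtain ⟨-, -, -, h1, h2⟩ := hb x (hs1 hx) y (hs1 hy)
    have h3 : DifferentiableAt ℂ (fun y => F (conj x, y)) (conj y) :=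
      DifferentiableAt.comp (g := F) (f := fun y : ℂ => (conj x, y)) _ h2.differentiableAt
        ((differentiableAt_const _).prodMk differentiableAt_id)
    have h4 : DifferentiableAt ℂ (fun y => Fc (x, y)) y := by
      have h := h3.conj_conj
      rw [Complex.conj_conj] at h
      exact h
    have h5 : DifferentiableAt ℂ (fun y => F (x, Fc (x, y))) y :=
      DifferentiableAt.comp (g := F) (f := fun y : ℂ => (x, Fc (x, y))) y h1.differentiableAt
        ((differentiableAt_const _).prodMk h4)
    exact (h5.sub differentiableAt_id).differentiableWithinAt
  · filter_upwards [eventually_real_mem_ball hR] with u hu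
    obtain ⟨h1, h2, h3, -, -⟩ := hb x (hs1 hx) u (hs1 hu.2)
    simp only [Complex.conj_ofReal] at h1 h2 h3
    set t := -conj (ψ (conj x, (u : ℂ))) with ht
    have hconjt : -conj t = ψ (conj x, (u : ℂ)) := by simp [ht]
    have htσ : t ∈ Metric.ball (0 : ℂ) σ := by
      rw [mem_ball_zero_iff] at h3 ⊢
      rwa [ht, norm_neg, RCLike.norm_conj]
    have h4 := hX.baseChange_zero_eq hP hPQ hσρ hbase htσ (hs2 hu.2)
    rw [hconjt, h2, Complex.conj_conj] at h4
    rw [h4] at h1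
    have h5 : Fc (x, (u : ℂ)) = logPoint n t u := by
      simp only [hFc, hF, Complex.conj_ofReal, conj_logPoint, ht]
    change logPoint n (ψ (x, Fc (x, (u : ℂ)))) (Fc (x, (u : ℂ))) - u = 0
    rw [h5, h1, logPoint_base_change, logPoint_zero_left, sub_self]

/-! ### The defining function of the hypersurface -/

/-- Passage from the complex defining equation `w = logPoint n (ψ (x, y)) y` to the form solved for
the imaginary part: with `U = (w + y) / 2` it reads `(w - y) / (2 i) = U ^ (n + 1) H (x, U)`. Here
`Y (x, U)` is the inverse of `y ↦ U`. -/
theorem exists_graph_function (n : ℕ) {ψ : ℂ × ℂ → ℂ} (hψ : AnalyticAt ℂ ψ 0)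
    (hψ0 : ∀ᶠ y in 𝓝 (0 : ℂ), ψ (0, y) = 0)
    (hψ1 : ∀ᶠ y in 𝓝 (0 : ℂ), HasDerivAt (fun x => ψ (x, y)) 1 0) :
    ∃ Y H : ℂ × ℂ → ℂ, AnalyticAt ℂ Y 0 ∧ Y 0 = 0 ∧ AnalyticAt ℂ H 0 ∧
      (∀ᶠ p in 𝓝 (0 : ℂ × ℂ), (logPoint n (ψ (p.1, Y p)) (Y p) + Y p) / 2 = p.2) ∧
      (∀ᶠ p in 𝓝 (0 : ℂ × ℂ), Y (p.1, (logPoint n (ψ p) p.2 + p.2) / 2) = p.2) ∧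
      (∀ᶠ u in 𝓝 (0 : ℂ), H (0, u) = 0 ∧ HasDerivAt (fun x => H (x, u)) (1 / 2) 0) ∧
      ∀ᶠ p in 𝓝 (0 : ℂ × ℂ), (logPoint n (ψ p) p.2 - p.2) / (2 * Complex.I) =
        ((logPoint n (ψ p) p.2 + p.2) / 2) ^ (n + 1) *
          H (p.1, (logPoint n (ψ p) p.2 + p.2) / 2) := by
  have hψ00 : ψ 0 = 0 := hψ0.self_of_nhds
  have hswap : ∀ q : ℂ × ℂ, AnalyticAt ℂ (fun p : ℂ × ℂ => (p.2, p.1)) q := fun q =>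
    analyticAt_snd.prod analyticAt_fst
  have hpair : AnalyticAt ℂ (fun p : ℂ × ℂ => (ψ p, p.2)) 0 := hψ.prod analyticAt_snd
  have hFa : AnalyticAt ℂ (fun p : ℂ × ℂ => logPoint n (ψ p) p.2) 0 :=
    AnalyticAt.fun_comp (f := fun p : ℂ × ℂ => (ψ p, p.2))
      (g := fun p : ℂ × ℂ => logPoint n p.1 p.2) (analyticAt_logPoint n _) hpair
  have hUa : AnalyticAt ℂ (fun p : ℂ × ℂ => (logPoint n (ψ p) p.2 + p.2) / 2) 0 :=
    (hFa.add analyticAt_snd).div_const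
  have hUa' : AnalyticAt ℂ (fun p : ℂ × ℂ => (logPoint n (ψ (p.2, p.1)) p.1 + p.1) / 2) 0 :=
    AnalyticAt.fun_comp (f := fun p : ℂ × ℂ => (p.2, p.1)) hUa (hswap 0)
  have hUd : HasDerivAt (fun y : ℂ => (logPoint n (ψ (0, y)) y + y) / 2) 1 0 := by
    refine (hasDerivAt_id (0 : ℂ)).congr_of_eventuallyEq ?_
    filter_upwards [hψ0] with y hy
    rw [hy, logPoint_zero_left, id]
    ring
  obtain ⟨G, hG, hG0, hGr, hGl⟩ := exists_inverse_fst hUa' (by simp) one_ne_zero hUd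
  have hswap0 : Filter.Tendsto (fun p : ℂ × ℂ => (p.2, p.1)) (𝓝 0) (𝓝 0) :=
    continuous_swap.tendsto' _ _ rfl
  set Y : ℂ × ℂ → ℂ := fun p => G (p.2, p.1) with hY
  have hYa : AnalyticAt ℂ Y 0 := AnalyticAt.fun_comp (f := fun p : ℂ × ℂ => (p.2, p.1)) hG (hswap 0)
  have hY0 : Y 0 = 0 := hG0
  have hYr : ∀ᶠ p in 𝓝 (0 : ℂ × ℂ), (logPoint n (ψ (p.1, Y p)) (Y p) + Y p) / 2 = p.2 :=
    hswap0.eventually hGr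
  have hYl : ∀ᶠ p in 𝓝 (0 : ℂ × ℂ), Y (p.1, (logPoint n (ψ p) p.2 + p.2) / 2) = p.2 :=
    hswap0.eventually hGl
  -- with `exp E = 1 + E e(E)` both `v = y E e(E) / 2 i` and `U ^ (n + 1) = y ^ (n + 1) D` contain the
  -- factor `y ^ (n + 1)`, and `T` is the quotient of the other factors
  set e : ℂ → ℂ := dslope Complex.exp 0 with he
  have hea : ∀ z, AnalyticAt ℂ e z := fun z =>
    ((Complex.differentiableOn_dslope (s := Set.univ) Filter.univ_mem).2
      Complex.differentiable_exp.differentiableOn).analyticAt Filter.univ_mem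
  have he0 : e 0 = 1 := by simp [he, dslope_same]
  have hes : ∀ z, Complex.exp z = 1 + z * e z := fun z => by
    have h := sub_smul_dslope Complex.exp 0 z
    rw [sub_zero, smul_eq_mul, Complex.exp_zero] at h
    rw [he, h]; ring
  set E : ℂ × ℂ → ℂ := fun p => Complex.I * p.2 ^ n * ψ p with hE
  have hEa : AnalyticAt ℂ E 0 := (analyticAt_const.mul (analyticAt_snd.pow n)).mul hψ
  have hE0 : E 0 = 0 := by simp [hE, hψ00]
  set D : ℂ × ℂ → ℂ := fun p => ((1 + Complex.exp (E p)) / 2) ^ (n + 1) with hD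
  have hDa : AnalyticAt ℂ D 0 := ((analyticAt_const.add hEa.cexp).div_const).pow _
  have hD0 : D 0 = 1 := by simp [hD, hE0]
  set k : ℂ × ℂ → ℂ := fun p => e (E p) / 2 / D p with hk
  have hka : AnalyticAt ℂ k 0 := by
    refine AnalyticAt.div (AnalyticAt.div_const ?_) hDa (by rw [hD0]; exact one_ne_zero)
    exact AnalyticAt.fun_comp (f := E) (hea _) hEa
  set T : ℂ × ℂ → ℂ := fun p => ψ p * k p with hT
  have hTa : AnalyticAt ℂ T 0 := hψ.mul hka
  have hin : AnalyticAt ℂ (fun p : ℂ × ℂ => (p.1, Y p)) 0 := analyticAt_fst.prod hYa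
  have hin0 : (((0 : ℂ × ℂ).1, Y 0) : ℂ × ℂ) = 0 := Prod.ext rfl hY0
  have hHa : AnalyticAt ℂ (fun p : ℂ × ℂ => T (p.1, Y p)) 0 :=
    AnalyticAt.fun_comp (f := fun p : ℂ × ℂ => (p.1, Y p)) (by rw [hin0]; exact hTa) hin
  have hemb : Filter.Tendsto (fun u : ℂ => ((0 : ℂ), u)) (𝓝 0) (𝓝 (0 : ℂ × ℂ)) :=
    Continuous.tendsto' (by fun_prop) _ _ rfl
  have hYz : ∀ᶠ u in 𝓝 (0 : ℂ), Y (0, u) = u := by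
    filter_upwards [hemb.eventually hYl, hψ0] with u hu hu0
    simp only [hu0, logPoint_zero_left, add_self_div_two] at hu
    exact hu
  refine ⟨Y, fun p => T (p.1, Y p), hYa, hY0, hHa, hYr, hYl, ?_, ?_⟩
  · filter_upwards [hYz, hψ0, hψ0.eventually_nhds, hψ1,
      hemb.eventually hψ.eventually_analyticAt, hemb.eventually hka.eventually_analyticAt,
      hemb.eventually hYa.eventually_analyticAt] with u h1 h2 h2' h3 h4 h5 h6
    refine ⟨by simp only [hT, h1, h2, zero_mul], ?_⟩
    have hline : HasDerivAt (fun x : ℂ => (x, u)) ((1, 0) : ℂ × ℂ) 0 :=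
      (hasDerivAt_id _).prodMk (hasDerivAt_const _ _)
    have hline' : HasDerivAt (fun y : ℂ => ((0 : ℂ), y)) ((0, 1) : ℂ × ℂ) u :=
      (hasDerivAt_const _ _).prodMk (hasDerivAt_id _)
    have hYd : DifferentiableAt ℂ (fun x => Y (x, u)) 0 :=
      DifferentiableAt.comp (g := Y) (f := fun x : ℂ => (x, u)) 0 h6.differentiableAt
        hline.differentiableAt
    have hcurve : HasDerivAt (fun x : ℂ => (x, Y (x, u)))
        ((1, deriv (fun x => Y (x, u)) 0) : ℂ × ℂ) 0 :=
      (hasDerivAt_id _).prodMk hYd.hasDerivAt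
    have hL1 : fderiv ℂ ψ (0, u) (1, 0) = 1 :=
      (HasFDerivAt.comp_hasDerivAt (f := fun x : ℂ => (x, u)) 0
        h4.differentiableAt.hasFDerivAt hline).unique h3
    have hL2 : fderiv ℂ ψ (0, u) (0, 1) = 0 :=
      (HasFDerivAt.comp_hasDerivAt (f := fun y : ℂ => ((0 : ℂ), y)) u
        h4.differentiableAt.hasFDerivAt hline').unique
        ((hasDerivAt_const u (0 : ℂ)).congr_of_eventuallyEq h2')
    have hL : ∀ d : ℂ, fderiv ℂ ψ (0, u) (1, d) = 1 := fun d => by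
      have hsplit : ((1, d) : ℂ × ℂ) = (1, 0) + d • ((0, 1) : ℂ × ℂ) := by simp
      rw [hsplit, map_add, map_smul, hL1, hL2, smul_zero, add_zero]
    have hψc : HasDerivAt (fun x : ℂ => ψ (x, Y (x, u))) 1 0 := by
      have h := HasFDerivAt.comp_hasDerivAt (f := fun x : ℂ => (x, Y (x, u))) (0 : ℂ)
        (l := ψ) (l' := fderiv ℂ ψ (0, u))
        (by rw [h1]; exact h4.differentiableAt.hasFDerivAt) hcurve
      rwa [hL] at h
    have hkc : DifferentiableAt ℂ (fun x : ℂ => k (x, Y (x, u))) 0 :=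
      DifferentiableAt.comp (g := k) (f := fun x : ℂ => (x, Y (x, u))) (0 : ℂ)
        (by rw [h1]; exact h5.differentiableAt) hcurve.differentiableAt
    have hkv : k (0, u) = 1 / 2 := by simp [hk, hD, hE, h2, he0]
    have h := hψc.mul hkc.hasDerivAt
    simp only [h1, h2, zero_mul, add_zero, one_mul, hkv] at h
    exact h
  · have hDne : ∀ᶠ p in 𝓝 (0 : ℂ × ℂ), D p ≠ 0 :=
      hDa.continuousAt.eventually_ne (by rw [hD0]; exact one_ne_zero)
    filter_upwards [hYl, hDne] with p hp hDp
    rw [hp]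
    have h1 : logPoint n (ψ p) p.2 = p.2 * Complex.exp (E p) := rfl
    have h2 : ((logPoint n (ψ p) p.2 + p.2) / 2) ^ (n + 1) = p.2 ^ (n + 1) * D p := by
      rw [h1, hD, ← mul_pow]
      congr 1
      ring
    have hI := Complex.I_ne_zero
    rw [h2, h1]
    simp only [hT, hk, Prod.mk.eta]
    have h3 : p.2 ^ (n + 1) * D p * (ψ p * (e (E p) / 2 / D p)) =
      p.2 ^ (n + 1) * (ψ p * (e (E p) / 2)) := by field_simp
    rw [h3, hes (E p)]
    generalize e (E p) = c
    simp only [hE]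
    field_simp
    ring

/-! ### Existence of the hypersurface -/

/-- The symmetry of the family makes the function `H` of `exists_graph_function` real. -/
theorem conj_graph_function_eq {n : ℕ} {ψ Y H : ℂ × ℂ → ℂ} (hY : ContinuousAt Y 0) (hY0 : Y 0 = 0)
    (hψ : ContinuousAt ψ 0) (hψ0 : ψ 0 = 0)
    (hYr : ∀ᶠ p in 𝓝 (0 : ℂ × ℂ), (logPoint n (ψ (p.1, Y p)) (Y p) + Y p) / 2 = p.2)
    (hYl : ∀ᶠ p in 𝓝 (0 : ℂ × ℂ), Y (p.1, (logPoint n (ψ p) p.2 + p.2) / 2) = p.2)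
    (hH : ∀ᶠ p in 𝓝 (0 : ℂ × ℂ), (logPoint n (ψ p) p.2 - p.2) / (2 * Complex.I) =
        ((logPoint n (ψ p) p.2 + p.2) / 2) ^ (n + 1) *
          H (p.1, (logPoint n (ψ p) p.2 + p.2) / 2))
    (hsymm : ∀ᶠ p in 𝓝 (0 : ℂ × ℂ),
      logPoint n (ψ (p.1, conj (logPoint n (ψ (conj p.1, conj p.2)) (conj p.2))))
        (conj (logPoint n (ψ (conj p.1, conj p.2)) (conj p.2))) = p.2) :
    ∀ᶠ p : ℝ × ℝ in 𝓝 0, p.2 ≠ 0 → conj (H ((p.1 : ℂ), (p.2 : ℂ))) = H ((p.1 : ℂ), (p.2 : ℂ)) := by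
  have hemb : Filter.Tendsto (fun p : ℝ × ℝ => ((p.1 : ℂ), (p.2 : ℂ))) (𝓝 0) (𝓝 0) :=
    Continuous.tendsto' (by fun_prop) _ _ (by simp)
  have hfst : Filter.Tendsto (fun p : ℂ × ℂ => p.1) (𝓝 0) (𝓝 0) := continuous_fst.tendsto' _ _ rfl
  have hYt : Filter.Tendsto Y (𝓝 0) (𝓝 0) := by simpa [hY0] using hY.tendsto
  have hψt : Filter.Tendsto ψ (𝓝 0) (𝓝 0) := by simpa [hψ0] using hψ.tendsto
  have hcj : Filter.Tendsto (fun z : ℂ => conj z) (𝓝 0) (𝓝 0) :=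
    Complex.continuous_conj.tendsto' _ _ (map_zero _)
  have hpt : Filter.Tendsto (fun p : ℂ × ℂ => (p.1, Y p)) (𝓝 0) (𝓝 0) := hfst.prodMk_nhds hYt
  have hF : Filter.Tendsto (fun p : ℂ × ℂ => logPoint n (ψ p) p.2) (𝓝 0) (𝓝 0) := by
    have h1 : Filter.Tendsto (fun p : ℂ × ℂ => logPoint n p.1 p.2) (𝓝 0) (𝓝 0) := by
      simpa using (analyticAt_logPoint n 0).continuousAt.tendsto
    exact h1.comp (hψt.prodMk_nhds (continuous_snd.tendsto' _ _ rfl))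
  have hw : Filter.Tendsto (fun p : ℂ × ℂ => (p.1, conj (logPoint n (ψ (p.1, Y p)) (Y p))))
      (𝓝 0) (𝓝 0) := hfst.prodMk_nhds (hcj.comp (hF.comp hpt))
  have hy : Filter.Tendsto (fun p : ℂ × ℂ => (p.1, conj (Y p))) (𝓝 0) (𝓝 0) :=
    hfst.prodMk_nhds (hcj.comp hYt)
  filter_upwards [hemb.eventually hYr, hemb.eventually (hw.eventually hYl),
    hemb.eventually (hpt.eventually hH), hemb.eventually (hy.eventually hsymm)] with p h1 h2 h3 h4 hp
  obtain ⟨x, u⟩ := p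
  dsimp only at h1 h2 h3 h4 hp ⊢
  simp only [Complex.conj_ofReal, Complex.conj_conj] at h4
  set y := Y ((x : ℂ), (u : ℂ)) with hydef
  set w := logPoint n (ψ ((x : ℂ), y)) y with hwdef
  -- the point conjugate to `w` has the same `U`, hence is `y`
  have hsum : conj w + conj y = 2 * u := by
    rw [← map_add, show w + y = 2 * (u : ℂ) by rw [← h1]; ring]
    simp only [map_mul, Complex.conj_ofReal, map_ofNat]
  rw [h4, show (conj y + conj w) / 2 = (u : ℂ) by rw [add_comm, hsum]; ring, ← hydef] at h2
  have hu : (u : ℂ) ^ (n + 1) ≠ 0 := pow_ne_zero _ (by exact_mod_cast hp)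
  rw [h1] at h3
  have hHe : H ((x : ℂ), (u : ℂ)) = (w - y) / (2 * Complex.I) / (u : ℂ) ^ (n + 1) := by
    rw [h3]; field_simp
  rw [hHe, h2]
  simp only [map_div₀, map_sub, map_mul, map_pow, Complex.conj_ofReal, Complex.conj_conj,
    Complex.conj_I, map_ofNat]
  rw [mul_neg, div_neg, ← neg_div, neg_sub]

/-- A symmetric family `w = logPoint n (ψ (z ξ̄, η̄)) η̄` is the Segre family of a hypersurface. -/
theorem PositiveSegreFamily.exists_hypersurface {n : ℕ} (S : PositiveSegreFamily)
    (hψ : AnalyticAt ℂ S.ψ 0)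
    (hsymm : ∀ᶠ p in 𝓝 (0 : ℂ × ℂ),
      logPoint n (S.ψ (p.1, conj (logPoint n (S.ψ (conj p.1, conj p.2)) (conj p.2))))
        (conj (logPoint n (S.ψ (conj p.1, conj p.2)) (conj p.2))) = p.2) :
    ∃ M : Set (ℂ × ℂ), IsPositiveAdmissibleHypersurface (n + 1) M ∧
      IsSegreFamilyOf (S.graph (n + 1)) M := by
  have hψ0 : ∀ᶠ y in 𝓝 (0 : ℂ), S.ψ (0, y) = 0 :=
    Filter.eventually_of_mem (Metric.ball_mem_nhds 0 S.ε_pos) S.psi_zero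
  obtain ⟨Y, H, hY, hY0, hH, hYr, hYl, hH0, hHid⟩ := exists_graph_function n hψ hψ0
    (Filter.eventually_of_mem (Metric.ball_mem_nhds 0 S.ε_pos) S.psi_deriv)
  have hreal := conj_graph_function_eq hY.continuousAt hY0 hψ.continuousAt hψ0.self_of_nhds
    hYr hYl hHid hsymm
  set h : ℝ × ℝ → ℝ := fun p => (H ((p.1 : ℂ), (p.2 : ℂ))).re with hh
  have hemb : ∀ p, AnalyticAt ℝ (fun p : ℝ × ℝ => ((p.1 : ℂ), (p.2 : ℂ))) p := fun p =>
    ((Complex.ofRealCLM.analyticAt _).comp analyticAt_fst).prod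
      ((Complex.ofRealCLM.analyticAt _).comp analyticAt_snd)
  have hha : AnalyticAt ℝ h 0 := by
    have h1 : AnalyticAt ℝ (fun p : ℝ × ℝ => H ((p.1 : ℂ), (p.2 : ℂ))) 0 :=
      AnalyticAt.fun_comp (f := fun p : ℝ × ℝ => ((p.1 : ℂ), (p.2 : ℂ)))
        (hH.restrictScalars (𝕜 := ℝ)) (hemb 0)
    exact (Complex.reCLM.analyticAt _).comp h1
  have hofReal : Filter.Tendsto (fun u : ℝ => (u : ℂ)) (𝓝 0) (𝓝 0) :=
    Complex.continuous_ofReal.tendsto' _ _ rfl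
  set g : ℂ × ℂ → ℝ := fun Z => Z.2.im - Z.2.re ^ (n + 1) * h (‖Z.1‖ ^ 2, Z.2.re) with hg
  have hpt : AnalyticAt ℝ (fun Z : ℂ × ℂ => (‖Z.1‖ ^ 2, Z.2.re)) 0 :=
    (analyticAt_norm_sq analyticAt_fst).prod ((Complex.reCLM.analyticAt _).comp analyticAt_snd)
  have hpt00 : ((‖(0 : ℂ × ℂ).1‖ ^ 2, (0 : ℂ × ℂ).2.re) : ℝ × ℝ) = 0 := by simp
  have hga : AnalyticAt ℝ g 0 := by
    have h1 : AnalyticAt ℝ (fun Z : ℂ × ℂ => h (‖Z.1‖ ^ 2, Z.2.re)) 0 :=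
      AnalyticAt.fun_comp (f := fun Z : ℂ × ℂ => (‖Z.1‖ ^ 2, Z.2.re)) (by rwa [hpt00]) hpt
    exact ((Complex.imCLM.analyticAt _).comp analyticAt_snd).sub
      ((((Complex.reCLM.analyticAt _).comp analyticAt_snd).pow (n + 1)).mul h1)
  have hg' : fderiv ℝ g 0 ≠ 0 := by
    intro hzero
    have hline : HasDerivAt (fun t : ℝ => t • ((0, Complex.I) : ℂ × ℂ)) ((0, Complex.I) : ℂ × ℂ) 0 := by
      simpa using (hasDerivAt_id (0 : ℝ)).smul_const ((0, Complex.I) : ℂ × ℂ)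
    have h1 := HasFDerivAt.comp_hasDerivAt (f := fun t : ℝ => t • ((0, Complex.I) : ℂ × ℂ)) (0 : ℝ)
      (l := g) (l' := fderiv ℝ g 0) (by rw [zero_smul]; exact hga.differentiableAt.hasFDerivAt) hline
    have h2 : (g ∘ fun t : ℝ => t • ((0, Complex.I) : ℂ × ℂ)) = id := by
      funext t
      simp [hg]
    rw [h2, hzero] at h1
    exact one_ne_zero ((hasDerivAt_id (0 : ℝ)).unique h1)
  set φ : (ℂ × ℂ) × (ℂ × ℂ) → ℂ := fun q => (q.1.2 - q.2.2) / (2 * Complex.I) -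
    ((q.1.2 + q.2.2) / 2) ^ (n + 1) * H (q.1.1 * q.2.1, (q.1.2 + q.2.2) / 2) with hφ
  have hpair : AnalyticAt ℂ (fun q : (ℂ × ℂ) × (ℂ × ℂ) =>
      (q.1.1 * q.2.1, (q.1.2 + q.2.2) / 2)) 0 :=
    ((analyticAt_fst.comp analyticAt_fst).mul (analyticAt_fst.comp analyticAt_snd)).prod
      (((analyticAt_snd.comp analyticAt_fst).add (analyticAt_snd.comp analyticAt_snd)).div_const)
  have hpair00 : (((0 : (ℂ × ℂ) × (ℂ × ℂ)).1.1 * (0 : (ℂ × ℂ) × (ℂ × ℂ)).2.1,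
      ((0 : (ℂ × ℂ) × (ℂ × ℂ)).1.2 + (0 : (ℂ × ℂ) × (ℂ × ℂ)).2.2) / 2) : ℂ × ℂ) = 0 := by simp
  have hpair0 : Filter.Tendsto (fun q : (ℂ × ℂ) × (ℂ × ℂ) =>
      (q.1.1 * q.2.1, (q.1.2 + q.2.2) / 2)) (𝓝 0) (𝓝 0) :=
    hpair00 ▸ hpair.continuousAt.tendsto
  have hφa : AnalyticAt ℂ φ 0 := by
    have h1 : AnalyticAt ℂ (fun q : (ℂ × ℂ) × (ℂ × ℂ) =>
        H (q.1.1 * q.2.1, (q.1.2 + q.2.2) / 2)) 0 :=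
      AnalyticAt.fun_comp (f := fun q : (ℂ × ℂ) × (ℂ × ℂ) =>
        (q.1.1 * q.2.1, (q.1.2 + q.2.2) / 2)) (by rwa [hpair00]) hpair
    exact (((analyticAt_snd.comp analyticAt_fst).sub
      (analyticAt_snd.comp analyticAt_snd)).div_const).sub
      (((((analyticAt_snd.comp analyticAt_fst).add
        (analyticAt_snd.comp analyticAt_snd)).div_const).pow (n + 1)).mul h1)
  refine ⟨{Z | g Z = 0}, ⟨h, hha, ?_, ?_⟩, φ, g, hφa, ⟨?_, hga, hg', ?_⟩, ?_, ?_⟩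
  · filter_upwards [hofReal.eventually hH0] with u hu
    refine ⟨by simp [hh, hu.1], ?_⟩
    have h1 : HasDerivAt (fun x => H (x, (u : ℂ))) (1 / 2) ((0 : ℝ) : ℂ) := by simpa using hu.2
    have h2 := h1.real_of_complex
    norm_num at h2 ⊢
    exact h2
  · exact Filter.Eventually.of_forall fun Z => sub_eq_zero
  · simp [hg]
  · exact Filter.Eventually.of_forall fun Z => Iff.rfl
  · have hpt0 : Filter.Tendsto (fun Z : ℂ × ℂ => ((‖Z.1‖ ^ 2, Z.2.re) : ℝ × ℝ)) (𝓝 0) (𝓝 0) := by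
      have := hpt.continuousAt.tendsto
      rwa [hpt00] at this
    filter_upwards [hpt0.eventually hreal] with Z hZ
    have h1 : (Z.2 + conj Z.2) / 2 = (Z.2.re : ℂ) := by rw [Complex.add_conj]; push_cast; ring
    have h2 : (Z.2 - conj Z.2) / (2 * Complex.I) = (Z.2.im : ℂ) := by
      have hI := Complex.I_ne_zero
      rw [Complex.sub_conj]; push_cast; field_simp
    have h3 : Z.1 * conj Z.1 = ((‖Z.1‖ ^ 2 : ℝ) : ℂ) := by rw [Complex.mul_conj']; push_cast; rfl
    simp only [hφ, hg, h1, h2, h3]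
    rcases eq_or_ne Z.2.re 0 with h0 | h0
    · simp [h0]
    · have h4 := Complex.conj_eq_iff_re.1 (hZ h0)
      simp only [hh]
      rw [← h4]
      push_cast
      simp
  · -- `φ = 0` determines `(w, η̄)` from the sum and the difference of the two
    have hcj2 : Filter.Tendsto (fun q : (ℂ × ℂ) × (ℂ × ℂ) => ((q.1, (conj q.2.1, conj q.2.2)) :
        (ℂ × ℂ) × (ℂ × ℂ))) (𝓝 0) (𝓝 0) := by
      have := Complex.continuous_conj
      exact Continuous.tendsto' (by fun_prop) _ _ (by simp)
    have hA : Filter.Tendsto (fun q : (ℂ × ℂ) × (ℂ × ℂ) => (q.1.1 * q.2.1, q.2.2)) (𝓝 0) (𝓝 0) :=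
      Continuous.tendsto' (by fun_prop) _ _ (by simp)
    have hYt : Filter.Tendsto (fun p : ℂ × ℂ => (p.1, Y p)) (𝓝 0) (𝓝 0) := by
      have h1 : Filter.Tendsto Y (𝓝 0) (𝓝 0) := by simpa [hY0] using hY.continuousAt.tendsto
      exact (continuous_fst.tendsto' _ _ rfl).prodMk_nhds h1
    have hkey : ∀ᶠ q : (ℂ × ℂ) × (ℂ × ℂ) in 𝓝 0,
        φ q = 0 ↔ q.1.2 = logPoint n (S.ψ (q.1.1 * q.2.1, q.2.2)) q.2.2 := by
      filter_upwards [hpair0.eventually hYr, hpair0.eventually (hYt.eventually hHid),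
        hA.eventually hHid] with q h1 h2 h3
      have hI : (2 * Complex.I) ≠ 0 := by simp
      simp only [hφ]
      rw [sub_eq_zero]
      constructor
      · intro h4
        rw [h1, ← h4, div_left_inj' hI] at h2
        have h5 : logPoint n (S.ψ (q.1.1 * q.2.1, Y (q.1.1 * q.2.1, (q.1.2 + q.2.2) / 2)))
            (Y (q.1.1 * q.2.1, (q.1.2 + q.2.2) / 2)) +
            Y (q.1.1 * q.2.1, (q.1.2 + q.2.2) / 2) = q.1.2 + q.2.2 := by
          linear_combination 2 * h1
        have h6 : Y (q.1.1 * q.2.1, (q.1.2 + q.2.2) / 2) = q.2.2 := by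
          linear_combination (h5 - h2) / 2
        rw [h6] at h2
        linear_combination -h2
      · intro h4
        rw [← h4] at h3
        exact h3
    filter_upwards [hcj2.eventually hkey] with q hq
    exact hq

/-- An equation of real form has a positive real structure. -/
theorem hasPositiveRealStructure_of_hasRealForm {n : ℕ} {P Q a : ℂ → ℂ} {r : ℝ} (hr : 0 < r)
    (hP : DifferentiableOn ℂ P (Metric.ball 0 r)) (hQ : DifferentiableOn ℂ Q (Metric.ball 0 r))
    (hPQ : HasRealForm n P Q r a) : HasPositiveRealStructure (n + 1) P Q := by
  obtain ⟨ρ, X, X', hX⟩ := exists_isLogSolution n hr hP hQ 0 1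
  obtain ⟨S, hS, hψ, hri, hle⟩ := hX.exists_segreFamily
  obtain ⟨M, hM, hSM⟩ := S.exists_hypersurface hψ
    (hX.eventually_logPoint_symm hP hPQ hψ hri hle)
  exact ⟨M, hM, S, hS, hSM⟩

/-! ### The criterion -/

theorem IsRealPowerSeriesOn.differentiableOn {a : ℂ → ℂ} {r : ℝ} (ha : IsRealPowerSeriesOn a r) :
    DifferentiableOn ℂ a (Metric.ball 0 r) := by
  obtain ⟨c, hc⟩ := ha
  intro w hw
  obtain ⟨t, hwt, htr⟩ := exists_between (mem_ball_zero_iff.1 hw)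
  lift t to NNReal using (norm_nonneg w).trans hwt.le
  set p := FormalMultilinearSeries.ofScalars ℂ (fun j => (c j : ℂ)) with hp
  have hrad : (t : ENNReal) ≤ p.radius := by
    refine p.le_radius_of_tendsto (l := 0) ?_
    have h1 := (hc (t : ℂ) (by simpa using htr)).summable.tendsto_atTop_zero.norm
    simpa [hp, FormalMultilinearSeries.ofScalars_norm] using h1
  have hball : HasFPowerSeriesOnBall a p 0 t := by
    refine ⟨hrad, by exact_mod_cast (norm_nonneg w).trans_lt hwt, fun {y} hy => ?_⟩
    have hy' : y ∈ Metric.ball (0 : ℂ) r := by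
      rw [Metric.eball_coe] at hy
      exact Metric.ball_subset_ball htr.le hy
    simpa [hp, FormalMultilinearSeries.ofScalars_apply_eq, mul_comm] using hc y hy'
  have hmem : w ∈ Metric.eball (0 : ℂ) t := by
    rw [Metric.eball_coe]
    simpa using hwt
  exact (hball.analyticAt_of_mem hmem).differentiableAt.differentiableWithinAt

/-- The coefficients of an equation with a positive real structure are of real form. -/
theorem IsPositivelyAssociatedHypersurface.exists_real_form {n : ℕ} {P Q : ℂ → ℂ} {r : ℝ}
    {M : Set (ℂ × ℂ)} (hr : 0 < r) (hP : DifferentiableOn ℂ P (Metric.ball 0 r))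
    (hQ : DifferentiableOn ℂ Q (Metric.ball 0 r))
    (hM : IsPositivelyAssociatedHypersurface (n + 1) P Q M) :
    ∃ a b : ℂ → ℂ, IsRealPowerSeriesOn a r ∧ IsRealPowerSeriesOn b r ∧
      ∀ w ∈ Metric.ball (0 : ℂ) r, P w = 2 * Complex.I * a w - ((n : ℂ) + 1) * w ^ n ∧
        Q w = b w + Complex.I * w ^ (n + 1) * deriv a w := by
  obtain ⟨-, S, hS, hSM⟩ := hM
  obtain ⟨ρ, X, X', hX⟩ := exists_isLogSolution n hr hP hQ 0 1
  have hX1 := hX.mono (lt_min hX.pos one_pos) (min_le_left ρ 1)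
  obtain ⟨a, b, ha, hb, -, h⟩ := exists_real_form_of_reflection hP hQ hX1
    (exists_reflection_of_isSegreFamilyOf hQ hS hSM hX1 (min_le_right _ _))
  exact ⟨a, b, ha, hb, h⟩

theorem theorem3p15 (m : ℕ) (hm : 1 ≤ m) (r : ℝ) (hr : 0 < r) (P Q : ℂ → ℂ)
    (hP : DifferentiableOn ℂ P (Metric.ball 0 r))
    (hQ : DifferentiableOn ℂ Q (Metric.ball 0 r)) :
    (HasPositiveRealStructure m P Q ↔
      ∃ a b : ℂ → ℂ, IsRealPowerSeriesOn a r ∧ IsRealPowerSeriesOn b r ∧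
        ∀ w ∈ Metric.ball (0 : ℂ) r,
          P w = 2 * Complex.I * a w - (m : ℂ) * w ^ (m - 1) ∧
          Q w = b w + Complex.I * w ^ m * deriv a w) ∧
    ∀ M : Set (ℂ × ℂ), IsPositivelyAssociatedHypersurface m P Q M →
      ∀ᶠ p : ℂ × ℂ in 𝓝 0, p ∈ M → p.2 ≠ 0 →
        IsLeviNondegenerateAt M p ∧ IsSphericalAt M p := by
  obtain ⟨n, rfl⟩ := Nat.exists_eq_add_of_le' hm
  simp only [Nat.add_sub_cancel, Nat.cast_add, Nat.cast_one]
  refine ⟨⟨fun ⟨M, hM⟩ => hM.exists_real_form hr hP hQ, fun ⟨a, b, ha, hb, h⟩ => ?_⟩,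
    fun M hM => ?_⟩
  · exact hasPositiveRealStructure_of_hasRealForm hr hP hQ
      (hasRealForm_of_isRealPowerSeriesOn ha hb ha.differentiableOn h)
  · obtain ⟨a, b, ha, hb, h⟩ := hM.exists_real_form hr hP hQ
    filter_upwards [eventually_isSphericalAt hr hP hQ hM
      (hasRealForm_of_isRealPowerSeriesOn ha hb ha.differentiableOn h)] with p hp hpM hpw
    exact ⟨(hp hpM hpw).isLeviNondegenerateAt, hp hpM hpw⟩
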